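/- Let $p,q,m$ be positive integers and let $\ell(\pi)$ be the smallest number of transpositions whose product is $\pi\in\mathcal S_{p+q}$. Write $\pi\le\sigma$ if $\ell(\sigma)=\ell(\pi)+\ell(\pi^{-1}\sigma)$, and let $\alpha_{p,q}=(1\,2\cdots p)(p+1\,\cdots\,p+q)$. A permutation in $\mathcal S_{p+q}$ is called connected if one of its cycles meets both $\{1,\dots,p\}$ and $\{p+1,\dots,p+q\}$, and disconnected otherwise. Let $\overline{\mathcal S}^A_{\mathrm{nc}}(p,q)$ be the set of pairs $(\pi,z)$ with $\pi\in\mathcal S_{p+q}$ and $z\in\{0,1\}$ such that: (1) if $\pi$ is disconnected, then $\pi\le\alpha_{p,q}$; (2) if $\pi$ is connected, then $\ell(\alpha_{p,q})=\ell(\pi)+\ell(\pi^{-1}\alpha_{p,q})-2$; (3) if $z=1$, then $\pi$ is disconnected. Write $(\pi,z)\le(\sigma,w)$ if either $z=w$ and $\pi\le\sigma$, or $z=0$, $w=1$, $\pi$ is connected, $\sigma$ is disconnected and $\ell(\sigma)=\ell(\pi)+\ell(\pi^{-1}\sigma)-2$. Put $\operatorname{rank}(\pi,z)=\ell(\pi)+2z$.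 A connected multichain of length $m$ is a sequence $(\pi_1,z_1)\le(\pi_2,z_2)\le\cdots\le(\pi_m,z_m)$ in $\overline{\mathcal S}^A_{\mathrm{nc}}(p,q)$ (each term related to the next one) in which at least one $\pi_i$ is connected. Then there is a bijection from the set of all tuples $(c,d;L^E,R_1^E,\dots,R_m^E;L^I,R_1^I,\dots,R_m^I)$ of integers $c\ge1$, $1\le d\le c$, and sets $$L^E,R_1^E,\dots,R_m^E\subseteq\{1,\dots,p\},\qquad |L^E|=|R_1^E|+\cdots+|R_m^E|+c,$$ $$L^I,R_1^I,\dots,R_m^I\subseteq\{p+1,\dots,p+q\},\qquad |L^I|=|R_1^I|+\cdots+|R_m^I|-c,$$ onto the set of all connected multichains of length $m$ in $\overline{\mathcal S}^A_{\mathrm{nc}}(p,q)$, such that the multichain corresponding to a tuple satisfies $$\operatorname{rank}(\pi_i,z_i)=p+q-\bigl(|R_i^E|+\cdots+|R_m^E|+|R_i^I|+\cdots+|R_m^I|\bigr),\qquad 1\le i\le m.$$ -/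

import Mathlib

namespace AnnularNC

/-- The ground set `{1, …, p + q}`, split into the outer points `{1, …, p}` (`Sum.inl i` is the
number `i + 1`) and the inner points `{p + 1, …, p + q}` (`Sum.inr j` is the number
`p + j + 1`). -/
abbrev Pt (p q : ℕ) : Type := Fin p ⊕ Fin q

/-- The absolute length: the smallest `k` such that `π` is a product of `k` transpositions. -/
noncomputable def absLength {X : Type*} [DecidableEq X] (π : Equiv.Perm X) : ℕ :=
  sInf {k : ℕ | ∃ l : List (Equiv.Perm X), l.length = k ∧ (∀ t ∈ l, t.IsSwap) ∧ l.prod = π}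

/-- The absolute order: `π ≤ σ` iff `ℓ(σ) = ℓ(π) + ℓ(π⁻¹ σ)`. -/
def AbsLE {X : Type*} [DecidableEq X] (π σ : Equiv.Perm X) : Prop :=
  absLength σ = absLength π + absLength (π⁻¹ * σ)

/-- The permutation `α_{p,q} = (1 2 … p)(p+1 p+2 … p+q)`. -/
def alpha (p q : ℕ) : Equiv.Perm (Pt p q) :=
  Equiv.sumCongr (finRotate p) (finRotate q)

/-- A permutation is connected if one of its cycles meets both `{1, …, p}` and
`{p + 1, …, p + q}`. -/
def IsConn {p q : ℕ} (π : Equiv.Perm (Pt p q)) : Prop :=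
  ∃ (i : Fin p) (j : Fin q), π.SameCycle (Sum.inl i) (Sum.inr j)

/-- Marked annular noncrossing permutations `(π, z)` of type `A`, with `z ∈ {0, 1}`. -/
structure MarkedPerm (p q : ℕ) where
  perm : Equiv.Perm (Pt p q)
  mark : Fin 2
  le_of_disconnected : ¬ IsConn perm → AbsLE perm (alpha p q)
  length_of_connected : IsConn perm →
    absLength (alpha p q) + 2 = absLength perm + absLength (perm⁻¹ * alpha p q)
  disconnected_of_mark : mark = 1 → ¬ IsConn perm

/-- The relation `(π, z) ≤ (σ, w)`: either `z = w` and `π ≤ σ`, or `z = 0`, `w = 1`, `π` is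
connected, `σ` is disconnected and `ℓ(σ) = ℓ(π) + ℓ(π⁻¹ σ) - 2`. -/
def MarkedPerm.Rel {p q : ℕ} (x y : MarkedPerm p q) : Prop :=
  (x.mark = y.mark ∧ AbsLE x.perm y.perm) ∨
  (x.mark = 0 ∧ y.mark = 1 ∧ IsConn x.perm ∧ ¬ IsConn y.perm ∧
    absLength y.perm + 2 = absLength x.perm + absLength (x.perm⁻¹ * y.perm))

/-- The rank `ℓ(π) + 2 z` of `(π, z)`. -/
noncomputable def MarkedPerm.rank {p q : ℕ} (x : MarkedPerm p q) : ℕ :=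
  absLength x.perm + 2 * (x.mark : ℕ)

/-- Connected multichains `x 0 ≤ x 1 ≤ ⋯ ≤ x (m - 1)` of marked annular noncrossing permutations:
at least one of the permutations is connected. -/
structure ConnMultichain (p q m : ℕ) where
  elt : Fin m → MarkedPerm p q
  step : ∀ i j : Fin m, (j : ℕ) = (i : ℕ) + 1 → (elt i).Rel (elt j)
  connected : ∃ i : Fin m, IsConn (elt i).perm

/-- The tuples `(c, d; L^E, R_1^E, …, R_m^E; L^I, R_1^I, …, R_m^I)`. The sets with upper index `E`
are sets of outer points, those with upper index `I` are sets of inner points, and `R_i` is the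
value at index `i - 1`. -/
structure ParenTuple (p q m : ℕ) where
  c : ℕ
  d : ℕ
  LE : Finset (Fin p)
  RE : Fin m → Finset (Fin p)
  LI : Finset (Fin q)
  RI : Fin m → Finset (Fin q)
  one_le_c : 1 ≤ c
  one_le_d : 1 ≤ d
  d_le_c : d ≤ c
  card_LE : (LE.card : ℤ) = (∑ i, ((RE i).card : ℤ)) + c
  card_LI : (LI.card : ℤ) = (∑ i, ((RI i).card : ℤ)) - c

end AnnularNC

/-! Write α for `alpha p q`. Put 1 in front of a multichain and α at its end: the quotients of
consecutive permutations are factors β₀, …, β_m with product α. Call excess the amount by which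
lengths of factors add up to more than the length of their product; it is even and nonnegative.
Connected multichains correspond to the factorizations of α of total length ℓ(α) + 2 = p + q in
which some factor moves a point across the two sides (`factorizationEquiv`). Indeed, at a partial
product π the excess 2 is spent entirely before π (mark 1), entirely after π (disconnected, mark 0),
or in ℓ(π) + ℓ(π⁻¹α) (connected); this is `chain_cases`. So the marks are determined by the factors,
and the rank of a term is the total length of the factors up to it.

Factorizations are counted with weight ∏ tᵢ ^ ℓ(βᵢ). On the other side, add the complements of L^E
and L^I to the R's as sets of index 0. A tuple becomes m + 1 subsets of each side with total sizes p
- c and q + c, so with φ(u) = ∏ (1 + tᵢ u) the tuples have generating polynomial ∑ c · [u^(p-c)] φ^p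
· [u^(q+c)] φ^q, the factor c counting the values of d. Once the two polynomials agree, the fibres
over each exponent vector have equal size, and a bijection is chosen fibre by fibre
(`exists_equiv_of_sum_eq`); it is not explicit.

For the count, the support of the last factor is enlarged one point at a time (`facSumOn_insert`),
which multiplies the target permutation by transpositions. A transposition cuts a cycle or joins
two. At minimal total length only cuts occur, so the weight is a product over cycles
(`coeff_allSum_state`). At excess 2, with colours mixed, exactly one join of an outer and an inner
cycle occurs (`coeff_conSum_state`). The resulting recursions are solved by lattice walks. A cycle
of length k has the weight of the k-step walks with step polynomial φ(u)/u from height 0 that first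
reach -1 at the end. Two cycles of lengths a and b have weight a times that of first passages in a
steps, started at height c - 1 with weight [u^c] (φ(u)/u)^b for c ≥ 1 (`annulusWeights`, by the
kernel method). The cycle lemma `succ_mul_hitWeight` turns this into the sum above. -/

set_option linter.unusedSectionVars false

namespace AnnularNC

/-! ### Absolute length, cycles and geodesics -/

section AbsLength

variable {X : Type*} [DecidableEq X] [Finite X]

open Equiv Equiv.Perm

/-- The number of cycles of a permutation, fixed points included. -/
noncomputable def orbitCount (σ : Perm X) : ℕ := Nat.card (Quotient (SameCycle.setoid σ))

/-- The product sends `a` to `σ b` and then follows the `σ`-orbit of `b`, which avoids `a`, until it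
returns to `b`; `N` is the return time. -/
theorem sameCycle_mul_swap {σ : Perm X} {a b : X} (h : ¬ σ.SameCycle a b) :
    (σ * swap a b).SameCycle a b := by
  obtain ⟨n, hn, hb⟩ : ∃ n, 0 < n ∧ (σ ^ n) b = b :=
    ⟨orderOf σ, orderOf_pos σ, by simp [pow_orderOf_eq_one]⟩
  classical
  have hex : ∃ n, 0 < n ∧ (σ ^ n) b = b := ⟨n, hn, hb⟩
  obtain ⟨hpos, hfix⟩ := Nat.find_spec hex
  set N := Nat.find hex
  have key : ∀ i, i + 1 ≤ N → ((σ * swap a b) ^ (i + 1)) a = (σ ^ (i + 1)) b := by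
    intro i
    induction i with
    | zero => intro _; simp
    | succ i ih =>
      intro hi
      rw [pow_succ', Perm.mul_apply, ih (by omega), pow_succ' σ (i + 1), Perm.mul_apply,
        Perm.mul_apply]
      have h1 : (σ ^ (i + 1)) b ≠ b := fun e =>
        Nat.find_min hex (m := i + 1) (by omega) ⟨by omega, e⟩
      have h2 : (σ ^ (i + 1)) b ≠ a := fun e => h (SameCycle.symm ⟨((i + 1 : ℕ) : ℤ), by rw [zpow_natCast]; exact e⟩)
      rw [swap_apply_of_ne_of_ne h2 h1]
  refine ⟨(N : ℕ), ?_⟩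
  obtain ⟨k, hk⟩ : ∃ k, N = k + 1 := ⟨N - 1, by omega⟩
  rw [zpow_natCast, hk, key k (by omega), ← hk, hfix]

/-- With `N` the first time at which `σ` carries `a` to `b`, the orbit of `b` under the product
stays among `σ a, …, σ ^ N a = b` and never meets `a`. -/
theorem not_sameCycle_mul_swap {σ : Perm X} {a b : X} (hab : a ≠ b) (h : σ.SameCycle a b) :
    ¬ (σ * swap a b).SameCycle a b := by
  classical
  have hex : ∃ n, (σ ^ n) a = b := by
    obtain ⟨n, hn⟩ := h.exists_nat_pow_eq
    exact ⟨n, hn⟩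
  have hfix := Nat.find_spec hex
  set N := Nat.find hex with hN
  have hmin : ∀ i < N, (σ ^ i) a ≠ b := fun i hi => Nat.find_min hex hi
  have hpos : 0 < N := by
    rcases Nat.eq_zero_or_pos N with h0 | h0
    · rw [h0] at hfix; exact absurd hfix hab
    · exact h0
  have hne : ∀ i, 0 < i → i ≤ N → (σ ^ i) a ≠ a := by
    intro i h0 hi e
    apply hmin (N - i) (by omega)
    rw [← hfix]
    conv_rhs => rw [show N = (N - i) + i by omega, pow_add, Perm.mul_apply, e]
  have step : ∀ i, 0 < i → i < N → (σ * swap a b) ((σ ^ i) a) = (σ ^ (i + 1)) a := by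
    intro i h0 hi
    rw [Perm.mul_apply, swap_apply_of_ne_of_ne (hne i h0 hi.le) (hmin i hi), pow_succ',
      Perm.mul_apply]
  have key : ∀ k : ℕ, ∃ i, 0 < i ∧ i ≤ N ∧ ((σ * swap a b) ^ k) b = (σ ^ i) a := by
    intro k
    induction k with
    | zero => exact ⟨N, hpos, le_rfl, by simp [hfix]⟩
    | succ k ih =>
      obtain ⟨i, h0, hi, e⟩ := ih
      rw [pow_succ', Perm.mul_apply, e]
      rcases hi.lt_or_eq with hlt | rfl
      · exact ⟨i + 1, by omega, hlt, step i h0 hlt⟩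
      · exact ⟨1, by omega, hpos, by rw [hfix]; simp⟩
  intro hs
  obtain ⟨k, hk⟩ := hs.symm.exists_nat_pow_eq
  obtain ⟨i, h0, hi, e⟩ := key k
  exact hne i h0 hi (e.symm.trans hk)

theorem SameCycle.of_mul_swap {σ : Perm X} {a b x y : X} (hab : σ.SameCycle a b)
    (h : (σ * swap a b).SameCycle x y) : σ.SameCycle x y := by
  have step : ∀ x, σ.SameCycle x ((σ * swap a b) x) := by
    intro x
    rw [Perm.mul_apply, sameCycle_apply_right]
    rcases eq_or_ne x a with rfl | ha
    · simpa using hab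
    rcases eq_or_ne x b with rfl | hb
    · simpa using hab.symm
    rw [swap_apply_of_ne_of_ne ha hb]
  obtain ⟨k, rfl⟩ := h.exists_nat_pow_eq
  clear h
  induction k with
  | zero => exact SameCycle.refl _ _
  | succ k ih => rw [pow_succ', Perm.mul_apply]; exact ih.trans (step _)

theorem mul_swap_mul_swap (σ : Perm X) (a b : X) : σ * swap a b * swap a b = σ := by
  rw [mul_assoc, swap_mul_self, mul_one]

theorem orbitCount_mul_swap_of_not {σ : Perm X} {a b : X} (h : ¬ σ.SameCycle a b) :
    orbitCount (σ * swap a b) + 1 = orbitCount σ := by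
  classical
  have hs' := sameCycle_mul_swap h
  have sub : ∀ x y, σ.SameCycle x y → (σ * swap a b).SameCycle x y := by
    intro x y hxy
    refine SameCycle.of_mul_swap hs' ?_
    rwa [mul_swap_mul_swap]
  -- the classes of `σ` other than that of `b` are in bijection with the classes of the product
  have hjoin : ∀ x y, (σ * swap a b).SameCycle x y →
      σ.SameCycle x y ∨ ((σ.SameCycle x a ∨ σ.SameCycle x b) ∧
        (σ.SameCycle y a ∨ σ.SameCycle y b)) := by
    intro x y hxy
    obtain ⟨k, rfl⟩ := hxy.exists_nat_pow_eq
    clear hxy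
    induction k with
    | zero => exact Or.inl (SameCycle.refl _ _)
    | succ k ih =>
      rw [pow_succ', Perm.mul_apply]
      generalize ((σ * swap a b) ^ k) x = z at ih
      rw [Perm.mul_apply]
      simp only [sameCycle_apply_right, sameCycle_apply_left]
      rcases eq_or_ne z a with rfl | ha
      · simp only [swap_apply_left]
        rcases ih with ih | ih
        · exact Or.inr ⟨Or.inl ih, Or.inr (SameCycle.refl _ _)⟩
        · exact Or.inr ⟨ih.1, Or.inr (SameCycle.refl _ _)⟩
      rcases eq_or_ne z b with rfl | hb
      · simp only [swap_apply_right]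
        rcases ih with ih | ih
        · exact Or.inr ⟨Or.inr ih, Or.inl (SameCycle.refl _ _)⟩
        · exact Or.inr ⟨ih.1, Or.inl (SameCycle.refl _ _)⟩
      rwa [swap_apply_of_ne_of_ne ha hb]
  let Q := Quotient (SameCycle.setoid σ)
  let Q' := Quotient (SameCycle.setoid (σ * swap a b))
  let f : Q → Q' := Quotient.map id (fun x y hxy => sub x y hxy)
  let pb : Q := Quotient.mk _ b
  have hbij : Function.Bijective (fun q : {q : Q // q ≠ pb} => f q.1) := by
    constructor
    · rintro ⟨q, hq⟩ ⟨r, hr⟩ hqr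
      induction q using Quotient.inductionOn with | _ x => ?_
      induction r using Quotient.inductionOn with | _ y => ?_
      have hxb : ¬ σ.SameCycle x b := fun e => hq (Quotient.sound e)
      have hyb : ¬ σ.SameCycle y b := fun e => hr (Quotient.sound e)
      have hxy : (σ * swap a b).SameCycle x y := Quotient.exact hqr
      apply Subtype.ext
      apply Quotient.sound
      rcases hjoin x y hxy with e | ⟨e1 | e1, e2 | e2⟩
      · exact e
      · exact e1.trans e2.symm
      all_goals first | exact absurd e2 hyb | exact absurd e1 hxb
    · intro q
      induction q using Quotient.inductionOn with | _ x => ?_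
      by_cases hx : σ.SameCycle x b
      · refine ⟨⟨Quotient.mk _ a, fun e => h (Quotient.exact e)⟩, ?_⟩
        exact Quotient.sound (hs'.trans (sub _ _ hx.symm))
      · exact ⟨⟨Quotient.mk _ x, fun e => hx (Quotient.exact e)⟩, rfl⟩
  have hc := Nat.card_eq_of_bijective _ hbij
  have : Fintype Q := Fintype.ofFinite Q
  unfold orbitCount
  rw [← hc, Nat.card_eq_fintype_card, Nat.card_eq_fintype_card]
  have hpos : 0 < Fintype.card Q := Fintype.card_pos_iff.mpr ⟨pb⟩
  rw [Fintype.card_subtype_compl, Fintype.card_subtype_eq]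
  exact Nat.sub_add_cancel hpos

theorem orbitCount_mul_swap_of_sameCycle {σ : Perm X} {a b : X} (hab : a ≠ b)
    (h : σ.SameCycle a b) : orbitCount (σ * swap a b) = orbitCount σ + 1 := by
  have := orbitCount_mul_swap_of_not (not_sameCycle_mul_swap hab h)
  rw [mul_swap_mul_swap] at this
  exact this.symm

theorem orbitCount_one : orbitCount (1 : Perm X) = Nat.card X := by
  refine (Nat.card_eq_of_bijective (fun x : X => (Quotient.mk (SameCycle.setoid 1) x))
    ⟨fun x y h => ?_, Quotient.mk_surjective⟩).symm
  exact sameCycle_one.mp (Quotient.exact h)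

theorem orbitCount_le (σ : Perm X) : orbitCount σ ≤ Nat.card X :=
  Nat.card_le_card_of_surjective _ (Quotient.mk_surjective (s := SameCycle.setoid σ))

theorem card_le_length_add_orbitCount (l : List (Perm X)) (hl : ∀ t ∈ l, t.IsSwap) :
    Nat.card X ≤ l.length + orbitCount l.prod := by
  induction l using List.reverseRecOn with
  | nil => simp [orbitCount_one]
  | append_singleton l t ih =>
    have h1 := ih (fun t ht => hl t (by simp [ht]))
    obtain ⟨a, b, hab, rfl⟩ := hl t (by simp)
    simp only [List.length_append, List.length_singleton, List.prod_append, List.prod_singleton]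
    by_cases hs : l.prod.SameCycle a b
    · have := orbitCount_mul_swap_of_sameCycle hab hs; omega
    · have := orbitCount_mul_swap_of_not hs; omega

theorem exists_swaps (σ : Perm X) : ∃ l : List (Perm X),
    l.length + orbitCount σ = Nat.card X ∧ (∀ t ∈ l, t.IsSwap) ∧ l.prod = σ := by
  induction hn : Nat.card X - orbitCount σ using Nat.strong_induction_on generalizing σ with
  | _ n ih =>
    by_cases h1 : σ = 1
    · exact ⟨[], by simp [h1, orbitCount_one]⟩
    obtain ⟨a, ha⟩ : ∃ a, σ a ≠ a := by
      by_contra hc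
      push Not at hc
      exact h1 (Equiv.ext hc)
    have hs : σ.SameCycle a (σ a) := by simp [sameCycle_apply_right, SameCycle.refl]
    have ho := orbitCount_mul_swap_of_sameCycle ha.symm hs
    have hle := orbitCount_le (σ * swap a (σ a))
    obtain ⟨l, hl1, hl2, hl3⟩ := ih _ (by omega) (σ * swap a (σ a)) rfl
    refine ⟨l ++ [swap a (σ a)], by simp; omega, ?_, ?_⟩
    · intro t ht
      rcases List.mem_append.mp ht with ht | ht
      · exact hl2 t ht
      · rw [List.mem_singleton.mp ht]; exact ⟨a, σ a, ha.symm, rfl⟩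
    · rw [List.prod_append, hl3, List.prod_singleton, mul_swap_mul_swap]

theorem absLength_add_orbitCount (σ : Perm X) : absLength σ + orbitCount σ = Nat.card X := by
  obtain ⟨l, hl1, hl2, hl3⟩ := exists_swaps σ
  apply le_antisymm
  · rw [← hl1]
    have hle : absLength σ ≤ l.length := Nat.sInf_le ⟨l, rfl, hl2, hl3⟩
    exact Nat.add_le_add_right hle _
  · have hne : {k : ℕ | ∃ l : List (Perm X), l.length = k ∧
      (∀ t ∈ l, t.IsSwap) ∧ l.prod = σ}.Nonempty := ⟨l.length, l, rfl, hl2, hl3⟩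
    obtain ⟨l', h1, h2, h3⟩ : ∃ l : List (Perm X), l.length = absLength σ ∧
      (∀ t ∈ l, t.IsSwap) ∧ l.prod = σ := Nat.sInf_mem hne
    have := card_le_length_add_orbitCount l' h2
    rw [h3, h1] at this
    exact this

theorem absLength_mul_swap_of_sameCycle {σ : Perm X} {a b : X} (hab : a ≠ b)
    (h : σ.SameCycle a b) : absLength (σ * swap a b) + 1 = absLength σ := by
  have h1 := absLength_add_orbitCount σ
  have h2 := absLength_add_orbitCount (σ * swap a b)
  have := orbitCount_mul_swap_of_sameCycle hab h
  omega

theorem absLength_mul_swap_of_not {σ : Perm X} {a b : X} (h : ¬ σ.SameCycle a b) :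
    absLength (σ * swap a b) = absLength σ + 1 := by
  have h1 := absLength_add_orbitCount σ
  have h2 := absLength_add_orbitCount (σ * swap a b)
  have := orbitCount_mul_swap_of_not h
  omega

theorem exists_swaps_absLength (σ : Perm X) : ∃ l : List (Perm X),
    l.length = absLength σ ∧ (∀ t ∈ l, t.IsSwap) ∧ l.prod = σ := by
  obtain ⟨l, h1, h2, h3⟩ := exists_swaps σ
  have := absLength_add_orbitCount σ
  exact ⟨l, by omega, h2, h3⟩

theorem absLength_le_of_prod {l : List (Perm X)} (hl : ∀ t ∈ l, t.IsSwap) :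
    absLength l.prod ≤ l.length := Nat.sInf_le ⟨l, rfl, hl, rfl⟩

theorem absLength_mul_le (σ τ : Perm X) : absLength (σ * τ) ≤ absLength σ + absLength τ := by
  obtain ⟨l, h1, h2, rfl⟩ := exists_swaps_absLength σ
  obtain ⟨l', h1', h2', rfl⟩ := exists_swaps_absLength τ
  rw [← List.prod_append, ← h1, ← h1', ← List.length_append]
  apply absLength_le_of_prod
  intro t ht
  rcases List.mem_append.mp ht with ht | ht
  exacts [h2 t ht, h2' t ht]

@[simp] theorem absLength_one : absLength (1 : Perm X) = 0 :=
  Nat.le_zero.mp (absLength_le_of_prod (l := []) (by simp))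

theorem sign_eq_neg_one_pow_absLength [Fintype X] (σ : Perm X) :
    sign σ = (-1) ^ absLength σ := by
  obtain ⟨l, h1, h2, rfl⟩ := exists_swaps_absLength σ
  rw [← h1, sign_prod_list_swap h2]

theorem even_absLength_mul (σ τ : Perm X) :
    Even (absLength (σ * τ) + absLength σ + absLength τ) := by
  have : Fintype X := Fintype.ofFinite X
  have h := sign_mul σ τ
  simp only [sign_eq_neg_one_pow_absLength] at h
  rw [← pow_add] at h
  have h2 : ((-1 : ℤˣ)) ^ (absLength (σ * τ) + absLength σ + absLength τ) = 1 := by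
    rw [add_assoc, pow_add, h, ← pow_add, ← two_mul, pow_mul]; simp
  by_contra hodd
  rw [Nat.not_even_iff_odd] at hodd
  rw [hodd.neg_one_pow] at h2
  exact absurd h2 (by decide)

variable {ι : Type*}

theorem color_eq_of_sameCycle {c : X → ι} {σ : Perm X} (h : ∀ x, c (σ x) = c x) {x y : X}
    (hxy : σ.SameCycle x y) : c x = c y := by
  obtain ⟨k, rfl⟩ := hxy.exists_nat_pow_eq
  clear hxy
  induction k with
  | zero => rfl
  | succ k ih => rw [pow_succ', Perm.mul_apply, h, ih]

/-- On a geodesic, each transposition of a shortest word for `β`, peeled off from the right, must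
cut a cycle of what is left of `σ`. Its two points then lie in one cycle and have the same colour.
-/
theorem color_preserved_of_geodesic {c : X → ι} {σ β : Perm X} (h : ∀ x, c (σ x) = c x)
    (hl : absLength (σ * β⁻¹) + absLength β ≤ absLength σ) :
    (∀ x, c (β x) = c x) ∧ ∀ x, c ((σ * β⁻¹) x) = c x := by
  obtain ⟨l, h1, h2, rfl⟩ := exists_swaps_absLength β
  rw [← h1] at hl
  clear h1
  induction l using List.reverseRecOn generalizing σ with
  | nil => simpa using h
  | append_singleton l t ih =>
    obtain ⟨a, b, hab, rfl⟩ := h2 t (by simp)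
    have h2' : ∀ t ∈ l, t.IsSwap := fun t ht => h2 t (by simp [ht])
    simp only [List.prod_append, List.prod_singleton, List.length_append,
      List.length_singleton, mul_inv_rev, swap_inv] at hl ⊢
    rw [← mul_assoc] at hl ⊢
    have hle : absLength (σ * swap a b) ≤ absLength (σ * swap a b * l.prod⁻¹) + l.length := by
      have := absLength_mul_le (σ * swap a b * l.prod⁻¹) l.prod
      rw [inv_mul_cancel_right] at this
      exact this.trans (Nat.add_le_add_left (absLength_le_of_prod h2') _)
    have hs : σ.SameCycle a b := by
      by_contra hs
      have := absLength_mul_swap_of_not hs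
      omega
    have hcut := absLength_mul_swap_of_sameCycle hab hs
    have hc := color_eq_of_sameCycle h hs
    have hsw : ∀ x, c (swap a b x) = c x := by
      intro x
      rcases eq_or_ne x a with rfl | ha
      · simp [hc]
      rcases eq_or_ne x b with rfl | hb
      · simp [hc]
      rw [swap_apply_of_ne_of_ne ha hb]
    obtain ⟨g1, g2⟩ := ih (σ := σ * swap a b) (fun x => by rw [Perm.mul_apply, h, hsw])
      h2' (by omega)
    exact ⟨fun x => by rw [Perm.mul_apply, g1, hsw], g2⟩

end AbsLength

end AnnularNC

namespace AnnularNC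

/-! ### Generating polynomials of factorizations -/

section FacSum

variable {X : Type*} [DecidableEq X] [Fintype X] {ι : Type*} [DecidableEq ι] {R : Type*} [CommRing R]

open Equiv Equiv.Perm

omit [DecidableEq X] [Fintype X] in
theorem apply_inv_apply (β : Perm X) (x : X) : β (β⁻¹ x) = x := by simp

open Polynomial in
/-- The generating polynomial of the factorizations `σ = β₀ β₁ ⋯ βₙ₋₁` into permutations which
preserve the colouring `c`. The factor `βᵢ` has weight `tᵢ ^ ℓ(βᵢ)`, and the variable records
the total length. -/
noncomputable def facSum (c : X → ι) (t : ℕ → R) : ℕ → Perm X → R[X]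
  | 0, σ => if σ = 1 then 1 else 0
  | n + 1, σ => ∑ β : Perm X with ∀ x, c (β x) = c x,
      (C (t n) * Polynomial.X) ^ absLength β * facSum c t n (σ * β⁻¹)

open Polynomial in
/-- The generating polynomial of the factorizations `σ = β₀ β₁ ⋯ βₙ` into permutations which
preserve the colouring `c`, where the support of `βₙ` is contained in `A`. -/
noncomputable def facSumOn (c : X → ι) (t : ℕ → R) (n : ℕ) (A : Finset X) (σ : Perm X) : R[X] :=
  ∑ β : Perm X with (∀ x, c (β x) = c x) ∧ ∀ x ∉ A, β x = x,
      (C (t n) * Polynomial.X) ^ absLength β * facSum c t n (σ * β⁻¹)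

theorem facSumOn_univ (c : X → ι) (t : ℕ → R) (n : ℕ) (σ : Perm X) :
    facSumOn c t n Finset.univ σ = facSum c t (n + 1) σ := by
  simp [facSumOn, facSum]

theorem facSumOn_empty (c : X → ι) (t : ℕ → R) (n : ℕ) (σ : Perm X) :
    facSumOn c t n ∅ σ = facSum c t n σ := by
  have : (Finset.univ.filter fun β : Perm X => (∀ x, c (β x) = c x) ∧
      ∀ x ∉ (∅ : Finset X), β x = x) = {1} := by
    ext β
    simp only [Finset.mem_filter, Finset.mem_univ, true_and, Finset.notMem_empty,
      not_false_eq_true, forall_const, Finset.mem_singleton]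
    exact ⟨fun h => Equiv.ext h.2, fun h => by simp [h]⟩
  rw [facSumOn, this]
  simp

-- The Jucys–Murphy recursion. A permutation `β` supported in `insert k A` either fixes `k`, or is
-- `β' * swap j k` with `j = β⁻¹ k` in `A` and `β'` supported in `A`. In the second case the length
-- grows by one, and the transposition can be absorbed into `σ`.
open Polynomial in
theorem facSumOn_insert (c : X → ι) (t : ℕ → R) (n : ℕ) {A : Finset X} {k : X} (hk : k ∉ A)
    (σ : Perm X) :
    facSumOn c t n (insert k A) σ = facSumOn c t n A σ +
      C (t n) * Polynomial.X * ∑ j ∈ A with c j = c k, facSumOn c t n A (σ * swap j k) := by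
  classical
  -- The index `j = k`, where the swap is trivial, accounts for the `β` that fix `k`.
  have main : facSumOn c t n (insert k A) σ =
      ∑ j ∈ insert k A with c j = c k,
        ∑ β : Perm X with (∀ x, c (β x) = c x) ∧ ∀ x ∉ A, β x = x,
          (C (t n) * Polynomial.X) ^ absLength (β * swap j k) *
            facSum c t n (σ * (β * swap j k)⁻¹) := by
    rw [facSumOn, ← Finset.sum_product']
    symm
    refine Finset.sum_bij' (fun p _ => p.2 * swap p.1 k)
      (fun β _ => (β⁻¹ k, β * swap (β⁻¹ k) k)) ?_ ?_ ?_ ?_ ?_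
    · rintro ⟨j, β⟩ h
      simp only [Finset.mem_product, Finset.mem_filter, Finset.mem_univ, true_and] at h ⊢
      obtain ⟨⟨hj, hjk⟩, hβ, hβA⟩ := h
      constructor
      · intro x
        rw [Perm.mul_apply, hβ]
        rcases eq_or_ne x j with rfl | h1
        · simp [hjk]
        rcases eq_or_ne x k with rfl | h2
        · simp [hjk]
        rw [swap_apply_of_ne_of_ne h1 h2]
      · intro x hx
        have h1 : x ≠ j := fun e => hx (e ▸ hj)
        have h2 : x ≠ k := fun e => hx (e ▸ Finset.mem_insert_self _ _)
        rw [Perm.mul_apply, swap_apply_of_ne_of_ne h1 h2]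
        exact hβA x fun e => hx (Finset.mem_insert_of_mem e)
    · intro β h
      simp only [Finset.mem_product, Finset.mem_filter, Finset.mem_univ, true_and] at h ⊢
      obtain ⟨hβ, hβA⟩ := h
      have hcol : c (β⁻¹ k) = c k := by rw [← hβ (β⁻¹ k), apply_inv_apply]
      refine ⟨⟨?_, hcol⟩, ?_, ?_⟩
      · by_contra hx
        have := hβA _ hx
        rw [apply_inv_apply] at this
        rw [← this] at hx
        exact hx (Finset.mem_insert_self _ _)
      · intro x
        rw [Perm.mul_apply, hβ]
        rcases eq_or_ne x (β⁻¹ k) with rfl | h1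
        · rw [swap_apply_left, hcol]
        rcases eq_or_ne x k with rfl | h2
        · rw [swap_apply_right, hcol]
        rw [swap_apply_of_ne_of_ne h1 h2]
      · intro x hx
        rcases eq_or_ne x k with rfl | h2
        · rw [Perm.mul_apply, swap_apply_right, apply_inv_apply]
        have hx' : x ∉ insert k A := by simp [h2, hx]
        have h3 := hβA x hx'
        have h1 : x ≠ β⁻¹ k := by
          rintro e
          rw [e, apply_inv_apply] at h3
          exact h2 (e.trans h3.symm)
        rw [Perm.mul_apply, swap_apply_of_ne_of_ne h1 h2, h3]
    · rintro ⟨j, β⟩ h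
      simp only [Finset.mem_product, Finset.mem_filter, Finset.mem_univ, true_and] at h ⊢
      have h1 : β k = k := h.2.2 k hk
      have h2 : (β * swap j k)⁻¹ k = j := by
        rw [Perm.inv_eq_iff_eq, Perm.mul_apply, swap_apply_left, h1]
      rw [h2, mul_swap_mul_swap]
    · intro β h
      simp only [mul_swap_mul_swap]
    · rintro ⟨j, β⟩ h
      rfl
  rw [main, Finset.filter_insert, if_pos rfl, Finset.sum_insert (by simp [hk]), Finset.mul_sum]
  congr 1
  · simp [facSumOn, ← Perm.one_def]
  · refine Finset.sum_congr rfl fun j hj => ?_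
    rw [facSumOn, Finset.mul_sum]
    refine Finset.sum_congr rfl fun β hβ => ?_
    simp only [Finset.mem_filter, Finset.mem_univ, true_and] at hj hβ
    have h1 : β k = k := hβ.2 k hk
    have h2 : ¬ β.SameCycle j k := fun h =>
      hk ((h.symm.eq_of_left h1) ▸ hj.1)
    rw [absLength_mul_swap_of_not h2, pow_succ', mul_inv_rev, swap_inv]
    simp only [mul_assoc]

open Polynomial in
theorem coeff_weight_pow_mul (a : R) (k d : ℕ) (f : R[X]) :
    ((C a * Polynomial.X) ^ k * f).coeff d = if k ≤ d then a ^ k * f.coeff (d - k) else 0 := by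
  rw [mul_pow, ← C_pow, mul_assoc, coeff_C_mul, coeff_X_pow_mul']
  split_ifs <;> simp

open Polynomial in
theorem coeff_succ_weight_mul (a : R) (d : ℕ) (f : R[X]) :
    (C a * Polynomial.X * f).coeff (d + 1) = a * f.coeff d := by
  rw [mul_assoc, coeff_C_mul, coeff_X_mul]

theorem coeff_facSumOn_of_lt_aux {c : X → ι} {t : ℕ → R} {n : ℕ}
    (ih : ∀ (σ : Perm X) d, d < absLength σ → (facSum c t n σ).coeff d = 0)
    {A : Finset X} {σ : Perm X} {d : ℕ} (hd : d < absLength σ) :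
    (facSumOn c t n A σ).coeff d = 0 := by
  rw [facSumOn, Polynomial.finsetSum_coeff]
  refine Finset.sum_eq_zero fun β _ => ?_
  rw [coeff_weight_pow_mul]
  split_ifs with h
  · have := absLength_mul_le (σ * β⁻¹) β
    rw [inv_mul_cancel_right] at this
    rw [ih _ _ (by omega), mul_zero]
  · rfl

theorem coeff_facSum_of_lt {c : X → ι} {t : ℕ → R} {n : ℕ} {σ : Perm X} {d : ℕ}
    (hd : d < absLength σ) : (facSum c t n σ).coeff d = 0 := by
  induction n generalizing σ d with
  | zero =>
    rw [facSum, if_neg]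
    · simp
    · rintro rfl; simp at hd
  | succ n ih =>
    rw [← facSumOn_univ]
    exact coeff_facSumOn_of_lt_aux (fun σ d h => ih h) hd

theorem coeff_facSumOn_of_lt {c : X → ι} {t : ℕ → R} {n : ℕ} {A : Finset X} {σ : Perm X} {d : ℕ}
    (hd : d < absLength σ) : (facSumOn c t n A σ).coeff d = 0 :=
  coeff_facSumOn_of_lt_aux (fun _ _ h => coeff_facSum_of_lt h) hd

/-- The generating polynomial of all factorizations. -/
noncomputable abbrev allSum (t : ℕ → R) : ℕ → Perm X → Polynomial R :=
  facSum (fun _ : X => ()) t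

/-- The generating polynomial of all factorizations with the last factor supported in `A`. -/
noncomputable abbrev allSumOn (t : ℕ → R) : ℕ → Finset X → Perm X → Polynomial R :=
  facSumOn (fun _ : X => ()) t

/-- The generating polynomial of the factorizations in which some factor does not preserve the
colouring `c`. -/
noncomputable def conSum (c : X → ι) (t : ℕ → R) (n : ℕ) (σ : Perm X) : Polynomial R :=
  allSum t n σ - facSum c t n σ

/-- The same, with the last factor supported in `A`. -/
noncomputable def conSumOn (c : X → ι) (t : ℕ → R) (n : ℕ) (A : Finset X) (σ : Perm X) :
    Polynomial R :=
  allSumOn t n A σ - facSumOn c t n A σ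

theorem conSum_zero (c : X → ι) (t : ℕ → R) (σ : Perm X) : conSum c t 0 σ = 0 := by
  simp [conSum, allSum, facSum]

theorem conSumOn_univ (c : X → ι) (t : ℕ → R) (n : ℕ) (σ : Perm X) :
    conSumOn c t n Finset.univ σ = conSum c t (n + 1) σ := by
  rw [conSumOn, conSum, allSumOn, allSum, facSumOn_univ, facSumOn_univ]

theorem conSumOn_empty (c : X → ι) (t : ℕ → R) (n : ℕ) (σ : Perm X) :
    conSumOn c t n ∅ σ = conSum c t n σ := by
  rw [conSumOn, conSum, allSumOn, allSum, facSumOn_empty, facSumOn_empty]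

open Polynomial in
theorem allSumOn_insert (t : ℕ → R) (n : ℕ) {A : Finset X} {k : X} (hk : k ∉ A) (σ : Perm X) :
    allSumOn t n (insert k A) σ = allSumOn t n A σ +
      C (t n) * Polynomial.X * ∑ j ∈ A, allSumOn t n A (σ * swap j k) := by
  rw [allSumOn, facSumOn_insert _ _ _ hk]
  simp

-- If `j` and `k` have different colours, the last factor sends `j` to `k` and already breaks the
-- colouring, so there is no condition on the other factors.
open Polynomial in
theorem conSumOn_insert (c : X → ι) (t : ℕ → R) (n : ℕ) {A : Finset X} {k : X} (hk : k ∉ A)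
    (σ : Perm X) :
    conSumOn c t n (insert k A) σ = conSumOn c t n A σ +
      C (t n) * Polynomial.X * ∑ j ∈ A,
        if c j = c k then conSumOn c t n A (σ * swap j k) else allSumOn t n A (σ * swap j k) := by
  have h1 : ∑ j ∈ A, allSumOn t n A (σ * swap j k) -
      ∑ j ∈ A with c j = c k, facSumOn c t n A (σ * swap j k) =
      ∑ j ∈ A, if c j = c k then conSumOn c t n A (σ * swap j k)
        else allSumOn t n A (σ * swap j k) := by
    rw [Finset.sum_filter, ← Finset.sum_sub_distrib]
    refine Finset.sum_congr rfl fun j _ => ?_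
    split_ifs <;> simp [conSumOn]
  rw [← h1, conSumOn, allSumOn_insert _ _ hk, facSumOn_insert _ _ _ hk, conSumOn]
  ring

/-- Degrees below `absLength σ` are excluded by the triangle inequality. In degree `absLength σ`
only geodesics contribute, and these preserve every colouring that `σ` preserves. -/
theorem coeff_conSumOn_of_le_aux {c : X → ι} {t : ℕ → R} {n : ℕ}
    (ih : ∀ (σ : Perm X) d, (∀ x, c (σ x) = c x) → d ≤ absLength σ →
      (conSum c t n σ).coeff d = 0)
    {A : Finset X} {σ : Perm X} {d : ℕ} (hσ : ∀ x, c (σ x) = c x) (hd : d ≤ absLength σ) :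
    (conSumOn c t n A σ).coeff d = 0 := by
  rw [conSumOn, allSumOn, facSumOn, facSumOn, Polynomial.coeff_sub, Polynomial.finsetSum_coeff,
    Polynomial.finsetSum_coeff]
  simp only [implies_true, true_and]
  rw [sub_eq_zero]
  symm
  have hle : ∀ β : Perm X, absLength σ ≤ absLength (σ * β⁻¹) + absLength β := by
    intro β
    have := absLength_mul_le (σ * β⁻¹) β
    rwa [inv_mul_cancel_right] at this
  simp only [Finset.sum_filter, coeff_weight_pow_mul]
  refine Finset.sum_congr rfl fun β _ => ?_
  by_cases hA : ∀ x ∉ A, β x = x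
  swap
  · rw [if_neg (fun h => hA h.2), if_neg hA]
  rw [if_pos hA]
  by_cases hgeo : absLength (σ * β⁻¹) + absLength β ≤ absLength σ
  · obtain ⟨h1, h2⟩ := color_preserved_of_geodesic hσ hgeo
    rw [if_pos ⟨h1, hA⟩]
    split_ifs with hβ
    · have := ih (σ * β⁻¹) (d - absLength β) h2 (by have := hle β; omega)
      rw [conSum, Polynomial.coeff_sub, sub_eq_zero] at this
      rw [← this]
    · rfl
  · split_ifs with h1 h2
    · rw [coeff_facSum_of_lt (by omega), coeff_facSum_of_lt (by omega)]
    · rfl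
    · rw [coeff_facSum_of_lt (by omega), mul_zero]
    · rfl

theorem coeff_conSum_of_le {c : X → ι} {t : ℕ → R} {n : ℕ} {σ : Perm X} {d : ℕ}
    (hσ : ∀ x, c (σ x) = c x) (hd : d ≤ absLength σ) : (conSum c t n σ).coeff d = 0 := by
  induction n generalizing σ d with
  | zero => simp [conSum_zero]
  | succ n ih =>
    rw [← conSumOn_univ]
    exact coeff_conSumOn_of_le_aux (fun σ d h1 h2 => ih h1 h2) hσ hd

theorem coeff_conSumOn_of_le {c : X → ι} {t : ℕ → R} {n : ℕ} {A : Finset X} {σ : Perm X} {d : ℕ}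
    (hσ : ∀ x, c (σ x) = c x) (hd : d ≤ absLength σ) : (conSumOn c t n A σ).coeff d = 0 :=
  coeff_conSumOn_of_le_aux (fun _ _ h1 h2 => coeff_conSum_of_le h1 h2) hσ hd

end FacSum

end AnnularNC

namespace AnnularNC

/-! ### Permutations as lists of cycles with frozen and active points -/

section States

variable {X : Type*} [DecidableEq X] [Fintype X]

open Equiv Equiv.Perm

theorem formPerm_append_cons (F : List X) (a : X) (A : List X) :
    (F ++ a :: A).formPerm = (F ++ [a]).formPerm * (a :: A).formPerm := by
  induction F with
  | nil => simp
  | cons x F ih =>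
    cases F with
    | nil => simp [List.formPerm_cons_cons]
    | cons y F =>
      simp only [List.cons_append, List.formPerm_cons_cons] at ih ⊢
      rw [ih, mul_assoc]

theorem commute_formPerm {l : List X} {τ : Perm X} (h : ∀ x ∈ l, τ x = x) :
    Commute l.formPerm τ := by
  apply Perm.Disjoint.commute
  intro x
  by_cases hx : x ∈ l
  · exact Or.inr (h x hx)
  · exact Or.inl (List.formPerm_apply_of_notMem hx)

theorem formPerm_cons_mul_swap {a b : X} {V : List X} (h : (a :: b :: V).Nodup) :
    (b :: V).formPerm * swap a b = swap a b * (a :: V).formPerm := by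
  cases V with
  | nil => simp
  | cons v V =>
    simp only [List.nodup_cons, List.mem_cons, not_or] at h
    obtain ⟨⟨hab, hav, haV⟩, ⟨hbv, hbV⟩, hvV, hV⟩ := h
    have hc : Commute (v :: V).formPerm (swap a b) := by
      apply commute_formPerm
      intro x hx
      apply swap_apply_of_ne_of_ne
      · rintro rfl; rcases List.mem_cons.mp hx with h | h
        exacts [hav h, haV h]
      · rintro rfl; rcases List.mem_cons.mp hx with h | h
        exacts [hbv h, hbV h]
    rw [List.formPerm_cons_cons, List.formPerm_cons_cons, mul_assoc, hc.eq, ← mul_assoc,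
      ← mul_assoc, mul_swap_eq_swap_mul (swap a b) a v, swap_apply_left,
      swap_apply_of_ne_of_ne (Ne.symm hav) (Ne.symm hbv)]

/-- The product exchanges the successors of `a` and `b`. When `F` is frozen and `a` is the next
point to freeze, one piece keeps its frozen points in front and the other is fully active, so the
shape of a state survives a cut. -/
theorem formPerm_cut {F U V : List X} {a b : X} (h : (F ++ a :: (U ++ b :: V)).Nodup) :
    (F ++ a :: (U ++ b :: V)).formPerm * swap a b =
      (F ++ a :: V).formPerm * (U ++ [b]).formPerm := by
  have hn : (a :: (U ++ b :: V)).Nodup := (List.nodup_append.mp h).2.1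
  have h1 : (a :: b :: V).Nodup := by
    refine hn.sublist ?_
    exact List.Sublist.cons_cons _ (List.sublist_append_right _ _)
  have h2 : (a :: (U ++ [b])).Nodup := by
    refine hn.sublist ?_
    refine List.Sublist.cons_cons _ (List.Sublist.append (List.Sublist.refl _) ?_)
    simp
  have h3 : (a :: (U ++ [b])).formPerm * swap a b = (U ++ [b]).formPerm := by
    have := List.formPerm_rotate_one _ h2
    rw [← this, List.rotate_cons_succ, List.rotate_zero, List.append_assoc]
    simp only [List.singleton_append]
    rw [formPerm_append_cons, List.formPerm_pair, swap_comm b a, mul_swap_mul_swap]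
  rw [formPerm_append_cons F a V, formPerm_append_cons F, ← List.cons_append,
    formPerm_append_cons (a :: U) b V, mul_assoc, mul_assoc, formPerm_cons_mul_swap h1,
    ← mul_assoc (List.formPerm _) (swap a b), List.cons_append, h3, mul_assoc]
  congr 1
  apply Commute.eq
  apply commute_formPerm
  intro x hx
  apply List.formPerm_apply_of_notMem
  intro hx'
  simp only [List.nodup_cons, List.nodup_append, List.mem_append, List.mem_cons] at hn
  grind

/-- A join undoes a cut, since `O₂ ++ O₁ ++ [b]` is a rotation of `O₁ ++ b :: O₂`. Frozen points
remain in front only if the cycle through `b` is fully active; this dictates the order in which the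
two sides are treated later. -/
theorem formPerm_join {F A O₁ O₂ : List X} {a b : X}
    (h : (F ++ a :: (O₂ ++ O₁ ++ b :: A)).Nodup) :
    (F ++ a :: A).formPerm * (O₁ ++ b :: O₂).formPerm * swap a b =
      (F ++ a :: (O₂ ++ O₁ ++ b :: A)).formPerm := by
  have h1 := formPerm_cut h
  have h2 : (O₂ ++ O₁ ++ [b]).formPerm = (O₁ ++ b :: O₂).formPerm := by
    have hn : (O₂ ++ O₁ ++ [b]).Nodup := by
      refine h.sublist ?_
      refine List.Sublist.trans ?_ (List.sublist_append_right _ _)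
      refine List.Sublist.trans ?_ (List.sublist_cons_self _ _)
      exact List.Sublist.append (List.Sublist.refl _) (by simp)
    apply List.formPerm_eq_of_isRotated hn
    refine ⟨O₂.length, ?_⟩
    rw [List.append_assoc, List.rotate_append_length_eq]
    simp
  rw [← h2, ← h1, mul_swap_mul_swap]

/-- A state is a list of cycles, each of which consists of a list of frozen points followed by a
list of active points. -/
abbrev State (X : Type*) := List (List X × List X)

namespace State

/-- All points of a state. -/
def pts (S : State X) : List X := S.flatMap fun x => x.1 ++ x.2

/-- The active points of a state. -/
def act (S : State X) : List X := S.flatMap fun x => x.2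

/-- The permutation with the given cycles. -/
def perm (S : State X) : Perm X := (S.map fun x => (x.1 ++ x.2).formPerm).prod

/-- The cycles are disjoint, nonempty, and cover all points. -/
structure Good (S : State X) : Prop where
  nodup : S.pts.Nodup
  full : ∀ x, x ∈ S.pts
  ne_nil : ∀ x ∈ S, x.1 ++ x.2 ≠ []

@[simp] theorem pts_nil : pts ([] : State X) = [] := rfl
@[simp] theorem act_nil : act ([] : State X) = [] := rfl
@[simp] theorem perm_nil : perm ([] : State X) = 1 := rfl

@[simp] theorem pts_cons (x : List X × List X) (S : State X) :
    pts (x :: S) = x.1 ++ x.2 ++ pts S := by simp [pts]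

@[simp] theorem act_cons (x : List X × List X) (S : State X) :
    act (x :: S) = x.2 ++ act S := by simp [act]

@[simp] theorem perm_cons (x : List X × List X) (S : State X) :
    perm (x :: S) = (x.1 ++ x.2).formPerm * perm S := by simp [perm]

@[simp] theorem pts_append (S T : State X) : pts (S ++ T) = pts S ++ pts T := by simp [pts]

@[simp] theorem act_append (S T : State X) : act (S ++ T) = act S ++ act T := by simp [act]

theorem act_sublist_pts (S : State X) : S.act.Sublist S.pts := by
  induction S with
  | nil => simp
  | cons x S ih =>
    simp only [act_cons, pts_cons]
    exact (List.sublist_append_right _ _).append ih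

theorem pts_perm {S T : State X} (h : S.Perm T) : S.pts.Perm T.pts := h.flatMap_right _

theorem act_perm {S T : State X} (h : S.Perm T) : S.act.Perm T.act := h.flatMap_right _

theorem perm_apply_of_notMem {S : State X} {x : X} (h : x ∉ S.pts) : S.perm x = x := by
  induction S with
  | nil => rfl
  | cons y S ih =>
    simp only [pts_cons, List.mem_append, not_or] at h
    rw [perm_cons, Perm.mul_apply, ih h.2, List.formPerm_apply_of_notMem]
    simp [h.1]

theorem perm_eq_of_perm {S T : State X} (hn : S.pts.Nodup) (h : S.Perm T) : S.perm = T.perm := by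
  refine (h.map _).prod_eq' ?_
  rw [List.pairwise_map]
  refine (List.nodup_flatMap.mp hn).2.imp ?_
  intro x y hxy
  apply commute_formPerm
  intro z hz
  exact List.formPerm_apply_of_notMem fun hz' => hxy hz hz'

theorem Good.of_perm {S T : State X} (h : S.Good) (hST : S.Perm T) : T.Good :=
  ⟨(pts_perm hST).nodup_iff.mp h.nodup, fun x => (pts_perm hST).mem_iff.mp (h.full x),
    fun x hx => h.ne_nil x (hST.mem_iff.mpr hx)⟩

theorem Good.of_pts_perm {S T : State X} (h : S.Good) (hST : S.pts.Perm T.pts)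
    (hT : ∀ x ∈ T, x.1 ++ x.2 ≠ []) : T.Good :=
  ⟨hST.nodup_iff.mp h.nodup, fun x => hST.mem_iff.mp (h.full x), hT⟩

theorem sameCycle_perm_cons {x : List X × List X} {S : State X} (h : (pts (x :: S)).Nodup)
    {a b : X} (ha : a ∈ x.1 ++ x.2) (hb : b ∈ x.1 ++ x.2) : (perm (x :: S)).SameCycle a b := by
  rw [pts_cons] at h
  have hdisj := (List.nodup_append.mp h).2.2
  have hfix : ∀ y ∈ x.1 ++ x.2, S.perm y = y := fun y hy =>
    perm_apply_of_notMem fun hy' => hdisj y hy y hy' rfl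
  have hc := commute_formPerm hfix
  have hnd := (List.nodup_append.mp h).1
  have key : ∀ y ∈ x.1 ++ x.2, (perm (x :: S)).SameCycle ((x.1 ++ x.2)[0]'
      (List.length_pos_of_mem ha)) y := by
    intro y hy
    obtain ⟨i, hi, rfl⟩ := List.getElem_of_mem hy
    refine ⟨(i : ℤ), ?_⟩
    rw [zpow_natCast, perm_cons, hc.mul_pow, Perm.mul_apply,
      Perm.pow_apply_eq_self_of_apply_eq_self (hfix _ (List.getElem_mem _)),
      List.formPerm_pow_apply_getElem _ hnd]
    have hmod : (0 + i) % (x.1 ++ x.2).length = i := by rw [zero_add, Nat.mod_eq_of_lt hi]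
    simp only [hmod]
  exact (key a ha).symm.trans (key b hb)

theorem not_sameCycle_perm_cons {x : List X × List X} {S : State X} (h : (pts (x :: S)).Nodup)
    {a b : X} (ha : a ∈ x.1 ++ x.2) (hb : b ∉ x.1 ++ x.2) :
    ¬ (perm (x :: S)).SameCycle a b := by
  rw [pts_cons] at h
  have hdisj := (List.nodup_append.mp h).2.2
  have hfix : ∀ y ∈ x.1 ++ x.2, S.perm y = y := fun y hy =>
    perm_apply_of_notMem fun hy' => hdisj y hy y hy' rfl
  intro hs
  have := color_eq_of_sameCycle (c := fun y => y ∈ x.1 ++ x.2) (σ := perm (x :: S)) ?_ hs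
  · exact hb (this.mp ha)
  · intro y
    rw [perm_cons, Perm.mul_apply, eq_iff_iff, List.formPerm_mem_iff_mem]
    by_cases hy : y ∈ x.1 ++ x.2
    · rw [hfix y hy]
    · refine iff_of_false (fun hz => hy ?_) hy
      have := hfix _ hz
      rwa [S.perm.injective this] at hz

theorem perm_cut {F U V : List X} {a b : X} {S : State X}
    (h : (pts ((F, a :: (U ++ b :: V)) :: S)).Nodup) :
    perm ((F, a :: (U ++ b :: V)) :: S) * swap a b =
      perm ((F ++ [a], V) :: ([], U ++ [b]) :: S) := by
  rw [pts_cons] at h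
  obtain ⟨h1, -, h3⟩ := List.nodup_append.mp h
  have hs : Commute S.perm (swap a b) := by
    apply Perm.Disjoint.commute
    intro x
    by_cases hx : x ∈ S.pts
    · right
      apply swap_apply_of_ne_of_ne <;> exact (h3 _ (by simp) _ hx).symm
    · exact Or.inl (perm_apply_of_notMem hx)
  simp only [perm_cons, List.nil_append]
  rw [mul_assoc, hs.eq, ← mul_assoc, formPerm_cut h1, ← mul_assoc]
  simp

theorem perm_join {F A O₁ O₂ : List X} {a b : X} {S : State X}
    (h : (pts ((F, a :: A) :: ([], O₁ ++ b :: O₂) :: S)).Nodup) :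
    perm ((F, a :: A) :: ([], O₁ ++ b :: O₂) :: S) * swap a b =
      perm ((F ++ [a], O₂ ++ O₁ ++ b :: A) :: S) := by
  have hn : (F ++ a :: (O₂ ++ O₁ ++ b :: A) ++ S.pts).Nodup := by
    refine (List.Perm.nodup_iff ?_).mp h
    rw [List.perm_iff_count]
    intro z
    simp [List.count_append, List.count_cons]
    omega
  obtain ⟨h1, -, h3⟩ := List.nodup_append.mp hn
  have hs : Commute S.perm (swap a b) := by
    apply Perm.Disjoint.commute
    intro x
    by_cases hx : x ∈ S.pts
    · right
      apply swap_apply_of_ne_of_ne <;> exact (h3 _ (by simp) _ hx).symm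
    · exact Or.inl (perm_apply_of_notMem hx)
  simp only [perm_cons, List.nil_append]
  rw [← mul_assoc, mul_assoc, hs.eq, ← mul_assoc, formPerm_join h1]
  simp

theorem perm_freeze (F A : List X) (a : X) (S : State X) :
    perm ((F ++ [a], A) :: S) = perm ((F, a :: A) :: S) := by simp

theorem exists_perm_cons_of_act_ne_nil {S : State X} (h : S.act ≠ []) :
    ∃ F a A S', S.Perm ((F, a :: A) :: S') := by
  obtain ⟨z, hz⟩ := List.exists_mem_of_ne_nil _ h
  obtain ⟨⟨F, A⟩, hx, hzA⟩ := List.mem_flatMap.mp hz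
  obtain ⟨a, A', rfl⟩ := List.exists_cons_of_ne_nil (List.ne_nil_of_mem hzA)
  exact ⟨F, a, A', _, List.perm_cons_erase hx⟩

/-- Thaw all points. -/
def thaw (S : State X) : State X := S.map fun x => ([], x.1 ++ x.2)

@[simp] theorem pts_thaw (S : State X) : S.thaw.pts = S.pts := by
  simp [thaw, pts, List.flatMap_map]

@[simp] theorem act_thaw (S : State X) : S.thaw.act = S.pts := by
  simp [thaw, pts, act, List.flatMap_map]

@[simp] theorem perm_thaw (S : State X) : S.thaw.perm = S.perm := by
  simp [thaw, perm, Function.comp_def]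

theorem Good.thaw {S : State X} (h : S.Good) : S.thaw.Good := by
  refine h.of_pts_perm (by simp) ?_
  intro x hx
  obtain ⟨y, hy, rfl⟩ := List.mem_map.mp hx
  simpa using h.ne_nil y hy

end State

end States

end AnnularNC

namespace AnnularNC

/-! ### Products of weights over a list, with one distinguished entry -/

section WSum

variable {Y R : Type*} [CommRing R]

/-- The product of the weights of the entries of a list. -/
def wprod (w : Y → R) (S : List Y) : R := (S.map w).prod

/-- The sum over all choices of an entry `x` of a list of `f x` times the weights of the other
entries. -/
def wsum (f w : Y → R) : List Y → R
  | [] => 0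
  | x :: S => f x * wprod w S + w x * wsum f w S

@[simp] theorem wprod_nil (w : Y → R) : wprod w [] = 1 := rfl
@[simp] theorem wprod_cons (w : Y → R) (x : Y) (S : List Y) :
    wprod w (x :: S) = w x * wprod w S := by simp [wprod]
@[simp] theorem wprod_append (w : Y → R) (S T : List Y) :
    wprod w (S ++ T) = wprod w S * wprod w T := by simp [wprod]
@[simp] theorem wsum_nil (f w : Y → R) : wsum f w [] = 0 := rfl
@[simp] theorem wsum_cons (f w : Y → R) (x : Y) (S : List Y) :
    wsum f w (x :: S) = f x * wprod w S + w x * wsum f w S := rfl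

theorem wprod_perm (w : Y → R) {S T : List Y} (h : S.Perm T) : wprod w S = wprod w T :=
  (h.map w).prod_eq

theorem wsum_perm (f w : Y → R) {S T : List Y} (h : S.Perm T) : wsum f w S = wsum f w T := by
  induction h with
  | nil => rfl
  | cons x h ih => rw [wsum_cons, wsum_cons, wprod_perm w h, ih]
  | swap x y l => simp only [wsum_cons, wprod_cons]; ring
  | trans _ _ h1 h2 => exact h1.trans h2

theorem wprod_congr {w w' : Y → R} {S : List Y} (h : ∀ x ∈ S, w x = w' x) :
    wprod w S = wprod w' S := by
  rw [wprod, wprod, List.map_congr_left h]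

theorem wsum_congr {f f' w w' : Y → R} {S : List Y} (hf : ∀ x ∈ S, f x = f' x)
    (hw : ∀ x ∈ S, w x = w' x) : wsum f w S = wsum f' w' S := by
  induction S with
  | nil => rfl
  | cons x S ih =>
    rw [wsum_cons, wsum_cons, hf x (by simp), hw x (by simp),
      wprod_congr (fun y hy => hw y (by simp [hy])),
      ih (fun y hy => hf y (by simp [hy])) (fun y hy => hw y (by simp [hy]))]

theorem wsum_add (f g w : Y → R) (S : List Y) :
    wsum (fun x => f x + g x) w S = wsum f w S + wsum g w S := by
  induction S with
  | nil => simp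
  | cons x S ih => simp only [wsum_cons, ih]; ring

theorem wsum_mul_left (r : R) (f w : Y → R) (S : List Y) :
    wsum (fun x => r * f x) w S = r * wsum f w S := by
  induction S with
  | nil => simp
  | cons x S ih => simp only [wsum_cons, ih]; ring

theorem wsum_sum {J : Type*} (s : Finset J) (f : J → Y → R) (w : Y → R) (S : List Y) :
    wsum (fun x => ∑ j ∈ s, f j x) w S = ∑ j ∈ s, wsum (f j) w S := by
  induction S with
  | nil => simp
  | cons x S ih =>
    simp only [wsum_cons, ih, Finset.sum_add_distrib, Finset.sum_mul, Finset.mul_sum]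

theorem wprod_map {Z : Type*} (w : Y → R) (e : Z → Y) (S : List Z) :
    wprod w (S.map e) = wprod (fun z => w (e z)) S := by simp [wprod, Function.comp_def]

theorem wsum_map {Z : Type*} (f w : Y → R) (e : Z → Y) (S : List Z) :
    wsum f w (S.map e) = wsum (fun z => f (e z)) (fun z => w (e z)) S := by
  induction S with
  | nil => rfl
  | cons x S ih => simp only [List.map_cons, wsum_cons, ih, wprod_map]

theorem sum_map_eq_sum_range {X : Type*} (A : List X) (h : X → R) (f : ℕ → R)
    (H : ∀ U j V, A = U ++ j :: V → h j = f U.length) :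
    (A.map h).sum = ∑ i ∈ Finset.range A.length, f i := by
  induction A generalizing f with
  | nil => simp
  | cons x A ih =>
    rw [List.map_cons, List.sum_cons, List.length_cons, Finset.sum_range_succ',
      ih (fun i => f (i + 1)) (fun U j V e => by
        have := H (x :: U) j V (by rw [e]; rfl)
        simpa using this), H [] x A rfl]
    exact add_comm _ _

/-- The scalar `r` is general because it absorbs the weights of the entries already passed in the
induction. -/
theorem sum_flatMap_eq_wsum {X : Type*} (O : List Y) (pts : Y → List X) (h : X → R) (g w : Y → R)
    (r : R) (H : ∀ o O', O.Perm (o :: O') → ∀ j ∈ pts o, h j = r * (g o * wprod w O')) :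
    ((O.flatMap pts).map h).sum = r * wsum (fun o => ((pts o).length : R) * g o) w O := by
  induction O generalizing r with
  | nil => simp
  | cons o O ih =>
    rw [List.flatMap_cons, List.map_append, List.sum_append, ih (r * w o), wsum_cons]
    · have : (pts o).map h = (pts o).map fun _ => r * (g o * wprod w O) :=
        List.map_congr_left fun j hj => H o O (List.Perm.refl _) j hj
      rw [this, List.map_const', List.sum_replicate, nsmul_eq_mul]
      ring
    · intro o' O' hp j hj
      rw [H o' (o :: O') ((hp.cons o).trans (List.Perm.swap _ _ _)) j hj, wprod_cons]
      ring

end WSum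

/-! ### Minimal factorizations: multiplicativity over cycles -/

section CycleWeights

variable {R : Type*} [CommRing R]

/-- The recursion satisfied by the weighted number of minimal factorizations of a cycle: `F n k`
refers to `n` factors and a cycle of length `k`, and `P n M K` to `n + 1` factors, the last of
which fixes the first `M` points of a cycle of length `M + K`. -/
structure CycleWeights (t : ℕ → R) (F : ℕ → ℕ → R) (P : ℕ → ℕ → ℕ → R) : Prop where
  zero : ∀ k, F 0 k = if k = 1 then 1 else 0
  base : ∀ n M, P n M 0 = F n M
  succ : ∀ n K, F (n + 1) K = P n 0 K
  step : ∀ n M K, P n M (K + 1) = P n (M + 1) K +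
    t n * ∑ i ∈ Finset.range K, P n 0 (i + 1) * P n (M + 1) (K - 1 - i)

/-- The recursion satisfied by the weighted number of minimal transitive factorizations of a
product of two cycles. -/
structure AnnulusWeights (t : ℕ → R) (P : ℕ → ℕ → ℕ → R) (F₂ : ℕ → ℕ → ℕ → R)
    (Q₁ Q₂ : ℕ → ℕ → ℕ → ℕ → R) : Prop where
  zero : ∀ a b, F₂ 0 a b = 0
  base₁ : ∀ n b M, Q₁ n b M 0 = F₂ n M b
  step₁ : ∀ n b M K, Q₁ n b M (K + 1) = Q₁ n b (M + 1) K +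
    t n * ∑ i ∈ Finset.range K, (P n 0 (i + 1) * Q₁ n b (M + 1) (K - 1 - i) +
      Q₁ n b 0 (i + 1) * P n (M + 1) (K - 1 - i))
  base₂ : ∀ n a M, Q₂ n a M 0 = Q₁ n M 0 a
  step₂ : ∀ n a M K, Q₂ n a M (K + 1) = Q₂ n a (M + 1) K +
    t n * ∑ i ∈ Finset.range K, (P n 0 (i + 1) * Q₂ n a (M + 1) (K - 1 - i) +
      Q₂ n a 0 (i + 1) * P n (M + 1) (K - 1 - i)) + t n * (a * P n (M + 1) (a + K))
  succ : ∀ n a b, F₂ (n + 1) a b = Q₂ n a 0 b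

variable {X : Type*} [DecidableEq X] [Fintype X] {ι : Type*} [DecidableEq ι]

open Equiv Equiv.Perm State

theorem coeff_weight_mul_of_lt {a : R} {d : ℕ} {f : Polynomial R} {e : ℕ}
    (hf : ∀ d < e, f.coeff d = 0) (hd : d ≤ e) :
    (Polynomial.C a * Polynomial.X * f).coeff d = 0 := by
  cases d with
  | zero => simp [mul_assoc]
  | succ d => rw [coeff_succ_weight_mul, hf d (by omega), mul_zero]

namespace State

/-- The facts about cutting the first cycle of a state. -/
theorem cut_facts {F U V : List X} {a j : X} {S : State X}
    (hg : Good ((F, a :: (U ++ j :: V)) :: S)) :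
    Good ((F ++ [a], V) :: ([], U ++ [j]) :: S) ∧
    perm ((F, a :: (U ++ j :: V)) :: S) * swap j a =
      perm ((F ++ [a], V) :: ([], U ++ [j]) :: S) ∧
    (act ((F ++ [a], V) :: ([], U ++ [j]) :: S)).Perm ((U ++ j :: V) ++ act S) ∧
    absLength (perm ((F ++ [a], V) :: ([], U ++ [j]) :: S)) + 1 =
      absLength (perm ((F, a :: (U ++ j :: V)) :: S)) := by
  have hp : perm ((F, a :: (U ++ j :: V)) :: S) * swap j a =
      perm ((F ++ [a], V) :: ([], U ++ [j]) :: S) := by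
    rw [swap_comm, perm_cut hg.nodup]
  refine ⟨hg.of_pts_perm ?_ ?_, hp, ?_, ?_⟩
  · rw [List.perm_iff_count]
    intro z
    simp [List.count_append, List.count_cons]
    omega
  · intro x hx
    simp only [List.mem_cons] at hx
    rcases hx with rfl | rfl | hx
    · simp
    · simp
    · exact hg.ne_nil x (by simp [hx])
  · rw [List.perm_iff_count]
    intro z
    simp [List.count_append, List.count_cons]
    omega
  · have hne : j ≠ a := by
      have := hg.nodup
      simp only [pts_cons, List.nodup_append, List.nodup_cons] at this
      rintro rfl
      exact this.1.2.1.1 (by simp)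
    rw [← hp]
    exact absLength_mul_swap_of_sameCycle hne (sameCycle_perm_cons hg.nodup (by simp) (by simp))

theorem freeze_facts {F A : List X} {a : X} {S : State X} (hg : Good ((F, a :: A) :: S)) :
    Good ((F ++ [a], A) :: S) := by
  refine hg.of_pts_perm (by simp) ?_
  intro x hx
  rcases List.mem_cons.mp hx with rfl | hx
  · simp
  · exact hg.ne_nil x (by simp [hx])

theorem not_sameCycle_head {F A : List X} {a j : X} {S : State X} (hg : Good ((F, a :: A) :: S))
    (hj : j ∈ act S) : ¬ (perm ((F, a :: A) :: S)).SameCycle j a := by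
  intro h
  refine not_sameCycle_perm_cons hg.nodup (a := a) (b := j) (by simp) ?_ h.symm
  have := hg.nodup
  rw [pts_cons] at this
  intro hj'
  exact (List.nodup_append.mp this).2.2 j hj' j ((act_sublist_pts S).subset hj) rfl

theorem act_head_nodup {F A : List X} {a : X} {S : State X} (hg : Good ((F, a :: A) :: S)) :
    (a :: (A ++ act S)).Nodup :=
  hg.nodup.sublist (by simpa using act_sublist_pts ((F, a :: A) :: S) |>.trans (by simp))

end State

open State

/-- Freezing `a` multiplies the permutation by the transpositions of `a` with the other active
points. In the lowest degree only the cuts, with `j` in the cycle of `a`, survive. -/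
theorem coeff_allSumOn_head {t : ℕ → R} {n : ℕ} {F A : List X} {a : X} {S : State X}
    (hg : Good ((F, a :: A) :: S)) (f : ℕ → R)
    (Hcut : ∀ U j V, A = U ++ j :: V →
      (allSumOn t n (act ((F ++ [a], V) :: ([], U ++ [j]) :: S)).toFinset
        (perm ((F ++ [a], V) :: ([], U ++ [j]) :: S))).coeff
        (absLength (perm ((F ++ [a], V) :: ([], U ++ [j]) :: S))) = f U.length) :
    (allSumOn t n (act ((F, a :: A) :: S)).toFinset (perm ((F, a :: A) :: S))).coeff
        (absLength (perm ((F, a :: A) :: S))) =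
      (allSumOn t n (act ((F ++ [a], A) :: S)).toFinset (perm ((F ++ [a], A) :: S))).coeff
        (absLength (perm ((F ++ [a], A) :: S))) +
      t n * ∑ i ∈ Finset.range A.length, f i := by
  have hnd := act_head_nodup hg
  have ha : a ∉ (A ++ act S).toFinset := by
    rw [List.mem_toFinset]; exact (List.nodup_cons.mp hnd).1
  have hins : (act ((F, a :: A) :: S)).toFinset = insert a (A ++ act S).toFinset := by simp
  have hfr : (act ((F ++ [a], A) :: S)).toFinset = (A ++ act S).toFinset := by simp
  rw [hins, hfr, perm_freeze, allSumOn_insert _ _ ha, Polynomial.coeff_add, Finset.mul_sum,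
    Polynomial.finsetSum_coeff]
  congr 1
  rw [List.sum_toFinset _ (List.nodup_cons.mp hnd).2, List.map_append, List.sum_append]
  -- A join raises the length by one, whereas the degree left for the remaining factors drops by
  -- one.
  have h2 : (List.map (fun j => (Polynomial.C (t n) * Polynomial.X * allSumOn t n
      (A ++ act S).toFinset (perm ((F, a :: A) :: S) * swap j a)).coeff
      (absLength (perm ((F, a :: A) :: S)))) (act S)).sum = 0 := by
    apply List.sum_eq_zero
    intro y hy
    obtain ⟨j, hj, rfl⟩ := List.mem_map.mp hy
    have := absLength_mul_swap_of_not (not_sameCycle_head hg hj)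
    exact coeff_weight_mul_of_lt (fun d hd => coeff_facSumOn_of_lt hd) (by omega)
  rw [h2, add_zero, sum_map_eq_sum_range A _ (fun i => t n * f i), Finset.mul_sum]
  intro U j V hA
  subst hA
  obtain ⟨-, h3, h4, h5⟩ := cut_facts hg
  rw [h3, ← h5, coeff_succ_weight_mul, ← Hcut U j V rfl, List.toFinset_eq_of_perm _ _ h4]

/-- Two degrees above the minimum, a cut keeps the excess 2. A join uses all of it: within one
colour nothing remains, by `coeff_conSumOn_of_le`, and between two colours a minimal factorization
of the joined permutation remains. -/
theorem coeff_conSumOn_head {c : X → ι} {t : ℕ → R} {n : ℕ} {F A : List X} {a : X} {S : State X}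
    (hg : Good ((F, a :: A) :: S)) (hc : ∀ x, c (perm ((F, a :: A) :: S) x) = c x)
    (hcA : ∀ j ∈ A, c j = c a) (f : ℕ → R)
    (Hcut : ∀ U j V, A = U ++ j :: V →
      (conSumOn c t n (act ((F ++ [a], V) :: ([], U ++ [j]) :: S)).toFinset
        (perm ((F ++ [a], V) :: ([], U ++ [j]) :: S))).coeff
        (absLength (perm ((F ++ [a], V) :: ([], U ++ [j]) :: S)) + 2) = f U.length) :
    (conSumOn c t n (act ((F, a :: A) :: S)).toFinset (perm ((F, a :: A) :: S))).coeff
        (absLength (perm ((F, a :: A) :: S)) + 2) =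
      (conSumOn c t n (act ((F ++ [a], A) :: S)).toFinset (perm ((F ++ [a], A) :: S))).coeff
        (absLength (perm ((F ++ [a], A) :: S)) + 2) +
      t n * ∑ i ∈ Finset.range A.length, f i +
      t n * ((act S).map fun j => if c j = c a then 0 else
        (allSumOn t n (A ++ act S).toFinset (perm ((F, a :: A) :: S) * swap j a)).coeff
          (absLength (perm ((F, a :: A) :: S) * swap j a))).sum := by
  have hnd := act_head_nodup hg
  have ha : a ∉ (A ++ act S).toFinset := by
    rw [List.mem_toFinset]; exact (List.nodup_cons.mp hnd).1
  have hins : (act ((F, a :: A) :: S)).toFinset = insert a (A ++ act S).toFinset := by simp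
  have hfr : (act ((F ++ [a], A) :: S)).toFinset = (A ++ act S).toFinset := by simp
  rw [hins, hfr, perm_freeze, conSumOn_insert _ _ _ ha, Polynomial.coeff_add,
    coeff_succ_weight_mul, Polynomial.finsetSum_coeff, add_assoc, ← mul_add]
  congr 2
  rw [List.sum_toFinset _ (List.nodup_cons.mp hnd).2, List.map_append, List.sum_append]
  congr 1
  · apply sum_map_eq_sum_range
    intro U j V hA
    subst hA
    obtain ⟨-, h3, h4, h5⟩ := cut_facts hg
    rw [if_pos (hcA j (by simp)), h3, ← h5, ← Hcut U j V rfl, List.toFinset_eq_of_perm _ _ h4]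
  · congr 1
    apply List.map_congr_left
    intro j hj
    have hl := absLength_mul_swap_of_not (not_sameCycle_head hg hj)
    split_ifs with hcj
    · refine coeff_conSumOn_of_le ?_ (by omega)
      intro x
      rw [Perm.mul_apply, hc]
      rcases eq_or_ne x j with rfl | h1
      · rw [swap_apply_left, hcj]
      rcases eq_or_ne x a with rfl | h2
      · rw [swap_apply_right, hcj]
      rw [swap_apply_of_ne_of_ne h1 h2]
    · rw [hl]

/-- The weight `P n |F| |A|` of a cycle with frozen points `F` and active points `A`. -/
def cycleWeight (P : ℕ → ℕ → ℕ → R) (n : ℕ) (x : List X × List X) : R :=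
  P n x.1.length x.2.length

/-- Induction on the number of active points. When none is left the last factor is trivial, and `ih`
counts the factorizations without it. -/
theorem coeff_allSumOn_state {t : ℕ → R} {F : ℕ → ℕ → R} {P : ℕ → ℕ → ℕ → R}
    (hw : CycleWeights t F P) {n : ℕ}
    (ih : ∀ S : State X, S.Good → (allSum t n S.perm).coeff (absLength S.perm) =
      wprod (fun x => F n (x.1.length + x.2.length)) S)
    (S : State X) (hg : S.Good) :
    (allSumOn t n S.act.toFinset S.perm).coeff (absLength S.perm) =
      wprod (cycleWeight P n) S := by
  induction hL : S.act.length generalizing S with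
  | zero =>
    rw [List.length_eq_zero_iff] at hL
    rw [hL, List.toFinset_nil, allSumOn, facSumOn_empty, ih S hg]
    refine wprod_congr fun x hx => ?_
    have : x.2 = [] := by
      rw [List.eq_nil_iff_forall_not_mem]
      intro y hy
      have : y ∈ S.act := List.mem_flatMap.mpr ⟨x, hx, hy⟩
      rw [hL] at this
      simp at this
    rw [cycleWeight, this, List.length_nil, hw.base, add_zero]
  | succ L ihL =>
    obtain ⟨G, a, A, S', hS⟩ := exists_perm_cons_of_act_ne_nil (S := S)
      (by rintro h; rw [h] at hL; simp at hL)
    rw [perm_eq_of_perm hg.nodup hS, List.toFinset_eq_of_perm _ _ (act_perm hS), wprod_perm _ hS]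
    have hg' := hg.of_perm hS
    have hL' : A.length + (act S').length = L := by
      have := (act_perm hS).length_eq
      simp at this
      omega
    rw [coeff_allSumOn_head hg' (fun i => P n 0 (i + 1) *
      P n (G.length + 1) (A.length - 1 - i) * wprod (cycleWeight P n) S'),
      ihL _ (freeze_facts hg') (by simp [hL'])]
    · simp only [wprod_cons, cycleWeight, List.length_append, List.length_cons, List.length_nil,
        zero_add]
      rw [hw.step, ← Finset.sum_mul]
      ring
    · intro U j V hA
      subst hA
      obtain ⟨h2, h3, h4, h5⟩ := cut_facts hg'
      rw [ihL _ h2 (by rw [h4.length_eq]; simp at hL' ⊢; omega)]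
      simp only [wprod_cons, cycleWeight, List.length_append, List.length_cons, List.length_nil,
        zero_add]
      rw [show U.length + (V.length + 1) - 1 - U.length = V.length by omega]
      ring

theorem coeff_allSum_state {t : ℕ → R} {F : ℕ → ℕ → R} {P : ℕ → ℕ → ℕ → R}
    (hw : CycleWeights t F P) (n : ℕ) (S : State X) (hg : S.Good) :
    (allSum t n S.perm).coeff (absLength S.perm) =
      wprod (fun x => F n (x.1.length + x.2.length)) S := by
  induction n generalizing S with
  | zero =>
    rw [allSum, facSum]
    have hF : ∀ x : List X × List X, F 0 (x.1.length + x.2.length) =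
      if x.1.length + x.2.length = 1 then 1 else 0 := fun x => hw.zero _
    simp only [hF]
    by_cases h1 : ∀ x ∈ S, x.1.length + x.2.length = 1
    · have hp : S.perm = 1 := by
        rw [State.perm]
        apply List.prod_eq_one
        intro σ hσ
        obtain ⟨x, hx, rfl⟩ := List.mem_map.mp hσ
        have hlen : (x.1 ++ x.2).length = 1 := by simpa using h1 x hx
        obtain ⟨y, hy⟩ := List.length_eq_one_iff.mp hlen
        simp only [hy, List.formPerm_singleton]
      rw [hp, if_pos rfl, absLength_one, Polynomial.coeff_one_zero, wprod_congr (w' := fun _ => 1)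
        (fun x hx => by rw [if_pos (h1 x hx)])]
      simp [wprod]
    · push Not at h1
      obtain ⟨x, hx, hne⟩ := h1
      have hS := List.perm_cons_erase hx
      have hg' := hg.of_perm hS
      rw [wprod_perm _ hS, perm_eq_of_perm hg.nodup hS, wprod_cons, if_neg hne, zero_mul, if_neg,
        Polynomial.coeff_zero]
      intro hp
      -- A nonempty cycle whose length is not 1 has two distinct points, so the permutation is not
      -- the identity.
      have hpos := List.length_pos_iff.mpr (hg.ne_nil x hx)
      rw [List.length_append] at hpos
      have hnd : (x.1 ++ x.2).Nodup := by
        have := hg'.nodup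
        rw [pts_cons] at this
        exact (List.nodup_append.mp this).1
      have h01 : (x.1 ++ x.2)[0]'(by simp; omega) ≠ (x.1 ++ x.2)[1]'(by simp; omega) := by
        intro e
        have := (hnd.getElem_inj_iff).mp e
        omega
      have := sameCycle_perm_cons hg'.nodup (List.getElem_mem (l := x.1 ++ x.2) (n := 0)
        (by simp; omega)) (List.getElem_mem (l := x.1 ++ x.2) (n := 1) (by simp; omega))
      rw [hp, sameCycle_one] at this
      exact h01 this
  | succ n ih =>
    -- A new last factor may move every point, so all points become active again.
    have := coeff_allSumOn_state hw ih S.thaw hg.thaw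
    rw [act_thaw, perm_thaw] at this
    have huniv : S.pts.toFinset = Finset.univ := by ext x; simp [hg.full x]
    rw [huniv, allSumOn, facSumOn_univ] at this
    rw [this, thaw, wprod_map]
    refine wprod_congr fun x hx => ?_
    rw [cycleWeight, hw.succ]
    simp

end CycleWeights

end AnnularNC

namespace AnnularNC

/-! ### Factorizations of excess 2 that join an outer and an inner cycle -/

section AnnulusStates

variable {R : Type*} [CommRing R]
variable {X : Type*} [DecidableEq X] [Fintype X] {ι : Type*} [DecidableEq ι]

open Equiv Equiv.Perm State

namespace State

theorem snd_eq_nil_of_act {S : State X} (h : S.act = []) : ∀ x ∈ S, x.2 = [] := by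
  intro x hx
  rw [List.eq_nil_iff_forall_not_mem]
  intro y hy
  have : y ∈ S.act := List.mem_flatMap.mpr ⟨x, hx, hy⟩
  rw [h] at this
  simp at this

theorem color_perm {c : X → ι} {S : State X}
    (h : ∀ x ∈ S, ∀ y ∈ x.1 ++ x.2, ∀ z ∈ x.1 ++ x.2, c y = c z) (y : X) :
    c (perm S y) = c y := by
  induction S with
  | nil => rfl
  | cons x S ih =>
    rw [perm_cons, Perm.mul_apply]
    rw [← ih (fun x hx => h x (by simp [hx]))]
    generalize (perm S) y = z
    by_cases hz : z ∈ x.1 ++ x.2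
    · exact h x (by simp) _ (List.formPerm_apply_mem_of_mem hz) _ hz
    · rw [List.formPerm_apply_of_notMem hz]

theorem color_perm_append {c : X → ι} {co ci : ι} {O I : State X} (hO : ∀ y ∈ O.pts, c y = co)
    (hI : ∀ y ∈ I.pts, c y = ci) (y : X) : c ((O ++ I).perm y) = c y := by
  refine color_perm (fun x hx y hy z hz => ?_) y
  rcases List.mem_append.mp hx with hx | hx
  · rw [hO y (List.mem_flatMap.mpr ⟨x, hx, hy⟩), hO z (List.mem_flatMap.mpr ⟨x, hx, hz⟩)]
  · rw [hI y (List.mem_flatMap.mpr ⟨x, hx, hy⟩), hI z (List.mem_flatMap.mpr ⟨x, hx, hz⟩)]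

theorem join_facts {F A O₁ O₂ : List X} {a j : X} {S : State X}
    (hg : Good ((F, a :: A) :: ([], O₁ ++ j :: O₂) :: S)) :
    Good ((F ++ [a], O₂ ++ O₁ ++ j :: A) :: S) ∧
    perm ((F, a :: A) :: ([], O₁ ++ j :: O₂) :: S) * swap j a =
      perm ((F ++ [a], O₂ ++ O₁ ++ j :: A) :: S) ∧
    (act ((F ++ [a], O₂ ++ O₁ ++ j :: A) :: S)).Perm
      (A ++ act (([], O₁ ++ j :: O₂) :: S)) := by
  refine ⟨hg.of_pts_perm ?_ ?_, ?_, ?_⟩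
  · rw [List.perm_iff_count]
    intro z
    simp [List.count_append, List.count_cons]
    omega
  · intro x hx
    rcases List.mem_cons.mp hx with rfl | hx
    · simp
    · exact hg.ne_nil x (by simp [hx])
  · rw [swap_comm, perm_join hg.nodup]
  · rw [List.perm_iff_count]
    intro z
    simp [List.count_append, List.count_cons]
    omega

end State

theorem wsum_mul_right {Y : Type*} (r : R) (f w : Y → R) (S : List Y) :
    wsum (fun x => f x * r) w S = wsum f w S * r := by
  simp only [mul_comm _ r, wsum_mul_left]

variable {t : ℕ → R} {F : ℕ → ℕ → R} {P : ℕ → ℕ → ℕ → R} {F₂ : ℕ → ℕ → ℕ → R}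
  {Q₁ Q₂ : ℕ → ℕ → ℕ → ℕ → R} {c : X → ι} {co ci : ι}

/-- The weight of a state in which the pair of cycles to be joined lies in `O × I`. -/
def pairSum (q : List X × List X → List X × List X → R) (w : List X × List X → R)
    (O I : State X) : R :=
  wsum (fun o => wsum (q o) w I) w O

/-- With the inner points frozen, the last factor cannot join the two colours; it only cuts outer
cycles. The pair of cycles that will be joined by earlier factors is carried along as the
distinguished pair. -/
theorem coeff_conSumOn_inner_frozen (hw : CycleWeights t F P) (ha : AnnulusWeights t P F₂ Q₁ Q₂)
    {n : ℕ}
    (ih : ∀ O I : State X, (O ++ I : State X).Good → (∀ y ∈ O.pts, c y = co) →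
      (∀ y ∈ I.pts, c y = ci) →
      (conSum c t n (perm (O ++ I))).coeff (absLength (perm (O ++ I)) + 2) =
      pairSum (fun o i => F₂ n (o.1.length + o.2.length) (i.1.length + i.2.length))
        (fun x => F n (x.1.length + x.2.length)) O I)
    (O I : State X) (hg : (O ++ I : State X).Good) (hO : ∀ y ∈ O.pts, c y = co)
    (hI : ∀ y ∈ I.pts, c y = ci) (hIact : I.act = []) :
    (conSumOn c t n (act (O ++ I)).toFinset (perm (O ++ I))).coeff
        (absLength (perm (O ++ I)) + 2) =
      pairSum (fun o i => Q₁ n i.1.length o.1.length o.2.length) (cycleWeight P n) O I := by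
  induction hL : O.act.length generalizing O with
  | zero =>
    rw [List.length_eq_zero_iff] at hL
    rw [act_append, hL, hIact, List.append_nil, List.toFinset_nil, conSumOn_empty, ih O I hg hO hI]
    have h1 := snd_eq_nil_of_act hL
    have h2 := snd_eq_nil_of_act hIact
    refine wsum_congr (fun o ho => wsum_congr (fun i hi => ?_) (fun i hi => ?_)) (fun o ho => ?_)
    · simp only [h1 o ho, h2 i hi, List.length_nil, ha.base₁, add_zero]
    · rw [cycleWeight, h2 i hi, List.length_nil, hw.base, add_zero]
    · rw [cycleWeight, h1 o ho, List.length_nil, hw.base, add_zero]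
  | succ L ihL =>
    obtain ⟨G, a, A, S', hS⟩ := exists_perm_cons_of_act_ne_nil (S := O)
      (by rintro h; rw [h] at hL; simp at hL)
    have hS2 : (O ++ I).Perm (((G, a :: A) :: S') ++ I) := hS.append_right I
    rw [perm_eq_of_perm hg.nodup hS2, List.toFinset_eq_of_perm _ _ (act_perm hS2), pairSum,
      wsum_perm _ _ hS]
    have hg' := hg.of_perm hS2
    have hO' : ∀ y ∈ State.pts ((G, a :: A) :: S'), c y = co := fun y hy =>
      hO y ((pts_perm hS).mem_iff.mpr hy)
    have hL' : A.length + (act S').length = L := by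
      have := (act_perm hS).length_eq
      simp at this
      omega
    have hcol := color_perm_append hO' hI
    rw [List.cons_append] at hg' hcol ⊢
    have hfr := freeze_facts hg'
    let q : ℕ → ℕ → R := fun M K => wsum (fun i => Q₁ n i.1.length M K) (cycleWeight P n) I
    let w := wprod (cycleWeight P n) S'
    let e := wsum (fun o : List X × List X => q o.1.length o.2.length) (cycleWeight P n) S'
    rw [coeff_conSumOn_head hg' hcol
      (fun j hj => by rw [hO' j (by simp [hj]), hO' a (by simp)])
      -- After the cut the distinguished outer cycle is the piece with the frozen points, the fully
      -- active piece, or one of the other cycles, whose total contribution is `e`.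
      (fun i => q (G.length + 1) (A.length - 1 - i) * (P n 0 (i + 1) * w) +
        P n (G.length + 1) (A.length - 1 - i) * (q 0 (i + 1) * w + P n 0 (i + 1) * e))]
    · have hz : ((act (S' ++ I)).map fun j => if c j = c a then 0 else
        (allSumOn t n (A ++ act (S' ++ I)).toFinset (perm ((G, a :: A) :: (S' ++ I)) *
          swap j a)).coeff (absLength (perm ((G, a :: A) :: (S' ++ I)) * swap j a))).sum = 0 := by
        apply List.sum_eq_zero
        intro y hy
        obtain ⟨j, hj, rfl⟩ := List.mem_map.mp hy
        rw [act_append, hIact, List.append_nil] at hj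
        rw [if_pos]
        rw [hO' j (by simp [(act_sublist_pts S').subset hj]), hO' a (by simp)]
      rw [hz, ← List.cons_append, ihL _ hfr (fun y hy => hO' y (by simpa using hy))
        (by simp [hL'])]
      have hq : q G.length (A.length + 1) = q (G.length + 1) A.length +
          t n * ∑ i ∈ Finset.range A.length, (P n 0 (i + 1) * q (G.length + 1) (A.length - 1 - i) +
            q 0 (i + 1) * P n (G.length + 1) (A.length - 1 - i)) := by
        refine (wsum_congr (fun i _ => ha.step₁ _ _ _ _) (fun i _ => rfl)).trans ?_
        simp only [q, wsum_add, wsum_mul_left, wsum_mul_right, wsum_sum]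
      change q (G ++ [a]).length A.length * w + P n (G ++ [a]).length A.length * e + _ + _ =
        q G.length (a :: A).length * w + P n G.length (a :: A).length * e
      rw [List.length_append, List.length_singleton, List.length_cons, hq, hw.step]
      have hs : ∑ i ∈ Finset.range A.length,
          (q (G.length + 1) (A.length - 1 - i) * (P n 0 (i + 1) * w) +
            P n (G.length + 1) (A.length - 1 - i) * (q 0 (i + 1) * w + P n 0 (i + 1) * e)) =
          (∑ i ∈ Finset.range A.length, (P n 0 (i + 1) * q (G.length + 1) (A.length - 1 - i) +
            q 0 (i + 1) * P n (G.length + 1) (A.length - 1 - i))) * w +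
          (∑ i ∈ Finset.range A.length, P n 0 (i + 1) * P n (G.length + 1) (A.length - 1 - i)) *
            e := by
        rw [Finset.sum_mul, Finset.sum_mul, ← Finset.sum_add_distrib]
        exact Finset.sum_congr rfl fun i _ => by ring
      rw [hs]
      ring
    · intro U j V hA
      subst hA
      obtain ⟨h2, h3, h4, h5⟩ := cut_facts hg'
      have := ihL ((G ++ [a], V) :: ([], U ++ [j]) :: S') h2 (fun y hy => hO' y (by
        simp only [pts_cons, List.mem_append, List.mem_cons, List.nil_append] at hy ⊢
        tauto)) (by simp at hL' ⊢; omega)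
      rw [List.cons_append, List.cons_append] at this
      rw [this]
      change q (G ++ [a]).length V.length * (P n 0 (U ++ [j]).length * w) +
        P n (G ++ [a]).length V.length * (q 0 (U ++ [j]).length * w +
          P n 0 (U ++ [j]).length * e) = _
      simp only [List.length_append, List.length_cons, List.length_nil, zero_add]
      rw [show U.length + (V.length + 1) - 1 - U.length = V.length by omega]

/-- The inner points are frozen first, while all outer points are active. A join with an outer point
then leaves a cycle of the required shape, whose minimal factorizations are known. Once every inner
point is frozen, the previous case applies. -/
theorem coeff_conSumOn_outer_active (hw : CycleWeights t F P) (ha : AnnulusWeights t P F₂ Q₁ Q₂)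
    (hci : ci ≠ co) {n : ℕ}
    (ih : ∀ O I : State X, (O ++ I : State X).Good → (∀ y ∈ O.pts, c y = co) →
      (∀ y ∈ I.pts, c y = ci) →
      (conSum c t n (perm (O ++ I))).coeff (absLength (perm (O ++ I)) + 2) =
      pairSum (fun o i => F₂ n (o.1.length + o.2.length) (i.1.length + i.2.length))
        (fun x => F n (x.1.length + x.2.length)) O I)
    (O I : State X) (hg : (I ++ O : State X).Good) (hO : ∀ y ∈ O.pts, c y = co)
    (hI : ∀ y ∈ I.pts, c y = ci) (hOact : ∀ o ∈ O, o.1 = []) :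
    (conSumOn c t n (act (I ++ O)).toFinset (perm (I ++ O))).coeff
        (absLength (perm (I ++ O)) + 2) =
      pairSum (fun o i => Q₂ n o.2.length i.1.length i.2.length) (cycleWeight P n) O I := by
  induction hL : I.act.length generalizing I with
  | zero =>
    rw [List.length_eq_zero_iff] at hL
    have hp : (I ++ O).Perm (O ++ I) := List.perm_append_comm
    rw [perm_eq_of_perm hg.nodup hp, List.toFinset_eq_of_perm _ _ (act_perm hp),
      coeff_conSumOn_inner_frozen hw ha ih O I (hg.of_perm hp) hO hI hL]
    have h1 := snd_eq_nil_of_act hL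
    refine wsum_congr (fun o ho => wsum_congr (fun i hi => ?_) (fun i hi => rfl)) (fun o ho => rfl)
    simp only [h1 i hi, hOact o ho, List.length_nil, ha.base₂]
  | succ L ihL =>
    obtain ⟨G, a, A, S', hS⟩ := exists_perm_cons_of_act_ne_nil (S := I)
      (by rintro h; rw [h] at hL; simp at hL)
    have hS2 : (I ++ O).Perm (((G, a :: A) :: S') ++ O) := hS.append_right O
    rw [perm_eq_of_perm hg.nodup hS2, List.toFinset_eq_of_perm _ _ (act_perm hS2), pairSum,
      wsum_congr (fun o _ => wsum_perm _ _ hS) (fun o _ => rfl)]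
    have hg' := hg.of_perm hS2
    have hI' : ∀ y ∈ State.pts ((G, a :: A) :: S'), c y = ci := fun y hy =>
      hI y ((pts_perm hS).mem_iff.mpr hy)
    have hL' : A.length + (act S').length = L := by
      have := (act_perm hS).length_eq
      simp at this
      omega
    have hcol := color_perm_append hI' hO
    rw [List.cons_append] at hg' hcol ⊢
    have hfr := freeze_facts hg'
    let q : List X × List X → ℕ → ℕ → R := fun o M K => Q₂ n o.2.length M K
    let w := wprod (cycleWeight P n) S'
    let e : List X × List X → R := fun o =>
      wsum (fun i : List X × List X => q o i.1.length i.2.length) (cycleWeight P n) S'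
    rw [coeff_conSumOn_head hg' hcol
      (fun j hj => by rw [hI' j (by simp [hj]), hI' a (by simp)])
      (fun i => wsum (fun o => q o (G.length + 1) (A.length - 1 - i) * (P n 0 (i + 1) * w) +
        P n (G.length + 1) (A.length - 1 - i) * (q o 0 (i + 1) * w + P n 0 (i + 1) * e o))
        (cycleWeight P n) O)]
    -- The joins: each of the `o.2.length` points of an outer cycle `o` gives a cycle with `G.length
    -- + 1` frozen and `o.2.length + A.length` active points.
    · have hz : ((act (S' ++ O)).map fun j => if c j = c a then 0 else
        (allSumOn t n (A ++ act (S' ++ O)).toFinset (perm ((G, a :: A) :: (S' ++ O)) *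
          swap j a)).coeff (absLength (perm ((G, a :: A) :: (S' ++ O)) * swap j a))).sum =
          w * wsum (fun o => (o.2.length : R) * P n (G.length + 1) (o.2.length + A.length))
            (cycleWeight P n) O := by
        rw [act_append, List.map_append, List.sum_append, List.sum_eq_zero, zero_add]
        · rw [← act_append]
          refine sum_flatMap_eq_wsum O (fun o => o.2) _
            (fun o => P n (G.length + 1) (o.2.length + A.length)) (cycleWeight P n) w ?_
          rintro ⟨o₁, o₂⟩ O' hO' j hj
          have ho₁ : o₁ = [] := hOact _ (hO'.mem_iff.mpr List.mem_cons_self)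
          subst ho₁
          obtain ⟨O₁, O₂, rfl⟩ := List.append_of_mem hj
          have hjO : j ∈ O.pts := (pts_perm hO').mem_iff.mpr (by simp)
          rw [if_neg (by rw [hO j hjO, hI' a (by simp)]; exact hci.symm)]
          have hp : ((G, a :: A) :: (S' ++ O)).Perm
              ((G, a :: A) :: ([], O₁ ++ j :: O₂) :: (S' ++ O')) :=
            List.Perm.cons _ ((hO'.append_left S').trans List.perm_middle)
          have hp' : (S' ++ O).Perm (([], O₁ ++ j :: O₂) :: (S' ++ O')) :=
            (hO'.append_left S').trans List.perm_middle
          obtain ⟨h2, h3, h4⟩ := join_facts (hg'.of_perm hp)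
          rw [perm_eq_of_perm hg'.nodup hp, h3,
            List.toFinset_eq_of_perm _ _ (((act_perm hp').append_left A).trans h4.symm),
            coeff_allSumOn_state hw (coeff_allSum_state hw n) _ h2, wprod_cons, wprod_append]
          rw [cycleWeight]
          simp only [List.length_append, List.length_cons, List.length_nil]
          rw [show O₂.length + O₁.length + (A.length + 1) =
            O₁.length + (O₂.length + 1) + A.length by omega]
          ring
        · intro y hy
          obtain ⟨j, hj, rfl⟩ := List.mem_map.mp hy
          rw [if_pos]
          rw [hI' j (by simp [(act_sublist_pts S').subset hj]), hI' a (by simp)]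
      rw [hz, ← List.cons_append, ihL _ hfr (fun y hy => hI' y (by simpa using hy))
        (by simp [hL'])]
      have hq : ∀ o, q o G.length (A.length + 1) = q o (G.length + 1) A.length +
          t n * ∑ i ∈ Finset.range A.length,
            (P n 0 (i + 1) * q o (G.length + 1) (A.length - 1 - i) +
            q o 0 (i + 1) * P n (G.length + 1) (A.length - 1 - i)) +
          t n * (o.2.length * P n (G.length + 1) (o.2.length + A.length)) := fun o =>
        ha.step₂ _ _ _ _
      change wsum (fun o => q o (G ++ [a]).length A.length * w +
          P n (G ++ [a]).length A.length * e o) (cycleWeight P n) O + _ + _ =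
        wsum (fun o => q o G.length (a :: A).length * w + P n G.length (a :: A).length * e o)
          (cycleWeight P n) O
      rw [← wsum_sum, ← wsum_mul_left, ← wsum_mul_left, ← wsum_mul_left, ← wsum_add, ← wsum_add]
      refine wsum_congr (fun o _ => ?_) (fun o _ => rfl)
      rw [List.length_append, List.length_singleton, List.length_cons, hq, hw.step]
      have hs : ∑ i ∈ Finset.range A.length,
          (q o (G.length + 1) (A.length - 1 - i) * (P n 0 (i + 1) * w) +
            P n (G.length + 1) (A.length - 1 - i) * (q o 0 (i + 1) * w + P n 0 (i + 1) * e o)) =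
          (∑ i ∈ Finset.range A.length, (P n 0 (i + 1) * q o (G.length + 1) (A.length - 1 - i) +
            q o 0 (i + 1) * P n (G.length + 1) (A.length - 1 - i))) * w +
          (∑ i ∈ Finset.range A.length, P n 0 (i + 1) * P n (G.length + 1) (A.length - 1 - i)) *
            e o := by
        rw [Finset.sum_mul, Finset.sum_mul, ← Finset.sum_add_distrib]
        exact Finset.sum_congr rfl fun i _ => by ring
      rw [hs]
      ring
    · intro U j V hA
      subst hA
      obtain ⟨h2, h3, h4, h5⟩ := cut_facts hg'
      have := ihL ((G ++ [a], V) :: ([], U ++ [j]) :: S') h2 (fun y hy => hI' y (by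
        simp only [pts_cons, List.mem_append, List.mem_cons, List.nil_append] at hy ⊢
        tauto)) (by simp at hL' ⊢; omega)
      rw [List.cons_append, List.cons_append] at this
      rw [this]
      change wsum (fun o => q o (G ++ [a]).length V.length * (P n 0 (U ++ [j]).length * w) +
        P n (G ++ [a]).length V.length * (q o 0 (U ++ [j]).length * w +
          P n 0 (U ++ [j]).length * e o)) (cycleWeight P n) O = _
      simp only [List.length_append, List.length_cons, List.length_nil, zero_add]
      rw [show U.length + (V.length + 1) - 1 - U.length = V.length by omega]

theorem coeff_conSum_state (hw : CycleWeights t F P) (ha : AnnulusWeights t P F₂ Q₁ Q₂)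
    (hci : ci ≠ co) (n : ℕ) (O I : State X) (hg : (O ++ I : State X).Good)
    (hO : ∀ y ∈ O.pts, c y = co) (hI : ∀ y ∈ I.pts, c y = ci) :
    (conSum c t n (perm (O ++ I))).coeff (absLength (perm (O ++ I)) + 2) =
      pairSum (fun o i => F₂ n (o.1.length + o.2.length) (i.1.length + i.2.length))
        (fun x => F n (x.1.length + x.2.length)) O I := by
  induction n generalizing O I with
  | zero =>
    rw [conSum_zero, Polynomial.coeff_zero, pairSum]
    have h0 : ∀ (w : List X × List X → R) (S : State X), wsum (fun _ => (0 : R)) w S = 0 := by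
      intro w S
      have := wsum_mul_left 0 (fun _ => (0 : R)) w S
      simpa using this
    simp only [ha.zero, h0]
  | succ n ih =>
    have hp : (O ++ I).Perm (I ++ O) := List.perm_append_comm
    have hg' := hg.of_perm hp
    have hth : thaw I ++ thaw O = thaw (I ++ O) := by simp [thaw]
    have := coeff_conSumOn_outer_active hw ha hci ih O.thaw I.thaw (hth ▸ hg'.thaw)
      (by simpa using hO) (by simpa using hI) (by simp only [thaw, List.mem_map]; rintro _ ⟨x, -, rfl⟩; rfl)
    rw [hth, act_thaw, perm_thaw] at this
    have huniv : (pts (I ++ O)).toFinset = Finset.univ := by ext x; simpa using hg'.full x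
    rw [huniv, conSumOn_univ] at this
    rw [perm_eq_of_perm hg.nodup hp, this, pairSum, pairSum]
    conv_lhs => rw [thaw.eq_1 O, wsum_map]
    refine wsum_congr (fun o ho => ?_) (fun o ho => ?_)
    · rw [thaw, wsum_map]
      refine wsum_congr (fun i hi => ?_) (fun i hi => ?_)
      · simp [ha.succ]
      · simp [cycleWeight, hw.succ]
    · simp [cycleWeight, hw.succ]

end AnnulusStates

end AnnularNC

namespace AnnularNC

/-! ### Weighted lattice walks and first passage -/

section Walks

variable {R : Type*} [CommRing R]

open Polynomial

/-- One step of a walk with step polynomial `f`, where the walks that hit `-1` are discarded. -/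
noncomputable def walkStep (f s : R[X]) : R[X] := divX (f * s)

/-- The weight of the walks with `k` steps which start with height distribution `s` and hit `-1`
for the first time in the last step. -/
noncomputable def hitWeight (f s : R[X]) : ℕ → R
  | 0 => 0
  | k + 1 => (f * (walkStep f)^[k] s).coeff 0

/-- Walks with `M` steps of type `f` followed by `K` steps of type `g`. -/
noncomputable def mixedWalk (f g s : R[X]) (M K : ℕ) : R[X] :=
  (walkStep g)^[K] ((walkStep f)^[M] s)

/-- The first passage weight for `M` steps of type `f` followed by `K` steps of type `g`. -/
noncomputable def mixedHit (f g s : R[X]) (M : ℕ) : ℕ → R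
  | 0 => hitWeight f s M
  | K + 1 => hitWeight g ((walkStep f)^[M] s) (K + 1)

theorem mixedHit_zero_left (f g s : R[X]) (K : ℕ) : mixedHit f g s 0 K = hitWeight g s K := by
  cases K <;> rfl

/-- The constant term of the product is the weight of the walks that hit -1 in this step; the rest
survives one unit lower. -/
theorem mul_mixedWalk (f g s : R[X]) (M K : ℕ) :
    g * mixedWalk f g s M K = X * mixedWalk f g s M (K + 1) + C (mixedHit f g s M (K + 1)) := by
  rw [mixedWalk, mixedWalk, Function.iterate_succ_apply', mixedHit, hitWeight, walkStep]
  exact (X_mul_divX_add _).symm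

theorem mul_mixedWalk_zero (f g s : R[X]) (M : ℕ) :
    f * mixedWalk f g s M 0 = X * mixedWalk f g s (M + 1) 0 + C (mixedHit f g s (M + 1) 0) := by
  rw [mixedWalk, mixedWalk, Function.iterate_succ_apply', mixedHit, hitWeight, walkStep]
  exact (X_mul_divX_add _).symm

theorem walkStep_add (f s s' : R[X]) : walkStep f (s + s') = walkStep f s + walkStep f s' := by
  rw [walkStep, mul_add, divX_add]; rfl

theorem walkStep_C_mul (f s : R[X]) (r : R) : walkStep f (C r * s) = C r * walkStep f s := by
  rw [walkStep, mul_left_comm, divX_C_mul]; rfl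

theorem iterate_walkStep_add (f s s' : R[X]) (k : ℕ) :
    (walkStep f)^[k] (s + s') = (walkStep f)^[k] s + (walkStep f)^[k] s' := by
  induction k with
  | zero => rfl
  | succ k ih => simp only [Function.iterate_succ_apply', ih, walkStep_add]

theorem iterate_walkStep_C_mul (f s : R[X]) (r : R) (k : ℕ) :
    (walkStep f)^[k] (C r * s) = C r * (walkStep f)^[k] s := by
  induction k with
  | zero => rfl
  | succ k ih => simp only [Function.iterate_succ_apply', ih, walkStep_C_mul]

theorem hitWeight_add (f s s' : R[X]) (k : ℕ) :
    hitWeight f (s + s') k = hitWeight f s k + hitWeight f s' k := by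
  cases k with
  | zero => simp [hitWeight]
  | succ k => rw [hitWeight, iterate_walkStep_add, mul_add, coeff_add]; rfl

theorem hitWeight_C_mul (f s : R[X]) (r : R) (k : ℕ) :
    hitWeight f (C r * s) k = r * hitWeight f s k := by
  cases k with
  | zero => simp [hitWeight]
  | succ k => rw [hitWeight, iterate_walkStep_C_mul, mul_left_comm, coeff_C_mul]; rfl

theorem hitWeight_iterate (g s : R[X]) (K k : ℕ) :
    hitWeight g ((walkStep g)^[K] s) (k + 1) = hitWeight g s (k + 1 + K) := by
  rw [hitWeight, ← Function.iterate_add_apply, show k + 1 + K = k + K + 1 by omega, hitWeight]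

end Walks

/-! ### Fixed points of formal power series -/

section SeriesLemmas

variable {R : Type*} [CommRing R]

open PowerSeries

theorem series_eq_zero_of_forall_dvd {δ : R⟦X⟧} (h : ∀ n, X ^ n ∣ δ) : δ = 0 := by
  ext n
  exact X_pow_dvd_iff.mp (h (n + 1)) n (Nat.lt_succ_self n)

theorem series_eq_zero_of_shift {δ : ℕ → R⟦X⟧} (h : ∀ K, δ K = X * δ (K + 1)) (K : ℕ) :
    δ K = 0 := by
  apply series_eq_zero_of_forall_dvd
  intro n
  induction n generalizing K with
  | zero => simp
  | succ n ih => rw [h K, pow_succ']; exact mul_dvd_mul_left _ (ih _)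

theorem sub_dvd_aeval_sub (g : Polynomial R) (a b : R⟦X⟧) :
    a - b ∣ Polynomial.aeval a g - Polynomial.aeval b g := by
  have := Polynomial.sub_dvd_eval_sub a b (g.map (algebraMap R R⟦X⟧))
  rwa [Polynomial.eval_map_algebraMap, Polynomial.eval_map_algebraMap] at this

/-- The power series solution of `w = z g(w)`. -/
theorem exists_fixedPoint (g : Polynomial R) : ∃ w : R⟦X⟧, w = X * Polynomial.aeval w g := by
  let u : ℕ → R⟦X⟧ := fun k => (fun w => X * Polynomial.aeval w g)^[k] 0
  have hu : ∀ k, u (k + 1) = X * Polynomial.aeval (u k) g := fun k =>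
    Function.iterate_succ_apply' _ _ _
  have hstep : ∀ k, (X : R⟦X⟧) ^ k ∣ u (k + 1) - u k := by
    intro k
    induction k with
    | zero => simp
    | succ k ih =>
      have := sub_dvd_aeval_sub g (u (k + 1)) (u k)
      rw [hu (k + 1)]
      nth_rewrite 2 [hu k]
      rw [← mul_sub, pow_succ']
      exact mul_dvd_mul_left _ (ih.trans this)
  have hmono : ∀ n k, (X : R⟦X⟧) ^ n ∣ u (n + k) - u n := by
    intro n k
    induction k with
    | zero => simp
    | succ k ih =>
      have := (pow_dvd_pow (X : R⟦X⟧) (Nat.le_add_right n k)).trans (hstep (n + k))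
      have h2 := dvd_add this ih
      rwa [sub_add_sub_cancel] at h2
  -- The iterates agree modulo `X ^ (n + 1)` from `u (n + 1)` on, so this is their limit.
  let w : R⟦X⟧ := mk fun n => coeff n (u (n + 1))
  have hw : ∀ n, (X : R⟦X⟧) ^ n ∣ w - u n := by
    intro n
    rw [X_pow_dvd_iff]
    intro i hi
    have := X_pow_dvd_iff.mp (hmono (i + 1) (n - (i + 1))) i (Nat.lt_succ_self i)
    rw [show i + 1 + (n - (i + 1)) = n by omega, map_sub, sub_eq_zero] at this
    rw [map_sub, coeff_mk, this, sub_self]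
  refine ⟨w, ?_⟩
  rw [← sub_eq_zero]
  apply series_eq_zero_of_forall_dvd
  intro n
  have h1 := (pow_dvd_pow (X : R⟦X⟧) (Nat.le_succ n)).trans (hw (n + 1))
  have h2 : (X : R⟦X⟧) ^ n ∣ X * (Polynomial.aeval w g - Polynomial.aeval (u n) g) :=
    Dvd.dvd.mul_left ((hw n).trans (sub_dvd_aeval_sub g _ _)) _
  have := dvd_sub h1 h2
  rwa [hu, mul_sub, sub_sub_sub_cancel_right] at this

theorem coeff_mul_of_constantCoeff_eq_zero {a b : R⟦X⟧} (ha : coeff 0 a = 0) (K : ℕ) :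
    coeff K (a * b) = ∑ i ∈ Finset.range K, coeff (i + 1) a * coeff (K - 1 - i) b := by
  rw [coeff_mul, Finset.Nat.sum_antidiagonal_eq_sum_range_succ
    (fun i j => coeff i a * coeff j b), Finset.sum_range_succ', ha, zero_mul, add_zero]
  refine Finset.sum_congr rfl fun i hi => ?_
  rw [Nat.sub_sub, add_comm 1 i]

end SeriesLemmas

/-! ### First passage series by the kernel method -/

section FirstPassageSeries

variable {R : Type*} [CommRing R]

open PowerSeries

/-- The first passage series for `M` steps of type `f` followed by steps of type `g`. -/
noncomputable def hitSeries (f g s : Polynomial R) (M : ℕ) : R⟦X⟧ := mk (mixedHit f g s M)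

/-- First passage from height `h` to -1 by steps of type `g` has series `w ^ (h + 1)`, because each
of the `h + 1` levels costs one factor `w`. In the proof, the difference of the two sides satisfies
`δ K = X * δ (K + 1)` and therefore vanishes. -/
theorem hitSeries_eq {f g s : Polynomial R} {w : R⟦X⟧} (hw : w = X * Polynomial.aeval w g)
    (M : ℕ) : hitSeries f g s M =
      C (mixedHit f g s M 0) + w * Polynomial.aeval w (mixedWalk f g s M 0) := by
  -- The hits strictly after `K` steps of type `g`; a hit in the `K`-th step itself is left out,
  -- whence the value 0 at `j = 0`.
  let tail : ℕ → R⟦X⟧ := fun K => mk fun j => if j = 0 then 0 else mixedHit f g s M (K + j)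
  have h1 : ∀ K, w * Polynomial.aeval w (mixedWalk f g s M K) - tail K =
      X * (w * Polynomial.aeval w (mixedWalk f g s M (K + 1)) - tail (K + 1)) := by
    intro K
    have e1 : w * Polynomial.aeval w (mixedWalk f g s M K) =
        X * (w * Polynomial.aeval w (mixedWalk f g s M (K + 1)) +
          C (mixedHit f g s M (K + 1))) := by
      refine (congrArg (· * Polynomial.aeval w (mixedWalk f g s M K)) hw).trans ?_
      simp only [mul_assoc]
      rw [← map_mul, mul_mixedWalk]
      simp
    have e2 : tail K = X * (tail (K + 1) + C (mixedHit f g s M (K + 1))) := by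
      ext j
      cases j with
      | zero => simp [tail]
      | succ j =>
        rw [coeff_succ_X_mul, map_add, coeff_mk, coeff_mk, coeff_C]
        cases j with
        | zero => simp
        | succ j => simp; congr 1; omega
    rw [e1, e2]
    ring
  have h0 := series_eq_zero_of_shift h1 0
  rw [sub_eq_zero] at h0
  rw [h0]
  ext j
  rw [hitSeries, coeff_mk, map_add, coeff_mk, coeff_C]
  cases j <;> simp

theorem hitSeries_succ {f g s : Polynomial R} {w : R⟦X⟧} (hw : w = X * Polynomial.aeval w g)
    (M : ℕ) : hitSeries f g s (M + 1) =
      Polynomial.aeval w f * Polynomial.aeval w (mixedWalk f g s M 0) := by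
  rw [hitSeries_eq hw, ← map_mul, mul_mixedWalk_zero]
  simp [add_comm]

/-- Writing `w = X * f(w) * (1 + t w)`, the factor `f(w)` is one more step of type `f` and raises
`M` to `M + 1`. -/
theorem hitSeries_step {f g s : Polynomial R} {w : R⟦X⟧} {t : R}
    (hw : w = X * Polynomial.aeval w g) (hg : g = f * (1 + Polynomial.C t * Polynomial.X)) (M : ℕ) :
    hitSeries f g s M =
      C (mixedHit f g s M 0) + X * (1 + C t * w) * hitSeries f g s (M + 1) := by
  rw [hitSeries_succ hw, hitSeries_eq hw]
  congr 1
  refine (congrArg (· * Polynomial.aeval w (mixedWalk f g s M 0)) hw).trans ?_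
  have : Polynomial.aeval w g = Polynomial.aeval w f * (1 + C t * w) := by
    rw [hg]; simp
  simp only [this]
  ring

theorem hitSeries_one_zero {f g : Polynomial R} {w : R⟦X⟧} (hw : w = X * Polynomial.aeval w g) :
    hitSeries f g 1 0 = w := by
  rw [hitSeries_eq hw]
  simp [mixedHit, hitWeight, mixedWalk]

theorem constantCoeff_fixedPoint {g : Polynomial R} {w : R⟦X⟧}
    (hw : w = X * Polynomial.aeval w g) : coeff 0 w = 0 := by
  rw [hw]; simp

end FirstPassageSeries

end AnnularNC

namespace AnnularNC

/-! ### Two cycles, the inner one frozen -/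

section OuterSeries

variable {R : Type*} [CommRing R]

open PowerSeries

/-- The series `z (1 + t w)`. -/
noncomputable def shiftSeries (t : R) (w : R⟦X⟧) : R⟦X⟧ := X * (1 + C t * w)

/-- Since `w` has no constant term, `y = shiftSeries t w` has derivative with constant term 1.
Dividing by it gives the derivation `∂ = d/dy`. -/
theorem shiftSeries_unit (t : R) {w : R⟦X⟧} (h0 : coeff 0 w = 0) :
    derivative R (shiftSeries t w) * invOfUnit (derivative R (shiftSeries t w)) 1 = 1 := by
  apply mul_invOfUnit
  have : constantCoeff (derivative R (shiftSeries t w)) = coeff 1 (shiftSeries t w) := by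
    rw [← coeff_zero_eq_constantCoeff_apply, coeff_derivative]; simp
  rw [this, shiftSeries, ← zero_add 1, coeff_succ_X_mul, map_add]
  simp at h0
  simp [h0]

/-- The series of the weights for two cycles where the inner cycle is frozen. -/
noncomputable def outerSeries (f g s : Polynomial R) (t : R) (w : R⟦X⟧) (M : ℕ) : R⟦X⟧ :=
  (M : R⟦X⟧) * hitSeries f g s M +
    shiftSeries t w * (derivative R (hitSeries f g s M) *
      invOfUnit (derivative R (shiftSeries t w)) 1) +
    C t * X * (derivative R (hitSeries f g 1 M) *
      invOfUnit (derivative R (shiftSeries t w)) 1) * (X * derivative R (hitSeries f g s 0))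

variable {f g s : Polynomial R} {t : R} {w : R⟦X⟧}

/-- This is `∂` applied to `H_M = const + y H_(M+1)`. -/
theorem derivative_hitSeries (hw : w = X * Polynomial.aeval w g)
    (hg : g = f * (1 + Polynomial.C t * Polynomial.X)) (M : ℕ) :
    derivative R (hitSeries f g s M) * invOfUnit (derivative R (shiftSeries t w)) 1 =
      hitSeries f g s (M + 1) + shiftSeries t w * (derivative R (hitSeries f g s (M + 1)) *
        invOfUnit (derivative R (shiftSeries t w)) 1) := by
  have hu := shiftSeries_unit t (constantCoeff_fixedPoint hw)
  have h1 : derivative R (hitSeries f g s M) = derivative R (shiftSeries t w) *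
      hitSeries f g s (M + 1) + shiftSeries t w * derivative R (hitSeries f g s (M + 1)) := by
    rw [hitSeries_step hw hg M, ← shiftSeries, map_add, derivative_C, zero_add,
      Derivation.leibniz, smul_eq_mul, smul_eq_mul]
    ring
  rw [h1]
  linear_combination (hitSeries f g s (M + 1)) * hu

/-- From `z y' = y + t z² w'`, multiplied by the derivative of `H_0` and divided by `y'`. The
operator `z d/dz` will produce the factor `a` in the weight of two cycles. -/
theorem outerSeries_zero (hw : w = X * Polynomial.aeval w g) :
    outerSeries f g s t w 0 = X * derivative R (hitSeries f g s 0) := by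
  have hu := shiftSeries_unit t (constantCoeff_fixedPoint hw)
  have h1 : X * derivative R (shiftSeries t w) =
      shiftSeries t w + C t * X * (X * derivative R w) := by
    rw [shiftSeries, Derivation.leibniz, map_add, derivative_one, Derivation.leibniz,
      derivative_C, derivative_X]
    simp only [smul_eq_mul]
    ring
  rw [outerSeries, hitSeries_one_zero hw]
  push_cast
  linear_combination (-derivative R (hitSeries f g s 0) *
    invOfUnit (derivative R (shiftSeries t w)) 1) * h1 +
    X * derivative R (hitSeries f g s 0) * hu

/-- The operator `M + y ∂` turns `H_M = c_M + y H_(M+1)` into the same relation with constant term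
`M c_M`. The third summand of `outerSeries` contributes the quadratic term with `outerSeries` at 0,
because `∂H_M = H_(M+1) + y ∂H_(M+1)` for the start `s = 1`. -/
theorem outerSeries_step (hw : w = X * Polynomial.aeval w g)
    (hg : g = f * (1 + Polynomial.C t * Polynomial.X)) (M : ℕ) :
    outerSeries f g s t w M = C ((M : R) * mixedHit f g s M 0) +
      X * (outerSeries f g s t w (M + 1) + C t * (w * outerSeries f g s t w (M + 1) +
        outerSeries f g s t w 0 * hitSeries f g 1 (M + 1))) := by
  have h1 := derivative_hitSeries (s := s) hw hg M
  have h2 := derivative_hitSeries (s := 1) hw hg M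
  have h3 := hitSeries_step (s := s) hw hg M
  have hM : (C ((M : R) * mixedHit f g s M 0) : R⟦X⟧) = (M : R⟦X⟧) * C (mixedHit f g s M 0) := by
    rw [map_mul, map_natCast]
  rw [hM, outerSeries_zero hw]
  simp only [outerSeries]
  rw [h1, h2, h3, shiftSeries]
  push_cast
  ring

theorem constantCoeff_outerSeries (M : ℕ) :
    coeff 0 (outerSeries f g s t w M) = (M : R) * mixedHit f g s M 0 := by
  simp [outerSeries, shiftSeries, hitSeries]

end OuterSeries

/-! ### Two cycles, the outer one active: Laurent coefficients -/

section InnerSeries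

variable {R : Type*} [CommRing R]

open PowerSeries
open scoped LaurentPolynomial

theorem trunc_T_neg_one_mul (p : R[T;T⁻¹]) :
    LaurentPolynomial.trunc (LaurentPolynomial.T (-1) * p) =
      Polynomial.divX (LaurentPolynomial.trunc p) := by
  induction p using LaurentPolynomial.induction_on' with
  | add p q hp hq => rw [mul_add, map_add, map_add, hp, hq, Polynomial.divX_add]
  | C_mul_T n a =>
    rw [mul_left_comm, ← LaurentPolynomial.T_add, LaurentPolynomial.trunc_C_mul_T,
      LaurentPolynomial.trunc_C_mul_T]
    rcases lt_trichotomy n 0 with h | h | h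
    · rw [if_neg (by omega), if_neg (by omega), Polynomial.divX_zero]
    · subst h
      simp
    · rw [if_pos (by omega), if_pos (by omega)]
      ext k
      rw [Polynomial.coeff_divX, Polynomial.coeff_monomial, Polynomial.coeff_monomial]
      congr 1
      simp only [eq_iff_iff]
      omega

/-- The functional which sends `T ^ c` with `c ≥ 1` to the weight of the walks with `n` steps
which first hit `-1` at the end, starting from `c - 1`. -/
noncomputable def laurentHit (g : Polynomial R) (n : ℕ) : R[T;T⁻¹] →+ R where
  toFun p := hitWeight g (LaurentPolynomial.trunc (LaurentPolynomial.T (-1) * p)) n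
  map_zero' := by
    have := hitWeight_C_mul g 0 (0 : R) n
    simpa using this
  map_add' p q := by rw [mul_add, map_add, hitWeight_add]

theorem laurentHit_C_mul (g : Polynomial R) (n : ℕ) (r : R) (p : R[T;T⁻¹]) :
    laurentHit g n (LaurentPolynomial.C r * p) = r * laurentHit g n p := by
  have htr : ∀ q : R[T;T⁻¹], LaurentPolynomial.trunc (LaurentPolynomial.C r * q) =
      Polynomial.C r * LaurentPolynomial.trunc q := by
    intro q
    induction q using LaurentPolynomial.induction_on' with
    | add p q hp hq => rw [mul_add, map_add, map_add, hp, hq, mul_add]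
    | C_mul_T n a =>
      rw [← mul_assoc, ← map_mul, LaurentPolynomial.trunc_C_mul_T,
        LaurentPolynomial.trunc_C_mul_T]
      split_ifs <;> simp [Polynomial.C_mul_monomial]
  simp only [laurentHit, AddMonoidHom.coe_mk, ZeroHom.coe_mk]
  rw [mul_left_comm, htr, hitWeight_C_mul]

theorem laurentHit_T_mul (g p : Polynomial R) (n : ℕ) :
    laurentHit g n (LaurentPolynomial.T 1 * Polynomial.toLaurent p) = hitWeight g p n := by
  simp only [laurentHit, AddMonoidHom.coe_mk, ZeroHom.coe_mk]
  rw [← mul_assoc, ← LaurentPolynomial.T_add, neg_add_cancel, LaurentPolynomial.T_zero, one_mul,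
    Polynomial.trunc_toLaurent]

theorem laurentHit_T_neg_mul (g p : Polynomial R) (n k : ℕ) :
    laurentHit g n (LaurentPolynomial.T (-k) * Polynomial.toLaurent p) =
      hitWeight g (Polynomial.divX^[k + 1] p) n := by
  have : ∀ k : ℕ, LaurentPolynomial.trunc (LaurentPolynomial.T (-k) * Polynomial.toLaurent p) =
      Polynomial.divX^[k] p := by
    intro k
    induction k with
    | zero => simp [Polynomial.trunc_toLaurent]
    | succ k ih =>
      rw [Function.iterate_succ_apply', ← ih, ← trunc_T_neg_one_mul, ← mul_assoc,
        ← LaurentPolynomial.T_add]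
      congr 3
      push_cast
      ring
  simp only [laurentHit, AddMonoidHom.coe_mk, ZeroHom.coe_mk]
  rw [trunc_T_neg_one_mul, this, Function.iterate_succ_apply']

/-- The coefficientwise extension of `laurentHit` to power series. -/
noncomputable def seriesHit (g : Polynomial R) (n : ℕ) : R[T;T⁻¹]⟦X⟧ →+ R⟦X⟧ where
  toFun F := mk fun k => laurentHit g n (coeff k F)
  map_zero' := by ext; simp
  map_add' F G := by ext; simp

theorem coeff_seriesHit (g : Polynomial R) (n k : ℕ) (F : R[T;T⁻¹]⟦X⟧) :
    coeff k (seriesHit g n F) = laurentHit g n (coeff k F) := by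
  simp [seriesHit]

theorem seriesHit_map_mul (g : Polynomial R) (n : ℕ) (r : R⟦X⟧) (F : R[T;T⁻¹]⟦X⟧) :
    seriesHit g n (PowerSeries.map LaurentPolynomial.C r * F) = r * seriesHit g n F := by
  ext k
  rw [coeff_seriesHit, coeff_mul, coeff_mul, map_sum]
  refine Finset.sum_congr rfl fun p _ => ?_
  rw [coeff_map, laurentHit_C_mul, coeff_seriesHit]

/-- A polynomial as a constant series with Laurent polynomial coefficients. -/
noncomputable def constSeries : Polynomial R →+* R[T;T⁻¹]⟦X⟧ :=
  (PowerSeries.C (R := R[T;T⁻¹])).comp Polynomial.toLaurent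

/-- A power of `T` as a constant series. -/
noncomputable def constT (n : ℤ) : R[T;T⁻¹]⟦X⟧ := PowerSeries.C (LaurentPolynomial.T n)

theorem constT_mul (m n : ℤ) : (constT m * constT n : R[T;T⁻¹]⟦X⟧) = constT (m + n) := by
  rw [constT, constT, constT, ← map_mul, LaurentPolynomial.T_add]

theorem constSeries_X : constSeries (Polynomial.X : Polynomial R) = constT 1 := by
  simp [constSeries, constT]

theorem constSeries_C (r : R) : constSeries (Polynomial.C r) =
    PowerSeries.map LaurentPolynomial.C (PowerSeries.C r) := by
  simp [constSeries]

/-- The geometric series `1 / (1 - z g / T)`. -/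
noncomputable def geomSeries (g : Polynomial R) : R[T;T⁻¹]⟦X⟧ :=
  mk fun k => LaurentPolynomial.T (-k) * Polynomial.toLaurent (g ^ k)

theorem geomSeries_spec (g : Polynomial R) :
    (1 - X * (constT (-1) * constSeries g)) * geomSeries g = 1 := by
  rw [sub_mul, one_mul, mul_assoc]
  ext1 k
  cases k with
  | zero => simp [geomSeries]
  | succ k =>
    rw [map_sub, coeff_succ_X_mul, constT, constSeries, RingHom.comp_apply, ← map_mul, coeff_C_mul,
      geomSeries, coeff_mk, coeff_mk, coeff_one, if_neg (by omega), sub_eq_zero, pow_succ, map_mul,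
      mul_mul_mul_comm, ← LaurentPolynomial.T_add, mul_comm (Polynomial.toLaurent g)]
    congr 2
    push_cast
    ring

/-- The series of walk polynomials. -/
noncomputable def walkSeries (f g s : Polynomial R) (M : ℕ) : R[T;T⁻¹]⟦X⟧ :=
  mk fun K => Polynomial.toLaurent (mixedWalk f g s M K)

/-- The kernel equation `(T - z g) W = T N - (H - c)`, where `N` is the distribution after the
`f`-steps and `H - c` collects the hits by `g`-steps. -/
theorem walkSeries_eq (f g s : Polynomial R) (M : ℕ) :
    X * (constSeries g * walkSeries f g s M) =
      constT 1 * (walkSeries f g s M - constSeries (mixedWalk f g s M 0)) +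
        PowerSeries.map LaurentPolynomial.C (hitSeries f g s M - C (mixedHit f g s M 0)) := by
  ext1 k
  cases k with
  | zero =>
    rw [coeff_zero_X_mul, map_add, coeff_map, map_sub, hitSeries, coeff_mk, coeff_zero_C, sub_self,
      map_zero, add_zero, constT, coeff_C_mul, map_sub, walkSeries, coeff_mk, constSeries,
      RingHom.comp_apply, coeff_zero_C, sub_self, mul_zero]
  | succ k =>
    have := congrArg Polynomial.toLaurent (mul_mixedWalk f g s M k)
    rw [map_mul, map_add, map_mul, Polynomial.toLaurent_X, Polynomial.toLaurent_C] at this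
    rw [coeff_succ_X_mul, constSeries, RingHom.comp_apply, coeff_C_mul, map_add, constT,
      coeff_C_mul, map_sub, coeff_map, map_sub, walkSeries, coeff_mk, coeff_mk, this, hitSeries,
      coeff_mk, RingHom.comp_apply, coeff_C, coeff_C, if_neg (by omega), if_neg (by omega),
      sub_zero, sub_zero]

theorem constSeries_mul_mixedWalk (f g s : Polynomial R) (M : ℕ) :
    constSeries f * constSeries (mixedWalk f g s M 0) =
      constT 1 * constSeries (mixedWalk f g s (M + 1) 0) +
        PowerSeries.map LaurentPolynomial.C (C (mixedHit f g s (M + 1) 0)) := by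
  rw [← map_mul, mul_mixedWalk_zero, map_add, map_mul, constSeries_X, constSeries_C]

/-- The inverse of `1 - z' f / T`, where `z' = z (1 + t w)`. -/
noncomputable def shiftedGeomSeries (f : Polynomial R) (t : R) (w : R⟦X⟧) : R[T;T⁻¹]⟦X⟧ :=
  invOfUnit (1 - PowerSeries.map LaurentPolynomial.C (shiftSeries t w) *
    (constT (-1) * constSeries f)) 1

theorem shiftedGeomSeries_spec (f : Polynomial R) (t : R) (w : R⟦X⟧) :
    (1 - PowerSeries.map LaurentPolynomial.C (shiftSeries t w) * (constT (-1) * constSeries f)) *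
      shiftedGeomSeries f t w = 1 := by
  apply mul_invOfUnit
  simp [shiftSeries]

/-- The Laurent series behind `innerSeries`. -/
noncomputable def innerLaurent (f g : Polynomial R) (t : R) (w : R⟦X⟧) (M : ℕ) : R[T;T⁻¹]⟦X⟧ :=
  (constT (-1) * constSeries f) ^ M * shiftedGeomSeries f t w +
    PowerSeries.map LaurentPolynomial.C (C t * X) * (constT 1 * (constT (-1) * constSeries f)) *
      ((constSeries (mixedWalk f g 1 M 0) - constT (-1) *
        PowerSeries.map LaurentPolynomial.C (hitSeries f g 1 M - C (mixedHit f g 1 M 0))) *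
        shiftedGeomSeries f t w) * geomSeries g

/-- The series of the weights for two cycles where the outer cycle, of length `n`, is active. -/
noncomputable def innerSeries (f g : Polynomial R) (t : R) (w : R⟦X⟧) (n M : ℕ) : R⟦X⟧ :=
  seriesHit g n (innerLaurent f g t w M)

variable {f g : Polynomial R} {t : R} {w : R⟦X⟧}

/-- A resolvent identity: as `g = f (1 + t T)`, one has `1 - y f/T = (1 - z g/T) + t z f (1 - w/T)`
with `y = z (1 + t w)`; now multiply by both inverses. -/
theorem innerLaurent_zero (hw : w = X * Polynomial.aeval w g)
    (hg : g = f * (1 + Polynomial.C t * Polynomial.X)) :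
    innerLaurent f g t w 0 = geomSeries g := by
  have h1 := geomSeries_spec g
  have h2 := shiftedGeomSeries_spec f t w
  have hgs : constSeries g = constSeries f *
      (1 + PowerSeries.map LaurentPolynomial.C (C t) * constT 1) := by
    conv_lhs => rw [hg]
    rw [map_mul, map_add, map_one, map_mul, constSeries_C, constSeries_X]
  have hT : (constT (-1) * constT 1 : R[T;T⁻¹]⟦X⟧) = 1 := by
    rw [constT_mul]; simp [constT]
  have hp : hitSeries f g 1 0 - C (mixedHit f g 1 0 0) = w := by
    rw [hitSeries_one_zero hw]; simp [mixedHit, hitWeight]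
  have hs : PowerSeries.map LaurentPolynomial.C (shiftSeries t w) =
      X * (1 + PowerSeries.map LaurentPolynomial.C (C t) *
        PowerSeries.map LaurentPolynomial.C w) := by
    simp [shiftSeries]
  rw [innerLaurent, hp, map_mul, PowerSeries.map_X, pow_zero, one_mul]
  have hN : constSeries (mixedWalk f g 1 0 0) = 1 := by simp [mixedWalk]
  rw [hN]
  rw [hgs] at h1
  rw [hs] at h2
  generalize PowerSeries.map LaurentPolynomial.C w = w' at *
  generalize PowerSeries.map LaurentPolynomial.C (C t) = t' at *
  generalize constSeries f = f' at *
  generalize (constT (-1) : R[T;T⁻¹]⟦X⟧) = m at *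
  generalize (constT 1 : R[T;T⁻¹]⟦X⟧) = p at *
  generalize shiftedGeomSeries f t w = J at *
  generalize geomSeries g = I at *
  linear_combination I * h2 - J * h1 - J * I * t' * X * f' * m * w' * hT

/-- In the last bracket, the walk series describes the cycle made by a join, and the product of
`hitSeries` with the geometric series describes a cut whose fully active piece is the one to be
joined. -/
theorem innerLaurent_step (hw : w = X * Polynomial.aeval w g)
    (hg : g = f * (1 + Polynomial.C t * Polynomial.X)) (M : ℕ) :
    innerLaurent f g t w M = (constT (-1) * constSeries f) ^ M +
      PowerSeries.map LaurentPolynomial.C (shiftSeries t w) * innerLaurent f g t w (M + 1) +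
      PowerSeries.map LaurentPolynomial.C (C t * X) *
        (constT 1 * walkSeries f g 1 (M + 1) +
          PowerSeries.map LaurentPolynomial.C (hitSeries f g 1 (M + 1)) * geomSeries g) := by
  have hI := geomSeries_spec g
  have hJ := shiftedGeomSeries_spec f t w
  have hT : (constT (-1) * constT 1 : R[T;T⁻¹]⟦X⟧) = 1 := by
    rw [constT_mul]; simp [constT]
  have hN := constSeries_mul_mixedWalk f g 1 M
  have hW := walkSeries_eq f g 1 (M + 1)
  have hP : PowerSeries.map LaurentPolynomial.C (hitSeries f g 1 M - C (mixedHit f g 1 M 0)) =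
      PowerSeries.map LaurentPolynomial.C (shiftSeries t w) *
        PowerSeries.map LaurentPolynomial.C (hitSeries f g 1 (M + 1)) := by
    rw [← map_mul]
    congr 1
    rw [hitSeries_step hw hg M, shiftSeries]
    ring
  rw [innerLaurent, innerLaurent, hP]
  rw [map_sub] at hW ⊢
  generalize PowerSeries.map LaurentPolynomial.C (C t * X) = t' at *
  generalize PowerSeries.map LaurentPolynomial.C (shiftSeries t w) = Z at *
  generalize PowerSeries.map LaurentPolynomial.C (hitSeries f g 1 (M + 1)) = P at *
  generalize PowerSeries.map LaurentPolynomial.C (C (mixedHit f g 1 (M + 1) 0)) = c at *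
  generalize constSeries (mixedWalk f g 1 M 0) = N at *
  generalize constSeries (mixedWalk f g 1 (M + 1) 0) = N' at *
  generalize walkSeries f g 1 (M + 1) = W at *
  generalize constSeries f = F at *
  generalize constSeries g = G at *
  generalize (constT (-1) : R[T;T⁻¹]⟦X⟧) = m at *
  generalize (constT 1 : R[T;T⁻¹]⟦X⟧) = p at *
  generalize shiftedGeomSeries f t w = J at *
  generalize geomSeries g = I at *
  -- `e1` telescopes the bracket of `innerLaurent` between `M` and `M + 1`; `e2` is the kernel
  -- equation divided by `1 - z g/T`.
  have e1 : (N - m * (Z * P)) * J - Z * ((N' - m * (P - c)) * J) = N := by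
    linear_combination N * hJ + J * Z * m * hN + J * Z * N' * hT
  have e2 : p * (m * F) * N * I = p * W + P * I := by
    linear_combination F * N * I * hT + I * hN + p * W * hI + I * hW + X * G * W * I * hT
  linear_combination (m * F) ^ M * hJ + t' * p * (m * F) * I * e1 + t' * e2

end InnerSeries

end AnnularNC

namespace AnnularNC

/-! ### The closed forms satisfy the recursions -/

section Weights

variable {R : Type*} [CommRing R]

open PowerSeries
open scoped LaurentPolynomial

/-- The polynomial `(1 + t₀ u) ⋯ (1 + t_{n-1} u)`. -/
noncomputable def phi (t : ℕ → R) (n : ℕ) : Polynomial R :=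
  ∏ i ∈ Finset.range n, (1 + Polynomial.C (t i) * Polynomial.X)

theorem phi_succ (t : ℕ → R) (n : ℕ) :
    phi t (n + 1) = phi t n * (1 + Polynomial.C (t n) * Polynomial.X) :=
  Finset.prod_range_succ _ _

theorem phi_zero (t : ℕ → R) : phi t 0 = 1 := rfl

theorem iterate_divX_zero (k : ℕ) : Polynomial.divX^[k] (0 : Polynomial R) = 0 := by
  induction k with
  | zero => rfl
  | succ k ih => rw [Function.iterate_succ_apply', ih, Polynomial.divX_zero]

theorem hitWeight_zero_right (f : Polynomial R) (k : ℕ) : hitWeight f 0 k = 0 := by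
  have := hitWeight_C_mul f 0 (0 : R) k
  simpa using this

theorem iterate_divX_one (b : ℕ) : Polynomial.divX^[b + 1] (1 : Polynomial R) = 0 := by
  rw [Function.iterate_succ_apply, Polynomial.divX_one, iterate_divX_zero]

theorem walkStep_one (s : Polynomial R) : walkStep 1 s = Polynomial.divX s := by
  rw [walkStep, one_mul]

theorem hitWeight_one_one (k : ℕ) : hitWeight (1 : Polynomial R) 1 k = if k = 1 then 1 else 0 := by
  rcases k with _ | _ | k
  · rfl
  · simp [hitWeight]
  · rw [hitWeight, show walkStep (1 : Polynomial R) = Polynomial.divX from funext walkStep_one,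
      iterate_divX_one]
    simp

/-- The solution of `w = z φ(w)` for `φ = phi t (n + 1)`. -/
noncomputable def phiFixed (t : ℕ → R) (n : ℕ) : R⟦X⟧ :=
  Classical.choose (exists_fixedPoint (phi t (n + 1)))

theorem phiFixed_spec (t : ℕ → R) (n : ℕ) :
    phiFixed t n = X * Polynomial.aeval (phiFixed t n) (phi t (n + 1)) :=
  Classical.choose_spec (exists_fixedPoint (phi t (n + 1)))

/-- The weight of a cycle of length `k`. -/
noncomputable def discWeight (t : ℕ → R) (n k : ℕ) : R := hitWeight (phi t n) 1 k

/-- The weight of a cycle with `M` frozen and `K` active points. -/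
noncomputable def discWeightOn (t : ℕ → R) (n M K : ℕ) : R :=
  mixedHit (phi t n) (phi t (n + 1)) 1 M K

theorem coeff_hitSeries (f g s : Polynomial R) (M K : ℕ) :
    coeff K (hitSeries f g s M) = mixedHit f g s M K := by
  rw [hitSeries, coeff_mk]

theorem discWeights (t : ℕ → R) : CycleWeights t (discWeight t) (discWeightOn t) where
  zero k := hitWeight_one_one k
  base n M := rfl
  succ n K := (mixedHit_zero_left _ _ _ _).symm
  step n M K := by
    have hw := phiFixed_spec t n
    have h := congrArg (coeff (K + 1)) (hitSeries_step (s := 1) hw (phi_succ t n) M)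
    rw [map_add, coeff_C, if_neg (by omega), zero_add, mul_assoc, coeff_succ_X_mul, add_mul,
      one_mul, map_add, mul_assoc, coeff_C_mul,
      coeff_mul_of_constantCoeff_eq_zero (constantCoeff_fixedPoint hw)] at h
    simp only [coeff_hitSeries] at h
    rw [discWeightOn, h]
    congr 2
    refine Finset.sum_congr rfl fun i _ => ?_
    congr 1
    rw [discWeightOn, ← coeff_hitSeries, hitSeries_one_zero hw]

/-- The weight of two cycles of lengths `a` and `b`. -/
noncomputable def annulusWeight (t : ℕ → R) (n a b : ℕ) : R :=
  a * hitWeight (phi t n) (Polynomial.divX^[b + 1] (phi t n ^ b)) a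

/-- The weight of two cycles where the inner one, of length `b`, is frozen. -/
noncomputable def annulusWeightOuter (t : ℕ → R) (n b M K : ℕ) : R :=
  coeff K (outerSeries (phi t n) (phi t (n + 1)) (Polynomial.divX^[b + 1] (phi t n ^ b)) (t n)
    (phiFixed t n) M)

/-- The weight of two cycles where the outer one, of length `a`, is active. -/
noncomputable def annulusWeightInner (t : ℕ → R) (n a M K : ℕ) : R :=
  a * coeff K (innerSeries (phi t n) (phi t (n + 1)) (t n) (phiFixed t n) a M)

theorem coeff_outerSeries_zero {f g s : Polynomial R} {t : R} {w : R⟦X⟧}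
    (hw : w = X * Polynomial.aeval w g) (K : ℕ) :
    coeff K (outerSeries f g s t w 0) = K * hitWeight g s K := by
  rw [outerSeries_zero hw]
  cases K with
  | zero => simp
  | succ K =>
    rw [coeff_succ_X_mul, coeff_derivative, coeff_hitSeries, mixedHit_zero_left]
    push_cast
    ring

theorem coeff_zero_innerSeries (f g : Polynomial R) (t : R) (w : R⟦X⟧) (n M : ℕ) :
    coeff 0 (innerSeries f g t w n M) = hitWeight g (Polynomial.divX^[M + 1] (f ^ M)) n := by
  rw [innerSeries, coeff_seriesHit, ← laurentHit_T_neg_mul]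
  congr 1
  have h1 : (constT (-1) * constSeries f) ^ M =
      (PowerSeries.C (LaurentPolynomial.T (-(M : ℤ)) * Polynomial.toLaurent (f ^ M))) := by
    rw [constT, constSeries, RingHom.comp_apply, ← map_mul, ← map_pow, mul_pow, map_pow,
      LaurentPolynomial.T_pow]
    congr 3
    ring
  rw [innerLaurent, h1, map_add, coeff_C_mul, map_mul (PowerSeries.map _), PowerSeries.map_X]
  simp [shiftedGeomSeries]

theorem seriesHit_constSeries_pow (f g : Polynomial R) (n M K : ℕ) :
    coeff (K + 1) (seriesHit g n ((constT (-1) * constSeries f) ^ M)) = 0 := by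
  rw [coeff_seriesHit, constT, constSeries, RingHom.comp_apply, ← map_mul, ← map_pow, coeff_C,
    if_neg (by omega), map_zero]

/-- The functional appends `a + 1` steps of type `g` to the `K` steps already made: the outer points
join the active points of the inner cycle. -/
theorem coeff_seriesHit_walkSeries (f g s : Polynomial R) (a M K : ℕ) :
    coeff K (seriesHit g (a + 1) (constT 1 * walkSeries f g s M)) =
      mixedHit f g s M (a + 1 + K) := by
  rw [coeff_seriesHit, constT, coeff_C_mul, walkSeries, coeff_mk, laurentHit_T_mul, mixedWalk,
    hitWeight_iterate, show a + 1 + K = a + K + 1 by omega]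
  rfl

theorem coeff_innerSeries_zero {f g : Polynomial R} {t : R} {w : R⟦X⟧}
    (hw : w = X * Polynomial.aeval w g) (hg : g = f * (1 + Polynomial.C t * Polynomial.X))
    (a K : ℕ) : coeff K (innerSeries f g t w a 0) =
      hitWeight g (Polynomial.divX^[K + 1] (g ^ K)) a := by
  rw [innerSeries, innerLaurent_zero hw hg, coeff_seriesHit, geomSeries, coeff_mk,
    laurentHit_T_neg_mul]

theorem coeff_innerSeries_step {f g : Polynomial R} {t : R} {w : R⟦X⟧}
    (hw : w = X * Polynomial.aeval w g) (hg : g = f * (1 + Polynomial.C t * Polynomial.X))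
    (a M K : ℕ) : coeff (K + 1) (innerSeries f g t w (a + 1) M) =
      coeff K (innerSeries f g t w (a + 1) (M + 1)) +
      t * coeff K (w * innerSeries f g t w (a + 1) (M + 1)) +
      t * (mixedHit f g 1 (M + 1) (a + 1 + K) +
        coeff K (innerSeries f g t w (a + 1) 0 * hitSeries f g 1 (M + 1))) := by
  have h := congrArg (fun F => coeff (K + 1) (seriesHit g (a + 1) F)) (innerLaurent_step hw hg M)
  simp only [map_add, seriesHit_map_mul, seriesHit_constSeries_pow] at h
  rw [← innerLaurent_zero hw hg] at h
  have hd : ∀ M, seriesHit g (a + 1) (innerLaurent f g t w M) = innerSeries f g t w (a + 1) M :=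
    fun _ => rfl
  simp only [hd] at h
  rw [h, zero_add, shiftSeries, mul_assoc, coeff_succ_X_mul, mul_comm (C t) X, mul_assoc,
    coeff_succ_X_mul, coeff_C_mul, map_add, coeff_seriesHit_walkSeries, add_mul, one_mul, map_add,
    mul_assoc, coeff_C_mul, mul_comm (hitSeries f g 1 (M + 1))]

theorem coeff_innerSeries_zero_zero {f g : Polynomial R} {t : R} {w : R⟦X⟧}
    (hw : w = X * Polynomial.aeval w g) (hg : g = f * (1 + Polynomial.C t * Polynomial.X))
    (a : ℕ) : coeff 0 (innerSeries f g t w a 0) = 0 := by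
  rw [coeff_innerSeries_zero hw hg, pow_zero, iterate_divX_one, hitWeight_zero_right]

/-- Coefficients are compared in the functional equations for `outerSeries` and `innerSeries`. The
factor `a` comes from `z d/dz` in the first and is put in by hand in the second, where it also
counts the outer points available for the join. -/
theorem annulusWeights (t : ℕ → R) : AnnulusWeights t (discWeightOn t) (annulusWeight t)
    (annulusWeightOuter t) (annulusWeightInner t) where
  zero a b := by
    rw [annulusWeight, phi_zero, one_pow, iterate_divX_one, hitWeight_zero_right, mul_zero]
  base₁ n b M := constantCoeff_outerSeries M
  step₁ n b M K := by
    have hw := phiFixed_spec t n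
    have h0 := constantCoeff_fixedPoint hw
    have h1 := coeff_outerSeries_zero (f := phi t n) (t := t n)
      (s := Polynomial.divX^[b + 1] (phi t n ^ b)) hw 0
    rw [Nat.cast_zero, zero_mul] at h1
    rw [annulusWeightOuter, outerSeries_step hw (phi_succ t n), map_add, coeff_C,
      if_neg (by omega), zero_add, coeff_succ_X_mul, map_add, coeff_C_mul, map_add,
      coeff_mul_of_constantCoeff_eq_zero h0, coeff_mul_of_constantCoeff_eq_zero h1,
      ← Finset.sum_add_distrib]
    congr 2
    refine Finset.sum_congr rfl fun i _ => ?_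
    rw [coeff_hitSeries, ← hitSeries_one_zero (f := phi t n) hw, coeff_hitSeries,
      hitSeries_one_zero (f := phi t n) hw]
    rfl
  base₂ n a M := by
    rw [annulusWeightInner, annulusWeightOuter, coeff_zero_innerSeries,
      coeff_outerSeries_zero (phiFixed_spec t n)]
  step₂ n a M K := by
    have hw := phiFixed_spec t n
    have hg := phi_succ t n
    have h0 := constantCoeff_fixedPoint hw
    cases a with
    | zero => simp [annulusWeightInner]
    | succ a =>
      rw [annulusWeightInner, coeff_innerSeries_step hw hg,
        coeff_mul_of_constantCoeff_eq_zero h0,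
        coeff_mul_of_constantCoeff_eq_zero (coeff_innerSeries_zero_zero hw hg _)]
      simp only [annulusWeightInner, Finset.sum_add_distrib, mul_add, Finset.mul_sum]
      have e1 : ∀ i, coeff (i + 1) (phiFixed t n) = discWeightOn t n 0 (i + 1) := by
        intro i
        rw [discWeightOn, ← coeff_hitSeries, hitSeries_one_zero hw]
      have e3 : ∀ M K, mixedHit (phi t n) (phi t (n + 1)) 1 M K = discWeightOn t n M K :=
        fun _ _ => rfl
      simp only [e1, coeff_hitSeries, e3]
      have e2 : ∀ x y z : R, x * (y * z) = y * (x * z) := fun x y z => by ring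
      simp only [e2 (((a + 1 : ℕ) : R)), mul_assoc]
      ring
  succ n a b := by
    rw [annulusWeightInner, annulusWeight,
      coeff_innerSeries_zero (phiFixed_spec t n) (phi_succ t n)]

end Weights

end AnnularNC

namespace AnnularNC

/-! ### The cycle lemma -/

section CycleLemma

variable {R : Type*} [CommRing R] [IsDomain R] [CharZero R]

open Polynomial

/-- Walks from height `h` that first hit -1 at step `n + 1` make up the fraction `(h + 1) / (n + 1)`
of all walks between these heights; the derivative of `X * s` supplies `h + 1`. The induction moves
the first step into the starting distribution. -/
theorem succ_mul_hitWeight (g s : R[X]) (n : ℕ) :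
    ((n : R) + 1) * hitWeight g s (n + 1) = (derivative (X * s) * g ^ (n + 1)).coeff n := by
  induction n generalizing s with
  | zero => simp [hitWeight, mul_coeff_zero, mul_comm]
  | succ n ih =>
    have h1 := ih (walkStep g s)
    rw [hitWeight, ← Function.iterate_succ_apply, ← hitWeight] at h1
    have h2 : derivative (X * walkStep g s) = derivative (g * s) := by
      rw [walkStep]
      conv_rhs => rw [← X_mul_divX_add (g * s)]
      simp
    rw [h2] at h1
    -- The term containing `s` itself is eliminated by reading the coefficient of `u ^ (n + 1)` in
    -- `s * g ^ (n + 2)` off its derivative.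
    have h3 : ((n : R) + 1) * (derivative (X * s) * g ^ (n + 1 + 1)).coeff (n + 1) =
        ((n : R) + 2) * (derivative (g * s) * g ^ (n + 1)).coeff n := by
      have e1 : (derivative (X * s) * g ^ (n + 1 + 1)).coeff (n + 1) =
          (s * g ^ (n + 2)).coeff (n + 1) + (derivative s * g ^ (n + 2)).coeff n := by
        rw [derivative_mul, derivative_X, one_mul, add_mul, coeff_add, mul_assoc X, coeff_X_mul]
      have e2 := coeff_derivative (s * g ^ (n + 2)) n
      rw [e1, mul_add, mul_comm, ← e2, ← coeff_C_mul, ← coeff_C_mul, ← coeff_add]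
      congr 1
      simp only [derivative_mul, derivative_pow, map_add, map_natCast, map_one, map_ofNat]
      push_cast
      ring
    have hn : ((n : R) + 1) ≠ 0 := by exact_mod_cast Nat.succ_ne_zero n
    apply mul_left_cancel₀ hn
    rw [h3, ← h1]
    push_cast
    ring

theorem coeff_iterate_divX (f : R[X]) (b i : ℕ) : (divX^[b] f).coeff i = f.coeff (b + i) := by
  induction b generalizing i with
  | zero => simp
  | succ b ih =>
    rw [Function.iterate_succ_apply', coeff_divX, ih]
    congr 1
    omega

/-- The index `i` is the starting height and plays the role of `c - 1`; the cycle lemma supplies the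
factor `i + 1`. -/
theorem annulusWeight_eq (t : ℕ → R) (n a b : ℕ) : annulusWeight t n a b =
    ∑ i ∈ Finset.range a, ((i : R) + 1) * (phi t n ^ b).coeff (b + 1 + i) *
      (phi t n ^ a).coeff (a - 1 - i) := by
  cases a with
  | zero => simp [annulusWeight]
  | succ a =>
    rw [annulusWeight]
    push_cast
    rw [succ_mul_hitWeight, coeff_mul, Finset.Nat.sum_antidiagonal_eq_sum_range_succ
      (fun i j => (derivative (X * divX^[b + 1] (phi t n ^ b))).coeff i *
        (phi t n ^ (a + 1)).coeff j)]
    refine Finset.sum_congr rfl fun i _ => ?_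
    rw [coeff_derivative, coeff_X_mul, coeff_iterate_divX]
    ring

end CycleLemma

/-! ### The two cycles of α and the count for α -/

section Alpha

open Equiv Equiv.Perm

theorem formPerm_map_finRange {X : Type*} [DecidableEq X] {n : ℕ} (f : Fin n → X)
    (hf : Function.Injective f) (i : Fin n) :
    ((List.finRange n).map f).formPerm (f i) = f (finRotate n i) := by
  have hn : ((List.finRange n).map f).Nodup := (List.nodup_finRange n).map hf
  have h := List.formPerm_apply_getElem _ hn i (by simp)
  simp only [List.getElem_map, List.getElem_finRange, Fin.cast_mk, Fin.eta, List.length_map,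
    List.length_finRange] at h
  rw [h]
  congr 1
  cases n with
  | zero => exact i.elim0
  | succ n =>
    rw [finRotate_apply]
    apply Fin.ext
    simp [Fin.val_add]

/-- The cycles of `alpha p q` on the outer points. -/
def outerState (p q : ℕ) : State (Pt p q) := [([], (List.finRange p).map Sum.inl)]

/-- The cycles of `alpha p q` on the inner points. -/
def innerState (p q : ℕ) : State (Pt p q) := [([], (List.finRange q).map Sum.inr)]

theorem perm_outerState_append (p q : ℕ) :
    State.perm (outerState p q ++ innerState p q) = alpha p q := by
  simp only [outerState, innerState, State.perm, List.map_cons, List.map_nil,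
    List.cons_append, List.nil_append, List.prod_cons, List.prod_nil, mul_one, alpha]
  ext x
  rw [Perm.mul_apply]
  rcases x with i | j
  · rw [List.formPerm_apply_of_notMem (l := (List.finRange q).map Sum.inr) (by simp),
      formPerm_map_finRange _ Sum.inl_injective]
    rfl
  · rw [formPerm_map_finRange _ Sum.inr_injective, List.formPerm_apply_of_notMem (by simp)]
    rfl

theorem good_alphaState {p q : ℕ} (hp : 0 < p) (hq : 0 < q) :
    (outerState p q ++ innerState p q : State (Pt p q)).Good where
  nodup := by
    simp only [State.pts, outerState, innerState, List.cons_append, List.nil_append,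
      List.flatMap_cons, List.flatMap_nil, List.append_nil]
    rw [List.nodup_append]
    refine ⟨(List.nodup_finRange p).map Sum.inl_injective,
      (List.nodup_finRange q).map Sum.inr_injective, ?_⟩
    intro a ha b hb
    simp only [List.mem_map, List.mem_finRange, true_and] at ha hb
    obtain ⟨i, rfl⟩ := ha
    obtain ⟨j, rfl⟩ := hb
    simp
  full x := by
    rcases x with i | j <;> simp [State.pts, outerState, innerState]
  ne_nil x hx := by
    simp only [outerState, innerState, List.cons_append, List.nil_append, List.mem_cons,
      List.not_mem_nil, or_false] at hx
    rcases hx with rfl | rfl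
    · simpa using hp.ne'
    · simpa using hq.ne'

theorem finRotate_pow_zero (n k : ℕ) : ((finRotate (n + 1)) ^ k) 0 = Fin.ofNat (n + 1) k := by
  induction k with
  | zero => simp
  | succ k ih =>
    rw [pow_succ', Perm.mul_apply, ih, finRotate_apply]
    apply Fin.ext
    simp [Fin.val_add]

theorem sameCycle_finRotate {n : ℕ} (i j : Fin n) : (finRotate n).SameCycle i j := by
  cases n with
  | zero => exact i.elim0
  | succ n =>
    have h : ∀ i : Fin (n + 1), (finRotate (n + 1)).SameCycle 0 i := fun i =>
      ⟨(i : ℕ), by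
        rw [zpow_natCast, finRotate_pow_zero]
        exact Fin.ext (Nat.mod_eq_of_lt i.isLt)⟩
    exact (h i).symm.trans (h j)

theorem sumCongr_zpow {X Y : Type*} (σ : Perm X) (τ : Perm Y) (k : ℤ) :
    (Equiv.sumCongr σ τ : Perm (X ⊕ Y)) ^ k = Equiv.sumCongr (σ ^ k) (τ ^ k) :=
  (map_zpow (Perm.sumCongrHom X Y) (σ, τ) k).symm

theorem orbitCount_alpha {p q : ℕ} (hp : 0 < p) (hq : 0 < q) : orbitCount (alpha p q) = 2 := by
  have hl : ∀ i j : Fin p, (alpha p q).SameCycle (Sum.inl i) (Sum.inl j) := fun i j => by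
    obtain ⟨k, hk⟩ := sameCycle_finRotate i j
    exact ⟨k, by rw [alpha, sumCongr_zpow]; simp [hk]⟩
  have hr : ∀ i j : Fin q, (alpha p q).SameCycle (Sum.inr i) (Sum.inr j) := fun i j => by
    obtain ⟨k, hk⟩ := sameCycle_finRotate i j
    exact ⟨k, by rw [alpha, sumCongr_zpow]; simp [hk]⟩
  have hc : ∀ x, Sum.isLeft (alpha p q x) = Sum.isLeft x := by
    rintro (i | j) <;> rfl
  let f : Quotient (SameCycle.setoid (alpha p q)) → Bool :=
    Quotient.lift Sum.isLeft fun x y h => (color_eq_of_sameCycle hc h)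
  have hf : Function.Bijective f := by
    constructor
    · intro x y
      induction x using Quotient.inductionOn
      induction y using Quotient.inductionOn
      rename_i x y
      intro h
      apply Quotient.sound
      rcases x with x | x <;> rcases y with y | y
      · exact hl x y
      · exact absurd h (by simp [f])
      · exact absurd h (by simp [f])
      · exact hr x y
    · intro b
      cases b
      · exact ⟨Quotient.mk _ (Sum.inr ⟨0, hq⟩), rfl⟩
      · exact ⟨Quotient.mk _ (Sum.inl ⟨0, hp⟩), rfl⟩
  rw [orbitCount, Nat.card_congr (Equiv.ofBijective f hf)]
  simp

theorem absLength_alpha {p q : ℕ} (hp : 0 < p) (hq : 0 < q) :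
    absLength (alpha p q) + 2 = p + q := by
  have h := absLength_add_orbitCount (alpha p q)
  rw [orbitCount_alpha hp hq] at h
  rw [h]
  simp

theorem coeff_conSum_alpha {R : Type*} [CommRing R] [IsDomain R] [CharZero R] {p q : ℕ}
    (hp : 0 < p) (hq : 0 < q) (t : ℕ → R) (n : ℕ) :
    (conSum (Sum.isLeft : Pt p q → Bool) t n (alpha p q)).coeff (p + q) =
      ∑ i ∈ Finset.range p, ((i : R) + 1) * (phi t n ^ q).coeff (q + 1 + i) *
        (phi t n ^ p).coeff (p - 1 - i) := by
  have h := coeff_conSum_state (t := t) (c := (Sum.isLeft : Pt p q → Bool)) (co := true)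
    (ci := false) (discWeights t) (annulusWeights t) (by simp) n (outerState p q) (innerState p q)
    (good_alphaState hp hq)
    (by
      intro y hy
      simp only [State.pts, outerState, List.flatMap_cons, List.flatMap_nil, List.append_nil,
        List.nil_append, List.mem_map] at hy
      obtain ⟨i, -, rfl⟩ := hy
      rfl)
    (by
      intro y hy
      simp only [State.pts, innerState, List.flatMap_cons, List.flatMap_nil, List.append_nil,
        List.nil_append, List.mem_map] at hy
      obtain ⟨i, -, rfl⟩ := hy
      rfl)
  rw [perm_outerState_append, absLength_alpha hp hq] at h
  rw [h, ← annulusWeight_eq]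
  simp [pairSum, outerState, innerState, wsum, wprod]

end Alpha

end AnnularNC

namespace AnnularNC

/-! ### Expansion over sequences of subsets and of permutations -/

section Expansion

variable {R : Type*} [CommRing R]

open Equiv Equiv.Perm

theorem coeff_prod_weight {n : ℕ} (t : ℕ → R) (e : Fin n → ℕ) (k : ℕ) :
    (∏ i : Fin n, (Polynomial.C (t i) * Polynomial.X) ^ e i).coeff k =
      if ∑ i, e i = k then ∏ i : Fin n, t i ^ e i else 0 := by
  simp only [mul_pow, Finset.prod_mul_distrib, Finset.prod_pow_eq_pow_sum]
  simp only [← map_pow, ← map_prod]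
  rw [Polynomial.coeff_C_mul, Polynomial.coeff_X_pow]
  simp [eq_comm]

theorem coeff_phi_pow (t : ℕ → R) (n a k : ℕ) : (phi t n ^ a).coeff k =
    ∑ S : {S : Fin n → Finset (Fin a) // ∑ i, (S i).card = k},
      ∏ i : Fin n, t i ^ (S.1 i).card := by
  have h1 : phi t n ^ a =
      ∑ S : Fin n → Finset (Fin a), ∏ i : Fin n, (Polynomial.C (t i) * Polynomial.X) ^ (S i).card := by
    rw [phi, ← Finset.prod_pow, Finset.prod_range, ← Fintype.piFinset_univ,
      ← Finset.prod_univ_sum (fun _ : Fin n => Finset.univ) fun i (S : Finset (Fin a)) =>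
        (Polynomial.C (t i) * Polynomial.X) ^ S.card]
    refine Finset.prod_congr rfl fun i _ => ?_
    have := Fintype.sum_pow_mul_eq_add_pow (Fin a) (Polynomial.C (t i) * Polynomial.X) 1
    simp only [one_pow, mul_one, Fintype.card_fin] at this
    rw [this, add_comm]
  rw [h1, Polynomial.finsetSum_coeff]
  simp only [coeff_prod_weight]
  rw [← Finset.sum_filter]
  exact Finset.sum_subtype _ (by simp) _

variable {X : Type*} [DecidableEq X] [Fintype X]

/-- The product of the first `k` entries of a sequence of permutations. -/
def prodTo (β : ℕ → Perm X) : ℕ → Perm X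
  | 0 => 1
  | k + 1 => prodTo β k * β k

theorem prodTo_congr {β γ : ℕ → Perm X} {k : ℕ} (h : ∀ j < k, β j = γ j) :
    prodTo β k = prodTo γ k := by
  induction k with
  | zero => rfl
  | succ k ih => rw [prodTo, prodTo, ih fun j hj => h j (by omega), h k (by omega)]

/-- A finite sequence of permutations, continued by the identity. -/
def extendOne {n : ℕ} (β : Fin n → Perm X) (k : ℕ) : Perm X := if h : k < n then β ⟨k, h⟩ else 1

theorem extendOne_val {n : ℕ} (β : Fin n → Perm X) (i : Fin n) : extendOne β i = β i := by
  rw [extendOne, dif_pos i.isLt]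

theorem prodTo_extendOne_snoc {n : ℕ} (β : Fin n → Perm X) (b : Perm X) :
    prodTo (extendOne (Fin.snoc β b : Fin (n + 1) → Perm X)) (n + 1) =
      prodTo (extendOne β) n * b := by
  rw [prodTo]
  congr 1
  · apply prodTo_congr
    intro j hj
    rw [extendOne, dif_pos (by omega), extendOne, dif_pos hj]
    exact Fin.snoc_castSucc (α := fun _ => Perm X) b β ⟨j, hj⟩
  · rw [extendOne, dif_pos (by omega)]
    exact Fin.snoc_last (α := fun _ => Perm X) b β

theorem facSum_eq_sum {ι : Type*} [DecidableEq ι] (c : X → ι) (t : ℕ → R) (n : ℕ) (σ : Perm X) :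
    facSum c t n σ = ∑ β : Fin n → Perm X,
      if prodTo (extendOne β) n = σ ∧ ∀ i x, c (β i x) = c x then
        ∏ i : Fin n, (Polynomial.C (t i) * Polynomial.X) ^ absLength (β i) else 0 := by
  induction n generalizing σ with
  | zero =>
    rw [facSum, Fintype.sum_unique]
    simp [prodTo, eq_comm]
  | succ n ih =>
    rw [facSum, ← (Fin.snocEquiv fun _ => Perm X).sum_comp, Fintype.sum_prod_type,
      Finset.sum_filter]
    refine Finset.sum_congr rfl fun b _ => ?_
    have hs : ∀ β : Fin n → Perm X, Fin.snocEquiv (fun _ => Perm X) (b, β) = Fin.snoc β b :=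
      fun _ => rfl
    simp only [hs, prodTo_extendOne_snoc, Fin.prod_univ_castSucc, Fin.forall_fin_succ',
      Fin.snoc_castSucc, Fin.snoc_last, Fin.val_castSucc, Fin.val_last]
    rw [ih, Finset.mul_sum]
    by_cases hb : ∀ x, c (b x) = c x
    · rw [if_pos hb]
      refine Finset.sum_congr rfl fun β _ => ?_
      simp only [hb, implies_true, and_true, eq_mul_inv_iff_mul_eq, mul_ite, mul_zero]
      split_ifs with h
      · exact mul_comm _ _
      · rfl
    · rw [if_neg hb]
      simp [hb]

theorem coeff_conSum_eq_sum {ι : Type*} [DecidableEq ι] (c : X → ι) (t : ℕ → R) (n N : ℕ)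
    (σ : Perm X) : (conSum c t n σ).coeff N =
      ∑ β : {β : Fin n → Perm X // prodTo (extendOne β) n = σ ∧ ∑ i, absLength (β i) = N ∧
        ¬ ∀ i x, c (β i x) = c x}, ∏ i : Fin n, t i ^ absLength (β.1 i) := by
  rw [conSum, allSum, facSum_eq_sum, facSum_eq_sum, Polynomial.coeff_sub,
    Polynomial.finsetSum_coeff, Polynomial.finsetSum_coeff, ← Finset.sum_sub_distrib,
    ← Finset.sum_subtype (Finset.univ.filter fun β : Fin n → Perm X =>
      prodTo (extendOne β) n = σ ∧ ∑ i, absLength (β i) = N ∧ ¬ ∀ i x, c (β i x) = c x) (by simp)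
      (fun β => ∏ i : Fin n, t i ^ absLength (β i)), Finset.sum_filter]
  refine Finset.sum_congr rfl fun β _ => ?_
  by_cases h1 : prodTo (extendOne β) n = σ <;> by_cases h2 : ∀ i x, c (β i x) = c x <;>
    by_cases h3 : ∑ i, absLength (β i) = N <;>
    simp [h1, h2, h3, coeff_prod_weight]

end Expansion

/-! ### From equal generating polynomials to bijections -/

section Counting

/-- The coefficient of a monomial is the size of the fibre over its exponent vector, so
corresponding fibres are equinumerous. -/
theorem exists_equiv_of_sum_eq {A B : Type*} [Fintype A] [Fintype B] {n : ℕ} (eA : A → Fin n → ℕ)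
    (eB : B → Fin n → ℕ)
    (h : ∑ a, ∏ i, (MvPolynomial.X i : MvPolynomial (Fin n) ℤ) ^ eA a i =
      ∑ b, ∏ i, (MvPolynomial.X i : MvPolynomial (Fin n) ℤ) ^ eB b i) :
    ∃ Φ : A ≃ B, ∀ a, eB (Φ a) = eA a := by
  classical
  have hm : ∀ e : Fin n → ℕ, ∏ i, (MvPolynomial.X i : MvPolynomial (Fin n) ℤ) ^ e i =
      MvPolynomial.monomial (Finsupp.equivFunOnFinite.symm e) 1 := by
    intro e
    rw [MvPolynomial.monomial_eq, Finsupp.prod_fintype _ _ (by simp)]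
    simp
  have hc : ∀ e : Fin n → ℕ, Fintype.card {a // eA a = e} = Fintype.card {b // eB b = e} := by
    intro e
    have h1 := congrArg (MvPolynomial.coeff (Finsupp.equivFunOnFinite.symm e)) h
    simp only [hm, MvPolynomial.coeff_sum, MvPolynomial.coeff_monomial,
      EmbeddingLike.apply_eq_iff_eq, Finset.sum_boole] at h1
    rw [Fintype.card_subtype, Fintype.card_subtype]
    exact_mod_cast h1
  refine ⟨(Equiv.sigmaFiberEquiv eA).symm.trans ((Equiv.sigmaCongrRight fun e =>
    Fintype.equivOfCardEq (hc e)).trans (Equiv.sigmaFiberEquiv eB)), fun a => ?_⟩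
  simp only [Equiv.trans_apply]
  exact (Fintype.equivOfCardEq (hc (eA a)) ⟨a, rfl⟩).2

/-- Tuples `(c, d; L^E, R_1^E, …; L^I, R_1^I, …)`, with `c - 1` and `d - 1` in the place of `c` and
`d`, and the complements of `L^E` and `L^I` as additional entries of the sequences of sets. -/
abbrev ParenData (p q m : ℕ) : Type :=
  Σ c : Fin p, Fin (c + 1) × {S : Fin (m + 1) → Finset (Fin p) // ∑ i, (S i).card = p - 1 - c} ×
    {S : Fin (m + 1) → Finset (Fin q) // ∑ i, (S i).card = q + 1 + c}

theorem sum_parenData {R : Type*} [CommRing R] (t : ℕ → R) (p q m : ℕ) :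
    ∑ τ : ParenData p q m, ∏ i : Fin (m + 1), t i ^ ((τ.2.2.1.1 i).card + (τ.2.2.2.1 i).card) =
      ∑ i ∈ Finset.range p, ((i : R) + 1) * (phi t (m + 1) ^ q).coeff (q + 1 + i) *
        (phi t (m + 1) ^ p).coeff (p - 1 - i) := by
  rw [Fintype.sum_sigma, Finset.sum_range]
  refine Finset.sum_congr rfl fun c _ => ?_
  rw [Fintype.sum_prod_type]
  simp only [Fintype.sum_prod_type, pow_add, Finset.prod_mul_distrib]
  rw [Finset.sum_const, Finset.card_univ, Fintype.card_fin, ← Fintype.sum_mul_sum, coeff_phi_pow,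
    coeff_phi_pow, nsmul_eq_mul]
  push_cast
  ring

end Counting

/-! ### Tuples as sequences of subsets -/

section ParenEquiv

variable {p q m : ℕ}

theorem ParenTuple.c_le (τ : ParenTuple p q m) : τ.c ≤ p := by
  have h1 := τ.card_LE
  have h2 := Finset.card_le_univ τ.LE
  rw [Fintype.card_fin] at h2
  have h3 : (0 : ℤ) ≤ ∑ i, ((τ.RE i).card : ℤ) := Finset.sum_nonneg fun _ _ => by positivity
  omega

/-- The parenthesis tuples as `ParenData`. -/
def parenEquiv (p q m : ℕ) : ParenTuple p q m ≃ ParenData p q m where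
  toFun τ := ⟨⟨τ.c - 1, by have := τ.c_le; have := τ.one_le_c; omega⟩,
    ⟨τ.d - 1, by have := τ.d_le_c; have := τ.one_le_d; simp only; omega⟩,
    ⟨Fin.cons τ.LEᶜ τ.RE, by
      have h1 := τ.card_LE
      have h2 := Finset.card_le_univ τ.LE
      have h3 := τ.one_le_c
      rw [Fin.sum_univ_succ]
      simp only [Fin.cons_zero, Fin.cons_succ, Finset.card_compl]
      rw [Fintype.card_fin] at h2 ⊢
      rw [← Nat.cast_sum] at h1
      omega⟩,
    ⟨Fin.cons τ.LIᶜ τ.RI, by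
      have h1 := τ.card_LI
      have h2 := Finset.card_le_univ τ.LI
      have h3 := τ.one_le_c
      rw [Fin.sum_univ_succ]
      simp only [Fin.cons_zero, Fin.cons_succ, Finset.card_compl]
      rw [Fintype.card_fin] at h2 ⊢
      rw [← Nat.cast_sum] at h1
      omega⟩⟩
  invFun x :=
    { c := x.1 + 1
      d := x.2.1 + 1
      LE := (x.2.2.1.1 0)ᶜ
      RE := Fin.tail x.2.2.1.1
      LI := (x.2.2.2.1 0)ᶜ
      RI := Fin.tail x.2.2.2.1
      one_le_c := Nat.le_add_left _ _
      one_le_d := Nat.le_add_left _ _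
      d_le_c := x.2.1.isLt
      card_LE := by
        have h1 := x.2.2.1.2
        have h2 := Finset.card_le_univ (x.2.2.1.1 0)
        have h3 := x.1.isLt
        rw [Fin.sum_univ_succ] at h1
        rw [Finset.card_compl, ← Nat.cast_sum]
        simp only [Fin.tail]
        rw [Fintype.card_fin] at h2 ⊢
        rw [Nat.cast_sub h2]
        omega
      card_LI := by
        have h1 := x.2.2.2.2
        have h2 := Finset.card_le_univ (x.2.2.2.1 0)
        rw [Fin.sum_univ_succ] at h1
        rw [Finset.card_compl, ← Nat.cast_sum]
        simp only [Fin.tail]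
        rw [Fintype.card_fin] at h2 ⊢
        rw [Nat.cast_sub h2]
        omega }
  left_inv τ := by
    obtain ⟨c, d, LE, RE, LI, RI, h1, h2, h3, h4, h5⟩ := τ
    simp only [Fin.cons_zero, compl_compl, Fin.tail_cons, Nat.sub_add_cancel h1,
      Nat.sub_add_cancel h2]
  right_inv x := by
    obtain ⟨⟨c, hc⟩, ⟨d, hd⟩, ⟨SE, hE⟩, ⟨SI, hI⟩⟩ := x
    simp only [compl_compl, Fin.cons_self_tail]
    rfl

end ParenEquiv

end AnnularNC

namespace AnnularNC

/-! ### Partial products of factorizations of excess 2 -/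

section Chains

variable {X : Type*} [DecidableEq X] [Fintype X] {ι : Type*}

open Equiv Equiv.Perm

/-- The permutation preserves the colouring `c`. -/
def Preserves (c : X → ι) (σ : Perm X) : Prop := ∀ x, c (σ x) = c x

theorem Preserves.one (c : X → ι) : Preserves c 1 := fun _ => rfl

theorem Preserves.mul {c : X → ι} {σ τ : Perm X} (hσ : Preserves c σ) (hτ : Preserves c τ) :
    Preserves c (σ * τ) := fun x => (hσ (τ x)).trans (hτ x)

theorem Preserves.inv {c : X → ι} {σ : Perm X} (hσ : Preserves c σ) : Preserves c σ⁻¹ := fun x => by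
  rw [← hσ (σ⁻¹ x), apply_inv_apply]

theorem Preserves.of_absLE {c : X → ι} {σ τ : Perm X} (hτ : Preserves c τ) (h : AbsLE σ τ) :
    Preserves c σ := by
  have := (color_preserved_of_geodesic (c := c) (σ := τ) (β := σ⁻¹ * τ) hτ (by
    rw [mul_inv_rev, inv_inv, mul_inv_cancel_left]; exact h.ge)).2
  rwa [mul_inv_rev, inv_inv, mul_inv_cancel_left] at this

/-- The total length of the first `k` entries of a sequence of permutations. -/
noncomputable def lenTo (β : ℕ → Perm X) (k : ℕ) : ℕ := ∑ j ∈ Finset.range k, absLength (β j)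

variable {β : ℕ → Perm X} {c : X → ι}

theorem lenTo_succ (β : ℕ → Perm X) (k : ℕ) : lenTo β (k + 1) = lenTo β k + absLength (β k) :=
  Finset.sum_range_succ _ _

theorem prodTo_shift (β : ℕ → Perm X) (k d : ℕ) :
    prodTo (fun j => β (k + j)) d = (prodTo β k)⁻¹ * prodTo β (k + d) := by
  induction d with
  | zero => simp [prodTo]
  | succ d ih => rw [prodTo, ih, ← add_assoc, prodTo, mul_assoc]

theorem lenTo_shift (β : ℕ → Perm X) (k d : ℕ) :
    lenTo β k + lenTo (fun j => β (k + j)) d = lenTo β (k + d) :=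
  (Finset.sum_range_add _ _ _).symm

theorem absLength_prodTo_le (β : ℕ → Perm X) (k : ℕ) : absLength (prodTo β k) ≤ lenTo β k := by
  induction k with
  | zero => rw [prodTo, absLength_one, lenTo, Finset.sum_range_zero]
  | succ k ih =>
    rw [prodTo, lenTo_succ]
    exact (absLength_mul_le _ _).trans (Nat.add_le_add_right ih _)

theorem even_absLength_prodTo (β : ℕ → Perm X) (k : ℕ) :
    Even (absLength (prodTo β k) + lenTo β k) := by
  induction k with
  | zero => rw [prodTo, absLength_one, lenTo, Finset.sum_range_zero]; exact Even.zero
  | succ k ih =>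
    have := even_absLength_mul (prodTo β k) (β k)
    rw [prodTo, lenTo_succ]
    rw [Nat.even_iff] at *
    omega

theorem Preserves.prodTo {k : ℕ} (h : ∀ j < k, Preserves c (β j)) :
    Preserves c (AnnularNC.prodTo β k) := by
  induction k with
  | zero => exact Preserves.one c
  | succ k ih => exact (ih fun j hj => h j (by omega)).mul (h k (by omega))

theorem preserves_of_prodTo {k : ℕ} (h : Preserves c (prodTo β k))
    (hl : lenTo β k ≤ absLength (prodTo β k)) : ∀ j < k, Preserves c (β j) := by
  induction k with
  | zero => intro j hj; omega
  | succ k ih =>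
    have h1 := absLength_prodTo_le β k
    have h2 := absLength_mul_le (prodTo β k) (β k)
    rw [prodTo] at h hl
    rw [lenTo_succ] at hl
    obtain ⟨h3, h4⟩ := color_preserved_of_geodesic (c := c) h (β := β k) (by
      rw [mul_inv_cancel_right]; omega)
    rw [mul_inv_cancel_right] at h4
    intro j hj
    rcases Nat.lt_succ_iff_lt_or_eq.mp hj with hj | rfl
    · exact ih h4 (by omega) j hj
    · exact h3

theorem preserves_of_shift {k n : ℕ} (hk : k ≤ n)
    (h : Preserves c ((prodTo β k)⁻¹ * prodTo β n))
    (hl : lenTo β n ≤ lenTo β k + absLength ((prodTo β k)⁻¹ * prodTo β n)) :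
    ∀ j, k ≤ j → j < n → Preserves c (β j) := by
  obtain ⟨d, rfl⟩ := Nat.exists_eq_add_of_le hk
  rw [← prodTo_shift] at h hl
  rw [← lenTo_shift] at hl
  intro j hj hjn
  obtain ⟨i, rfl⟩ := Nat.exists_eq_add_of_le hj
  exact preserves_of_prodTo h (by omega) i (by omega)

/-- The excess 2 of the whole product is the sum of three even excesses: of the first `k` factors,
of the remaining ones, and of the product of the two partial products. Exactly one equals 2. If it
is the last, both partial products are geodesic, and a colour-preserving `prodTo β k` would make
every factor preserve colours. -/
theorem chain_cases {n : ℕ} {σ : Perm X} (hσ : prodTo β n = σ) (hn : absLength σ + 2 = lenTo β n)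
    (hp : Preserves c σ) (hnot : ¬ ∀ j < n, Preserves c (β j)) {k : ℕ} (hk : k ≤ n) :
    (lenTo β k = absLength (prodTo β k) + 2 ∧ AbsLE (prodTo β k) σ ∧
      Preserves c (prodTo β k) ∧ lenTo β n ≤ lenTo β k + absLength ((prodTo β k)⁻¹ * σ)) ∨
    (lenTo β k = absLength (prodTo β k) ∧
      absLength σ + 2 = absLength (prodTo β k) + absLength ((prodTo β k)⁻¹ * σ) ∧
      ¬ Preserves c (prodTo β k)) ∨
    (lenTo β k = absLength (prodTo β k) ∧ AbsLE (prodTo β k) σ ∧ Preserves c (prodTo β k)) := by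
  subst hσ
  have a1 := absLength_prodTo_le β k
  have a2 := even_absLength_prodTo β k
  obtain ⟨d, rfl⟩ := Nat.exists_eq_add_of_le hk
  have b1 := absLength_prodTo_le (fun j => β (k + j)) d
  have b2 := even_absLength_prodTo (fun j => β (k + j)) d
  have hs := lenTo_shift β k d
  rw [prodTo_shift] at b1 b2
  have hmul : prodTo β k * ((prodTo β k)⁻¹ * prodTo β (k + d)) = prodTo β (k + d) :=
    mul_inv_cancel_left _ _
  have c1 := absLength_mul_le (prodTo β k) ((prodTo β k)⁻¹ * prodTo β (k + d))
  have c2 := even_absLength_mul (prodTo β k) ((prodTo β k)⁻¹ * prodTo β (k + d))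
  rw [hmul] at c1 c2
  rw [Nat.even_iff] at a2 b2 c2
  by_cases e1 : absLength (prodTo β (k + d)) = absLength (prodTo β k) +
      absLength ((prodTo β k)⁻¹ * prodTo β (k + d))
  · have hpk : Preserves c (prodTo β k) := hp.of_absLE e1
    rcases (by omega : lenTo β k = absLength (prodTo β k) + 2 ∨
      lenTo β k = absLength (prodTo β k)) with h | h
    · exact Or.inl ⟨h, e1, hpk, by omega⟩
    · exact Or.inr (Or.inr ⟨h, e1, hpk⟩)
  · refine Or.inr (Or.inl ⟨by omega, by omega, fun hpk => hnot fun j hj => ?_⟩)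
    by_cases hjk : j < k
    · exact preserves_of_prodTo hpk (by omega) j hjk
    · exact preserves_of_shift hk (hpk.inv.mul hp) (by omega) j (by omega) hj

end Chains

/-! ### Connectedness, marks and ranks -/

section Multichains

variable {p q m : ℕ}

open Equiv Equiv.Perm

/-- The permutation preserves the sides of the annulus. -/
abbrev PreservesSides (π : Perm (Pt p q)) : Prop :=
  Preserves (Sum.isLeft : Pt p q → Bool) π

theorem isConn_iff (π : Perm (Pt p q)) : IsConn π ↔ ¬ PreservesSides π := by
  constructor
  · rintro ⟨i, j, h⟩ hp
    have := color_eq_of_sameCycle hp h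
    simp at this
  · intro h
    simp only [PreservesSides, Preserves, not_forall] at h
    obtain ⟨x, hx⟩ := h
    have hc : π.SameCycle x (π x) := ⟨1, by simp⟩
    generalize π x = y at hx hc
    rcases x with i | i <;> rcases y with j | j
    · exact absurd rfl hx
    · exact ⟨i, j, hc⟩
    · exact ⟨j, i, hc.symm⟩
    · exact absurd rfl hx

theorem preservesSides_alpha (p q : ℕ) : PreservesSides (alpha p q) := by
  rintro (i | j) <;> rfl

theorem MarkedPerm.ext_of {x y : MarkedPerm p q} (h1 : x.perm = y.perm) (h2 : x.mark = y.mark) :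
    x = y := by
  cases x; cases y; cases h1; cases h2; rfl

theorem ConnMultichain.ext_of {x y : ConnMultichain p q m} (h : ∀ i, x.elt i = y.elt i) : x = y := by
  obtain ⟨e, _, _⟩ := x
  obtain ⟨e', _, _⟩ := y
  cases (funext h : e = e')
  rfl

theorem MarkedPerm.mark_cases (x : MarkedPerm p q) : x.mark = 0 ∨ x.mark = 1 := by
  generalize x.mark = z
  fin_cases z <;> simp

theorem MarkedPerm.Rel.rank_eq {x y : MarkedPerm p q} (h : x.Rel y) :
    y.rank = x.rank + absLength (x.perm⁻¹ * y.perm) := by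
  rcases h with ⟨h1, h2⟩ | ⟨h1, h2, -, -, h3⟩
  · rw [AbsLE] at h2
    rw [MarkedPerm.rank, MarkedPerm.rank, h1]
    omega
  · rw [MarkedPerm.rank, MarkedPerm.rank, h1, h2]
    simp only [Fin.val_zero, Fin.val_one]
    omega

theorem MarkedPerm.Rel.mark_eq_one {x y : MarkedPerm p q} (h : x.Rel y) (hx : x.mark = 1) :
    y.mark = 1 := by
  rcases h with ⟨h1, -⟩ | ⟨-, h2, -⟩
  · rw [← h1, hx]
  · exact h2

theorem MarkedPerm.Rel.disconnected_left {x y : MarkedPerm p q} (h : x.Rel y) (hy : y.mark = 0)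
    (hp : PreservesSides y.perm) : x.mark = 0 ∧ PreservesSides x.perm := by
  rcases h with ⟨h1, h2⟩ | ⟨-, h2, -⟩
  · exact ⟨h1.trans hy, hp.of_absLE h2⟩
  · rw [hy] at h2
    exact absurd h2 (by decide)

/-- Such an element has nothing left to jump over before α: the excess 2 lies in its mark or in the
two lengths. -/
theorem MarkedPerm.rank_add_of_mark {x : MarkedPerm p q} (h : IsConn x.perm ∨ x.mark = 1) :
    x.rank + absLength (x.perm⁻¹ * alpha p q) = absLength (alpha p q) + 2 := by
  rw [MarkedPerm.rank]
  rcases x.mark_cases with h0 | h1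
  · have hc : IsConn x.perm := h.resolve_right (by rw [h0]; decide)
    have := x.length_of_connected hc
    rw [h0, Fin.val_zero]
    omega
  · have := x.le_of_disconnected (x.disconnected_of_mark h1)
    rw [AbsLE] at this
    rw [h1, Fin.val_one]
    omega

/-- Factorizations of `alpha p q` of total length `p + q` which do not preserve the sides. -/
abbrev ConnFactorization (p q m : ℕ) : Type :=
  {β : Fin (m + 1) → Perm (Pt p q) // prodTo (extendOne β) (m + 1) = alpha p q ∧
    ∑ i, absLength (β i) = p + q ∧ ¬ ∀ i x, Sum.isLeft (β i x) = Sum.isLeft x}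

theorem lenTo_extendOne {n : ℕ} (β : Fin n → Perm (Pt p q)) :
    lenTo (extendOne β) n = ∑ i, absLength (β i) := by
  rw [lenTo, Finset.sum_range]
  simp only [extendOne_val]

end Multichains

end AnnularNC

namespace AnnularNC

/-! ### Multichains and factorizations -/

section Correspondence

variable {p q m : ℕ}

open Equiv Equiv.Perm

namespace ConnFactorization

theorem total (hp : 0 < p) (hq : 0 < q) (β : ConnFactorization p q m) :
    absLength (alpha p q) + 2 = lenTo (extendOne β.1) (m + 1) := by
  rw [lenTo_extendOne, β.2.2.1, absLength_alpha hp hq]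

theorem not_preserves (β : ConnFactorization p q m) :
    ¬ ∀ j < m + 1, PreservesSides (extendOne β.1 j) := fun h => β.2.2.2 fun i x => by
  have := h i i.isLt x
  rwa [extendOne_val] at this

/-- The marked permutations defined by the partial products. -/
noncomputable def marked (hp : 0 < p) (hq : 0 < q) (β : ConnFactorization p q m) (k : ℕ)
    (hk : k ≤ m + 1) : MarkedPerm p q where
  perm := prodTo (extendOne β.1) k
  -- The mark tells whether the excess has been spent within the first `k` factors.
  mark := if lenTo (extendOne β.1) k = absLength (prodTo (extendOne β.1) k) then 0 else 1
  le_of_disconnected h := by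
    rw [isConn_iff, not_not] at h
    rcases chain_cases β.2.1 (β.total hp hq) (preservesSides_alpha p q) β.not_preserves hk with
       ⟨-, h1, -⟩ | ⟨-, -, h1⟩ | ⟨-, h1, -⟩
    · exact h1
    · exact absurd h h1
    · exact h1
  length_of_connected h := by
    rw [isConn_iff] at h
    rcases chain_cases β.2.1 (β.total hp hq) (preservesSides_alpha p q) β.not_preserves hk with
       ⟨-, -, h1, -⟩ | ⟨-, h1, -⟩ | ⟨-, -, h1⟩
    · exact absurd h1 h
    · exact h1
    · exact absurd h1 h
  disconnected_of_mark h := by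
    rw [isConn_iff, not_not]
    rcases chain_cases β.2.1 (β.total hp hq) (preservesSides_alpha p q) β.not_preserves hk with
       ⟨-, -, h1, -⟩ | ⟨h1, -⟩ | ⟨-, -, h1⟩
    · exact h1
    · rw [if_pos h1] at h
      exact absurd h (by decide)
    · exact h1

theorem rank_marked (hp : 0 < p) (hq : 0 < q) (β : ConnFactorization p q m) (k : ℕ)
    (hk : k ≤ m + 1) : (β.marked hp hq k hk).rank = lenTo (extendOne β.1) k := by
  simp only [MarkedPerm.rank, marked]
  rcases chain_cases β.2.1 (β.total hp hq) (preservesSides_alpha p q) β.not_preserves hk with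
       ⟨h1, -⟩ | ⟨h1, -⟩ | ⟨h1, -⟩
  · rw [if_neg (by omega), h1, Fin.val_one, mul_one]
  · rw [if_pos h1, h1, Fin.val_zero, mul_zero, add_zero]
  · rw [if_pos h1, h1, Fin.val_zero, mul_zero, add_zero]

/-- The excess of the partial products never decreases and is 0 or 2, so it stays equal or jumps
once. Before a jump the partial product must be connected: otherwise it is a geodesic product,
everything after the jump is geodesic as well, and all factors would preserve the sides. -/
theorem rel_marked (hp : 0 < p) (hq : 0 < q) (β : ConnFactorization p q m) (k : ℕ)
    (hk : k + 1 ≤ m + 1) :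
    (β.marked hp hq k (by omega)).Rel (β.marked hp hq (k + 1) hk) := by
  have hk' : k ≤ m + 1 := by omega
  have hprod : (prodTo (extendOne β.1) k)⁻¹ * prodTo (extendOne β.1) (k + 1) =
      extendOne β.1 k := inv_mul_cancel_left _ _
  have hlen := lenTo_succ (extendOne β.1) k
  have hle : absLength (prodTo (extendOne β.1) (k + 1)) ≤
      absLength (prodTo (extendOne β.1) k) + absLength (extendOne β.1 k) := absLength_mul_le _ _
  have same : ∀ d, lenTo (extendOne β.1) k = absLength (prodTo (extendOne β.1) k) + d →
      lenTo (extendOne β.1) (k + 1) = absLength (prodTo (extendOne β.1) (k + 1)) + d →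
      (β.marked hp hq k hk').Rel (β.marked hp hq (k + 1) hk) := by
    intro d h1 h2
    refine Or.inl ⟨?_, ?_⟩
    · simp only [marked, h1, h2, Nat.add_eq_left]
    · simp only [marked, AbsLE]
      rw [hprod]
      omega
  have jump : lenTo (extendOne β.1) k = absLength (prodTo (extendOne β.1) k) →
      lenTo (extendOne β.1) (k + 1) = absLength (prodTo (extendOne β.1) (k + 1)) + 2 →
      PreservesSides (prodTo (extendOne β.1) (k + 1)) →
      lenTo (extendOne β.1) (m + 1) ≤ lenTo (extendOne β.1) (k + 1) +
        absLength ((prodTo (extendOne β.1) (k + 1))⁻¹ * alpha p q) →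
      (β.marked hp hq k hk').Rel (β.marked hp hq (k + 1) hk) := by
    intro h1 h2 h3 h4
    refine Or.inr ⟨?_, ?_, ?_, ?_, ?_⟩
    · simp only [marked, if_pos h1]
    · simp only [marked]
      rw [if_neg (by omega)]
    · rw [isConn_iff]
      intro h5
      refine β.not_preserves fun j hj => ?_
      rcases lt_trichotomy j k with hjk | rfl | hjk
      · exact preserves_of_prodTo h5 h1.le j hjk
      · rw [← hprod]
        exact h5.inv.mul h3
      · exact preserves_of_shift hk (by rw [β.2.1]; exact h3.inv.mul (preservesSides_alpha p q))
          (by rw [β.2.1]; exact h4) j hjk hj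
    · rw [isConn_iff, not_not]
      exact h3
    · simp only [marked]
      rw [hprod]
      omega
  rcases chain_cases β.2.1 (β.total hp hq) (preservesSides_alpha p q) β.not_preserves hk' with
       ⟨h1, -⟩ | ⟨h1, -⟩ | ⟨h1, -⟩ <;>
    rcases chain_cases β.2.1 (β.total hp hq) (preservesSides_alpha p q) β.not_preserves hk with
       ⟨h2, -, h3, h4⟩ | ⟨h2, -⟩ | ⟨h2, -⟩
  · exact same 2 h1 h2
  · omega
  · omega
  · exact jump h1 h2 h3 h4
  · exact same 0 h1 h2
  · exact same 0 h1 h2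
  · exact jump h1 h2 h3 h4
  · exact same 0 h1 h2
  · exact same 0 h1 h2

/-- The multichain of the partial products. -/
noncomputable def toMultichain (hp : 0 < p) (hq : 0 < q) (β : ConnFactorization p q m) :
    ConnMultichain p q m where
  -- The empty product 1 and the full product α are left out, so `m + 1` factors give `m` terms.
  elt i := β.marked hp hq (i + 1) (by omega)
  step i j h := by
    have := β.rel_marked hp hq (i + 1) (by omega)
    simpa only [h] using this
  connected := by
    by_contra h
    push Not at h
    have hpres : ∀ k ≤ m + 1, PreservesSides (prodTo (extendOne β.1) k) := by
      intro k hk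
      rcases k with _ | k
      · exact Preserves.one _
      · by_cases hkm : k < m
        · have := h ⟨k, hkm⟩
          rwa [isConn_iff, not_not] at this
        · obtain rfl : k = m := by omega
          rw [β.2.1]
          exact preservesSides_alpha p q
    refine β.not_preserves fun j hj => ?_
    have : (prodTo (extendOne β.1) j)⁻¹ * prodTo (extendOne β.1) (j + 1) = extendOne β.1 j :=
      inv_mul_cancel_left _ _
    rw [← this]
    exact (hpres j (by omega)).inv.mul (hpres (j + 1) (by omega))

theorem toMultichain_injective (hp : 0 < p) (hq : 0 < q) :
    Function.Injective (toMultichain (m := m) hp hq) := by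
  intro β γ h
  have hpr : ∀ k ≤ m + 1, prodTo (extendOne β.1) k = prodTo (extendOne γ.1) k := by
    intro k hk
    rcases k with _ | k
    · rfl
    · by_cases hkm : k < m
      · exact congrArg (fun x => (x.elt ⟨k, hkm⟩).perm) h
      · obtain rfl : k = m := by omega
        rw [β.2.1, γ.2.1]
  apply Subtype.ext
  funext i
  have h1 := hpr (i + 1) (by omega)
  rw [prodTo, prodTo, hpr i (by omega), extendOne_val, extendOne_val] at h1
  exact mul_left_cancel h1

end ConnFactorization

namespace ConnMultichain

/-- The permutations of a multichain, with `1` in front and `alpha p q` at the end. -/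
def perms (x : ConnMultichain p q m) : ℕ → Perm (Pt p q)
  | 0 => 1
  | k + 1 => if h : k < m then (x.elt ⟨k, h⟩).perm else alpha p q

/-- The quotients of consecutive permutations. -/
def factors (x : ConnMultichain p q m) (i : Fin (m + 1)) : Perm (Pt p q) :=
  (x.perms i)⁻¹ * x.perms (i + 1)

theorem perms_succ (x : ConnMultichain p q m) {k : ℕ} (h : k < m) :
    x.perms (k + 1) = (x.elt ⟨k, h⟩).perm := dif_pos h

theorem perms_last (x : ConnMultichain p q m) : x.perms (m + 1) = alpha p q :=
  dif_neg (lt_irrefl m)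

theorem prodTo_factors (x : ConnMultichain p q m) {k : ℕ} (hk : k ≤ m + 1) :
    prodTo (extendOne x.factors) k = x.perms k := by
  induction k with
  | zero => rfl
  | succ k ih =>
    rw [prodTo, ih (by omega), extendOne, dif_pos (by omega), factors, mul_inv_cancel_left]

/-- A mark 1 would persist along the chain, whereas a connected term has mark 0. Hence the rank
starts as a plain length and telescopes. -/
theorem mark_zero (x : ConnMultichain p q m) (hm : 0 < m) : (x.elt ⟨0, hm⟩).mark = 0 := by
  refine (x.elt ⟨0, hm⟩).mark_cases.resolve_right fun h => ?_
  have hall : ∀ k (hk : k < m), (x.elt ⟨k, hk⟩).mark = 1 := by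
    intro k
    induction k with
    | zero => intro _; exact h
    | succ k ih => intro hk; exact (x.step ⟨k, by omega⟩ ⟨k + 1, hk⟩ rfl).mark_eq_one (ih _)
  obtain ⟨i, hi⟩ := x.connected
  exact (x.elt i).disconnected_of_mark (hall i i.isLt) hi

theorem rank_eq (x : ConnMultichain p q m) {k : ℕ} (hk : k < m) :
    (x.elt ⟨k, hk⟩).rank = lenTo (extendOne x.factors) (k + 1) := by
  induction k with
  | zero =>
    rw [MarkedPerm.rank, x.mark_zero hk, Fin.val_zero, lenTo, Finset.sum_range_one, extendOne,
      dif_pos (by omega), factors]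
    simp [perms, hk]
  | succ k ih =>
    rw [(x.step ⟨k, by omega⟩ ⟨k + 1, hk⟩ rfl).rank_eq, ih, lenTo_succ _ (k + 1)]
    congr 2
    rw [extendOne, dif_pos (by omega), factors, perms_succ x (by omega), perms_succ x (by omega)]

/-- Below a disconnected term of mark 0 every term is disconnected, so the chain cannot end in one.
This fixes the total length of the factors at `p + q`. -/
theorem last_cases (x : ConnMultichain p q m) {k : ℕ} (hk : k + 1 = m) :
    IsConn (x.elt ⟨k, by omega⟩).perm ∨ (x.elt ⟨k, by omega⟩).mark = 1 := by
  by_contra! h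
  obtain ⟨h1, h2⟩ := h
  have h3 := (MarkedPerm.mark_cases _).resolve_right h2
  rw [isConn_iff, not_not] at h1
  have hall : ∀ d j (hj : j < m), j + d = k →
      (x.elt ⟨j, hj⟩).mark = 0 ∧ PreservesSides (x.elt ⟨j, hj⟩).perm := by
    intro d
    induction d with
    | zero => rintro j hj rfl; exact ⟨h3, h1⟩
    | succ d ih =>
      intro j hj hjk
      obtain ⟨h4, h5⟩ := ih (j + 1) (by omega) (by omega)
      exact (x.step ⟨j, hj⟩ ⟨j + 1, by omega⟩ rfl).disconnected_left h4 h5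
  obtain ⟨i, hi⟩ := x.connected
  rw [isConn_iff] at hi
  exact hi (hall (k - i) i i.isLt (by omega)).2

/-- The factorization of a multichain. -/
def toFactorization (hp : 0 < p) (hq : 0 < q) (hm : 0 < m) (x : ConnMultichain p q m) :
    ConnFactorization p q m :=
  ⟨x.factors, by rw [prodTo_factors x le_rfl, perms_last], by
    obtain ⟨k, rfl⟩ := Nat.exists_eq_succ_of_ne_zero hm.ne'
    rw [← lenTo_extendOne, lenTo_succ, ← x.rank_eq (Nat.lt_succ_self k), ← absLength_alpha hp hq,
      ← MarkedPerm.rank_add_of_mark (x.last_cases rfl), extendOne, dif_pos (by omega), factors,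
      perms_succ x (Nat.lt_succ_self k), perms_last], by
    intro h
    obtain ⟨i, hi⟩ := x.connected
    rw [isConn_iff] at hi
    apply hi
    rw [← perms_succ x i.isLt, ← prodTo_factors x (by omega)]
    apply Preserves.prodTo
    intro j hj
    rw [extendOne, dif_pos (by omega)]
    exact h _⟩

theorem toMultichain_toFactorization (hp : 0 < p) (hq : 0 < q) (hm : 0 < m)
    (x : ConnMultichain p q m) : (x.toFactorization hp hq hm).toMultichain hp hq = x := by
  apply ConnMultichain.ext_of
  intro i
  have h1 : (((x.toFactorization hp hq hm).toMultichain hp hq).elt i).perm = (x.elt i).perm := by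
    change prodTo (extendOne x.factors) (i + 1) = _
    rw [prodTo_factors x (by omega), perms_succ x i.isLt]
  have h2 : (((x.toFactorization hp hq hm).toMultichain hp hq).elt i).rank = (x.elt i).rank := by
    rw [x.rank_eq i.isLt]
    exact (x.toFactorization hp hq hm).rank_marked hp hq (i + 1) (by omega)
  -- The permutation and the rank together determine the mark.
  refine MarkedPerm.ext_of h1 ?_
  rw [MarkedPerm.rank, MarkedPerm.rank, h1] at h2
  exact Fin.ext (by omega)

end ConnMultichain

/-- Factorizations correspond to multichains. -/
noncomputable def factorizationEquiv (hp : 0 < p) (hq : 0 < q) (hm : 0 < m) :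
    ConnFactorization p q m ≃ ConnMultichain p q m :=
  Equiv.ofBijective (ConnFactorization.toMultichain hp hq)
    ⟨ConnFactorization.toMultichain_injective hp hq,
      fun x => ⟨x.toFactorization hp hq hm, x.toMultichain_toFactorization hp hq hm⟩⟩

theorem exists_parenData_equiv (hp : 0 < p) (hq : 0 < q) :
    ∃ Φ : ParenData p q m ≃ ConnFactorization p q m, ∀ τ i,
      absLength ((Φ τ).1 i) = (τ.2.2.1.1 i).card + (τ.2.2.2.1 i).card := by
  -- Only the first `m + 1` weights occur; they are independent variables, and the value 0 beyond
  -- them is irrelevant.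
  let t : ℕ → MvPolynomial (Fin (m + 1)) ℤ := fun k =>
    if h : k < m + 1 then MvPolynomial.X ⟨k, h⟩ else 0
  have ht : ∀ i : Fin (m + 1), t i = MvPolynomial.X i := fun i => dif_pos i.isLt
  have h := (sum_parenData t p q m).trans (coeff_conSum_alpha hp hq t (m + 1)).symm
  rw [coeff_conSum_eq_sum] at h
  simp only [ht] at h
  obtain ⟨Φ, hΦ⟩ := exists_equiv_of_sum_eq
    (fun (τ : ParenData p q m) i => (τ.2.2.1.1 i).card + (τ.2.2.2.1 i).card)
    (fun (β : ConnFactorization p q m) i => absLength (β.1 i)) h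
  exact ⟨Φ, fun τ i => congrFun (hΦ τ) i⟩

theorem rank_factorizationEquiv (hp : 0 < p) (hq : 0 < q) (hm : 0 < m)
    (β : ConnFactorization p q m) (i : Fin m) :
    ((factorizationEquiv hp hq hm β).elt i).rank +
      ∑ j ∈ Finset.Ici i, absLength (β.1 j.succ) = p + q := by
  have h1 : ((factorizationEquiv hp hq hm β).elt i).rank = lenTo (extendOne β.1) (i + 1) :=
    β.rank_marked hp hq (i + 1) (by omega)
  have h2 : ∑ j ∈ Finset.Ici i, absLength (β.1 j.succ) =
      ∑ k ∈ Finset.Ico (i + 1 : ℕ) (m + 1), absLength (extendOne β.1 k) := by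
    rw [← Finset.sum_Ico_add', ← Fin.map_valEmbedding_Ici, Finset.sum_map]
    refine Finset.sum_congr rfl fun j _ => ?_
    rw [← extendOne_val β.1 j.succ]
    rfl
  rw [h1, h2, lenTo, Finset.sum_range_add_sum_Ico _ (by omega)]
  exact (lenTo_extendOne β.1).trans β.2.2.1

end Correspondence

end AnnularNC

theorem mainTheorem6 (p q m : ℕ) (hp : 0 < p) (hq : 0 < q) (hm : 0 < m) :
    ∃ Φ : AnnularNC.ParenTuple p q m ≃ AnnularNC.ConnMultichain p q m,
      ∀ (t : AnnularNC.ParenTuple p q m) (i : Fin m),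
        ((((Φ t).elt i).rank : ℕ) : ℤ) =
          (p : ℤ) + q - ∑ j ∈ Finset.Ici i, (((t.RE j).card : ℤ) + ((t.RI j).card : ℤ)) := by
  obtain ⟨Ψ, hΨ⟩ := AnnularNC.exists_parenData_equiv (m := m) hp hq
  refine ⟨(AnnularNC.parenEquiv p q m).trans
    (Ψ.trans (AnnularNC.factorizationEquiv hp hq hm)), fun t i => ?_⟩
  have h := AnnularNC.rank_factorizationEquiv hp hq hm (Ψ (AnnularNC.parenEquiv p q m t)) i
  simp only [hΨ] at h
  simp only [Equiv.trans_apply]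
  -- Factor 0, matched with the complements of `LE` and `LI`, never enters the sum; factor `j.succ`
  -- is matched with `RE j` and `RI j`.
  have h' : ∀ j : Fin m, (((AnnularNC.parenEquiv p q m t).2.2.1.1 j.succ).card +
      ((AnnularNC.parenEquiv p q m t).2.2.2.1 j.succ).card) = (t.RE j).card + (t.RI j).card :=
    fun _ => rfl
  simp only [h'] at h
  rw [eq_sub_iff_add_eq]
  exact_mod_cast h
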